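/- **Notation.** Write $\hat f(\xi)=\mathcal F f(\xi)=\int_{\mathbb R^d} f(t)e^{-2\pi i t\cdot\xi}\,dt$. For $f\in\mathcal S'(\mathbb R^d)$ and a window $g\in\mathcal S(\mathbb R^d)\setminus\{0\}$, let $V_gf(x,\xi)=\langle f, e^{2\pi i\xi\cdot}g(\cdot-x)\rangle=\int f(y)\overline{g(y-x)}e^{-2\pi i\xi\cdot y}\,dy$ be the short-time Fourier transform. For $1\le p,q\le\infty$, the modulation space $M^{p,q}(\mathbb R^d)$ consists of all $f\in\mathcal S'(\mathbb R^d)$ with $$\|f\|_{M^{p,q}}=\big\|\,\xi\mapsto\|V_gf(\cdot,\xi)\|_{L^p}\big\|_{L^q}<\infty .$$ The Wiener amalgam space $W(\mathcal FL^1,L^\infty)(\mathbb R^d)$ consists of all $f\in\mathcal S'(\mathbb R^d)$ with $$\|f\|_{W(\mathcal FL^1,L^\infty)}=\sup_{x\in\mathbb R^d}\|\mathcal F(g(\cdot-x)f)\|_{L^1}<\infty .$$ Different windows $g$ give the same spaces with equivalent norms. **Theorem 1.1.** Let $\mathcal A$ be the set of real-valued $\mu\in C^2(\mathbb R^d)$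 with $\partial^\gamma\mu\in W(\mathcal FL^1,L^\infty)(\mathbb R^d)$ for all multi-indices $\gamma$ with $|\gamma|=2$. 1. There is a constant $C>0$, depending only on $d$ and on the windows used to define the norms, such that for every $\mu\in\mathcal A$ the function $e^{i\mu}$ belongs to $W(\mathcal FL^1,L^\infty)(\mathbb R^d)$ and $$\|e^{i\mu}\|_{W(\mathcal FL^1,L^\infty)}\le C\exp\Big(C\sum_{|\gamma|=2}\|\partial^\gamma\mu\|_{W(\mathcal FL^1,L^\infty)}\Big).$$ 2. Let $\mu\in\mathcal A$ and $1\le p,q\le\infty$. Then the Fourier multiplier $e^{i\mu(D)}f=\mathcal F^{-1}(e^{i\mu}\hat f)$ is well defined on $M^{p,q}(\mathbb R^d)$ and is a bounded linear operator $M^{p,q}(\mathbb R^d)\to M^{p,q}(\mathbb R^d)$. For $f\in\mathcal S(\mathbb R^d)$ it is given by $e^{i\mu(D)}f(x)=\int_{\mathbb R^d} e^{2\pi i x\cdot\xi}e^{i\mu(\xi)}\hat f(\xi)\,d\xi$. For general $f\in M^{p,q}(\mathbb R^d)$ the product $e^{i\mu}\hat f\in\mathcal S'(\mathbb R^d)$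 is the one determined by $\mathcal F(\varphi\psi\, e^{i\mu}\hat f)=\mathcal F(\varphi e^{i\mu})*\mathcal F(\psi\hat f)$ for all $\varphi,\psi\in C_0^\infty(\mathbb R^d)$, with absolutely convergent convolution integrals. -/

import Mathlib

open MeasureTheory FourierTransform SchwartzMap
open scoped ENNReal NNReal

namespace TimeFrequency

/-- The space `ℝ^d` with its Euclidean norm and Lebesgue measure. -/
abbrev Euc (d : ℕ) : Type := EuclideanSpace ℝ (Fin d)

/-- The complex exponential `t ↦ e^{2πit}` is smooth with polynomially bounded derivatives. -/
theorem hasTemperateGrowth_exp :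
    (fun t : ℝ => Complex.exp (2 * Real.pi * Complex.I * t)).HasTemperateGrowth := by
  have key : ∀ (n : ℕ) (t : ℝ),
      iteratedDeriv n (fun t : ℝ => Complex.exp (2 * Real.pi * Complex.I * t)) t
        = (2 * Real.pi * Complex.I) ^ n * Complex.exp (2 * Real.pi * Complex.I * t) := by
    intro n
    induction n with
    | zero => intro t; simp
    | succ k ih =>
      intro t
      rw [iteratedDeriv_succ, funext ih]
      have h1 : HasDerivAt (fun t : ℝ => 2 * Real.pi * Complex.I * (t : ℂ))
          (2 * Real.pi * Complex.I) t := by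
        simpa using (Complex.ofRealCLM.hasDerivAt (x := t)).const_mul (2 * Real.pi * Complex.I)
      rw [((h1.cexp).const_mul _).deriv]
      ring
  refine ⟨(contDiff_const.mul Complex.ofRealCLM.contDiff).cexp, fun n => ⟨0, ‖(2 * Real.pi * Complex.I) ^ n‖, fun t => ?_⟩⟩
  rw [norm_iteratedFDeriv_eq_norm_iteratedDeriv, key, norm_mul, pow_zero, mul_one]
  have : ‖Complex.exp (2 * Real.pi * Complex.I * t)‖ = 1 := by
    have h := Complex.norm_exp_ofReal_mul_I (2 * Real.pi * t)
    rw [← h]; congr 2; push_cast; ring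
  rw [this, mul_one]

/-- The character `y ↦ e^{-2πi y·ξ}`. -/
noncomputable def character {d : ℕ} (ξ : Euc d) (y : Euc d) : ℂ :=
  Complex.exp (2 * Real.pi * Complex.I * ((-inner ℝ y ξ : ℝ) : ℂ))

theorem hasTemperateGrowth_character {d : ℕ} (ξ : Euc d) :
    (character ξ).HasTemperateGrowth := by
  have h : (fun y : Euc d => (-inner ℝ y ξ : ℝ)).HasTemperateGrowth :=
    (Function.hasTemperateGrowth_inner_left ξ).neg
  exact hasTemperateGrowth_exp.comp h

/-- The Schwartz function `y ↦ e^{-2πi y·ξ} g(y - x)`. -/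
noncomputable def atom {d : ℕ} (g : 𝓢(Euc d, ℂ)) (x ξ : Euc d) : 𝓢(Euc d, ℂ) :=
  SchwartzMap.smulLeftCLM ℂ (character ξ) (SchwartzMap.compSubConstCLM ℂ x g)

theorem atom_apply {d : ℕ} (g : 𝓢(Euc d, ℂ)) (x ξ y : Euc d) :
    atom g x ξ y = character ξ y * g (y - x) := by
  simp [atom, SchwartzMap.smulLeftCLM_apply_apply (hasTemperateGrowth_character ξ)]

/-- The function `ξ ↦ 𝓕(g(· - x) u)(ξ) = ⟨u, e^{-2πi ξ·} g(· - x)⟩`, the (smooth) Fourier transform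
of the product of the tempered distribution `u` with the translated Schwartz function `g(· - x)`. -/
noncomputable def windowedFourier {d : ℕ} (g : 𝓢(Euc d, ℂ)) (u : 𝓢'(Euc d, ℂ))
    (x ξ : Euc d) : ℂ :=
  u (atom g x ξ)

/-- The complex conjugate of a Schwartz function. -/
noncomputable def conjWindow {d : ℕ} (g : 𝓢(Euc d, ℂ)) : 𝓢(Euc d, ℂ) :=
  SchwartzMap.postcompCLM (𝕜 := ℝ) (Complex.conjCLE : ℂ →L[ℝ] ℂ) g

theorem conjWindow_apply {d : ℕ} (g : 𝓢(Euc d, ℂ)) (y : Euc d) :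
    conjWindow g y = starRingEnd ℂ (g y) := rfl

/-- The short-time Fourier transform
`V_g f(x, ξ) = ⟨f, M_ξ T_x g⟩ = ∫ e^{-2πi ξ·y} f(y) conj(g(y - x)) dy`
of a tempered distribution `f`. -/
noncomputable def stft {d : ℕ} (g : 𝓢(Euc d, ℂ)) (f : 𝓢'(Euc d, ℂ)) (x ξ : Euc d) : ℂ :=
  windowedFourier (conjWindow g) f x ξ

/-- The norm of the modulation space `M^{p,q}(ℝ^d)` computed with the window `g`:
the `L^q` norm in `ξ` of the `L^p` norm in `x` of `V_g f(x, ξ)`.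
The space `M^{p,q}(ℝ^d)` consists of the tempered distributions for which it is finite. -/
noncomputable def modulationENorm {d : ℕ} (g : 𝓢(Euc d, ℂ)) (p q : ℝ≥0∞)
    (f : 𝓢'(Euc d, ℂ)) : ℝ≥0∞ :=
  eLpNorm (fun ξ => eLpNorm (fun x => stft g f x ξ) p volume) q volume

/-- The norm `sup_x ‖g(· - x) u‖_{𝓕L¹} = sup_x ‖𝓕(g(· - x) u)‖_{L¹}` of the Wiener amalgam space
`W(𝓕L¹, L^∞)(ℝ^d)`, for a tempered distribution `u`. -/
noncomputable def distAmalgamENorm {d : ℕ} (g : 𝓢(Euc d, ℂ)) (u : 𝓢'(Euc d, ℂ)) : ℝ≥0∞ :=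
  ⨆ x : Euc d, eLpNorm (windowedFourier g u x) 1 volume

/-- The tempered distribution `u` is the one given by the locally integrable function `F`. Testing
against compactly supported functions only means that `F` need not grow slowly a priori. -/
def Represents {d : ℕ} (F : Euc d → ℂ) (u : 𝓢'(Euc d, ℂ)) : Prop :=
  LocallyIntegrable F volume ∧
    ∀ φ : 𝓢(Euc d, ℂ), HasCompactSupport (φ : Euc d → ℂ) → u φ = ∫ y, F y * φ y

/-- The `W(𝓕L¹, L^∞)` norm of a function `F`: that of the unique tempered distribution
given by `F`, and `∞` if there is none. -/
noncomputable def amalgamENorm {d : ℕ} (g : 𝓢(Euc d, ℂ)) (F : Euc d → ℂ) : ℝ≥0∞ :=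
  ⨅ (u : 𝓢'(Euc d, ℂ)) (_ : Represents F u), distAmalgamENorm g u

/-- `h = σ · u`, the (Fourier) product of a function `σ` and a tempered distribution `u`, which
localizes both factors and multiplies by convolving the Fourier transforms:
`𝓕((φσ)(ψu)) = 𝓕(φσ) ∗ 𝓕(ψu)` for all `φ, ψ ∈ C_c^∞(ℝ^d)`, the convolution integrals being
absolutely convergent. There is at most one such `h`. -/
def IsProduct {d : ℕ} (σ : Euc d → ℂ) (u h : 𝓢'(Euc d, ℂ)) : Prop :=
  ∀ φ ψ : 𝓢(Euc d, ℂ), HasCompactSupport (φ : Euc d → ℂ) → HasCompactSupport (ψ : Euc d → ℂ) →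
    ∀ ξ : Euc d,
      Integrable (fun η => 𝓕 (fun y => φ y * σ y) (ξ - η) * windowedFourier ψ u 0 η) volume ∧
      windowedFourier (SchwartzMap.smulLeftCLM ℂ (φ : Euc d → ℂ) ψ) h 0 ξ =
        ∫ η, 𝓕 (fun y => φ y * σ y) (ξ - η) * windowedFourier ψ u 0 η

/-- `h = σ(D) f = 𝓕⁻¹(σ · 𝓕 f)`, the Fourier multiplier with symbol `σ` applied to `f`. -/
def IsMultiplierImage {d : ℕ} (σ : Euc d → ℂ) (f h : 𝓢'(Euc d, ℂ)) : Prop :=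
  IsProduct σ (𝓕 f) (𝓕 h)

/-- The symbol `e^{iμ(ξ)}`. -/
noncomputable def unimodular {d : ℕ} (μ : Euc d → ℝ) (ξ : Euc d) : ℂ :=
  Complex.exp (Complex.I * (μ ξ : ℂ))

/-- The second partial derivative `∂_i ∂_j μ`, as a complex-valued function. -/
noncomputable def secondPartial {d : ℕ} (μ : Euc d → ℝ) (i j : Fin d) (ξ : Euc d) : ℂ :=
  ((fderiv ℝ (fun η => fderiv ℝ μ η (EuclideanSpace.single j 1)) ξ
    (EuclideanSpace.single i 1) : ℝ) : ℂ)

/-- `μ` is of class `C²` and its second derivatives lie in `W(𝓕L¹, L^∞)(ℝ^d)`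
(tested with the window `g`). -/
def AdmissiblePhase {d : ℕ} (g : 𝓢(Euc d, ℂ)) (μ : Euc d → ℝ) : Prop :=
  ContDiff ℝ 2 μ ∧ ∀ i j : Fin d, amalgamENorm g (secondPartial μ i j) < ∞

end TimeFrequency

/-! The proof works with the windowed Fourier transform `W_g u (x, ξ) = 𝓕(g(· - x) u)(ξ)`, in terms of
which both the modulation norms and the amalgam norm are defined. Two general facts carry
everything else.

* The reproducing formula `apply_eq_integral_windowedFourier`: if `∫ b γ = 1`, then
  `u ψ = ∫∫ W_b ψ (z, -η) W_γ u (z, η) dz dη` for a Schwartz function `ψ` and a tempered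
  distribution `u`. It rests on the rapid decay of `W_b ψ`, and on the fact that a tempered
  distribution may be applied under an absolutely convergent integral of Schwartz functions
  (`apply_eq_integral`). Together with the inequalities of Minkowski and Young it shows that
  different windows give equivalent norms.
* The functions that are inverse Fourier transforms of integrable functions form an algebra
  (`IsFourierL1`), in which the exponential series converges.

For the bound on `e^{iμ}`, fix `x` and expand `μ(x + y)` to second order in `y`. The exponential of
the constant term is a number of modulus one, that of the linear term is a character, and
multiplication by either leaves the `𝓕L¹` norm unchanged. The remainder is
`∑ y_i y_j ∫₀¹ (1 - t) ∂_i∂_jμ(x + ty) dt`. Near `y = 0` the factor `∂_i∂_jμ(x + ·)` coincides with a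
function `P` whose `𝓕L¹` norm is controlled by the amalgam norm of `∂_i∂_jμ`, uniformly in `x`. The
average over `t` of the dilates `P(t ·)` is the inverse Fourier transform of a finite measure whose
total mass is at most that norm, and its product with the Schwartz function `y_i y_j χ(y)`, where `χ`
is a cutoff, is in `𝓕L¹` (`IsFourierL1.mul_segmentAverage`). So a cutoff of the remainder lies in
`𝓕L¹`, and the exponential series gives the claim
(`isFourierL1_cutoff_mul_unimodular`).

For the multiplier, let `s` be the tempered distribution given by `σ = e^{iμ}` and let `u = 𝓕 f`. The
product `σ u` should act on `φ` as `u` acts on `φ σ`. The latter is not a Schwartz function, but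
its windowed Fourier transform is integrable since `W_{θθ'}(φ s)(z, ·)` is the convolution of
`W_θ s (z, ·)` and `W_{θ'} φ (z, ·)`, while that of `u` is bounded because every modulation space lies in
`M^{∞,∞}`. Hence the reproducing formula defines `σ u` as a tempered distribution (`exists_product`).
The identity `W_{φψ}(σ u)(x, ·) = W_φ s (x, ·) ∗ W_ψ u (x, ·)` (`windowedFourier_product`) then gives at
`x = 0` the characterization of the product, and by Minkowski's inequality the bound on `M^{p,q}`,
because the Fourier transform exchanges the roles of the two variables of the short-time Fourier
transform up to a phase factor (`norm_stft_conjWindow_fourier`). -/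

namespace TimeFrequency

open Filter Topology

/-! ### Seminorms on the Schwartz space -/

/-- The largest of the Schwartz seminorms of order at most `m`: an increasing sequence of seminorms
that defines the topology of the Schwartz space. -/
noncomputable def schwartzNorm {d : ℕ} (m : ℕ) : Seminorm ℂ 𝓢(Euc d, ℂ) :=
  (Finset.Iic (m, m)).sup (schwartzSeminormFamily ℂ (Euc d) ℂ)

theorem schwartzNorm_mono {d m m' : ℕ} (h : m ≤ m') (φ : 𝓢(Euc d, ℂ)) :
    schwartzNorm m φ ≤ schwartzNorm m' φ := by
  have : (schwartzNorm m : Seminorm ℂ 𝓢(Euc d, ℂ)) ≤ schwartzNorm m' :=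
    Finset.sup_mono (Finset.Iic_subset_Iic.2 (Prod.mk_le_mk.2 ⟨h, h⟩))
  exact this φ

theorem one_add_pow_mul_le_schwartzNorm {d m k n : ℕ} (hk : k ≤ m) (hn : n ≤ m)
    (φ : 𝓢(Euc d, ℂ)) (y : Euc d) :
    (1 + ‖y‖) ^ k * ‖iteratedFDeriv ℝ n φ y‖ ≤ 2 ^ m * schwartzNorm m φ :=
  one_add_le_sup_seminorm_apply (𝕜 := ℂ) (m := (m, m)) hk hn φ y

theorem one_add_pow_mul_norm_le {d m k : ℕ} (hk : k ≤ m) (φ : 𝓢(Euc d, ℂ)) (y : Euc d) :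
    (1 + ‖y‖) ^ k * ‖φ y‖ ≤ 2 ^ m * schwartzNorm m φ := by
  simpa using one_add_pow_mul_le_schwartzNorm hk (Nat.zero_le m) φ y

theorem schwartzNorm_le {d m : ℕ} (φ : 𝓢(Euc d, ℂ)) {M : ℝ} (hM : 0 ≤ M)
    (h : ∀ k ≤ m, ∀ n ≤ m, ∀ y, (1 + ‖y‖) ^ k * ‖iteratedFDeriv ℝ n φ y‖ ≤ M) :
    schwartzNorm m φ ≤ M := by
  refine Seminorm.finset_sup_apply_le hM fun i hi => ?_
  obtain ⟨hk, hn⟩ := Prod.mk_le_mk.1 (Finset.mem_Iic.1 hi)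
  refine SchwartzMap.seminorm_le_bound ℂ _ _ φ hM fun y => le_trans ?_ (h i.1 hk i.2 hn y)
  gcongr
  linarith

theorem seminorm_le_schwartzNorm {d m k n : ℕ} (hk : k ≤ m) (hn : n ≤ m) (φ : 𝓢(Euc d, ℂ)) :
    SchwartzMap.seminorm ℂ k n φ ≤ schwartzNorm m φ := by
  have : schwartzSeminormFamily ℂ (Euc d) ℂ (k, n) ≤ schwartzNorm m :=
    Finset.le_sup (f := schwartzSeminormFamily ℂ (Euc d) ℂ)
      (Finset.mem_Iic.2 (Prod.mk_le_mk.2 ⟨hk, hn⟩))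
  exact this φ

theorem continuous_schwartzNorm {d : ℕ} (m : ℕ) :
    Continuous (schwartzNorm m : Seminorm ℂ 𝓢(Euc d, ℂ)) := by
  have : (schwartzNorm m : Seminorm ℂ 𝓢(Euc d, ℂ)) = (Finset.Iic (m, m)).sup
      (schwartzSeminormFamily ℂ (Euc d) ℂ) := rfl
  rw [this]
  refine Finset.sup_induction (p := fun q : Seminorm ℂ 𝓢(Euc d, ℂ) => Continuous q) ?_ ?_ ?_
  · exact continuous_const
  · intro a ha b hb
    exact ha.max hb
  · intro i _
    exact (schwartz_withSeminorms ℂ (Euc d) ℂ).continuous_seminorm i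

theorem exists_sup_le_schwartzNorm {d : ℕ} (s : Finset (ℕ × ℕ)) :
    ∃ m : ℕ, s.sup (schwartzSeminormFamily ℂ (Euc d) ℂ) ≤ schwartzNorm m := by
  refine ⟨s.sup fun i => max i.1 i.2, Finset.sup_mono fun i hi => ?_⟩
  have h : max i.1 i.2 ≤ s.sup fun i => max i.1 i.2 := Finset.le_sup (f := fun i => max i.1 i.2) hi
  exact Finset.mem_Iic.2 (Prod.mk_le_mk.2
    ⟨(le_max_left _ _).trans h, (le_max_right _ _).trans h⟩)

/-- Every continuous seminorm on the Schwartz space is dominated by some `schwartzNorm m`. -/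
theorem exists_le_schwartzNorm {d : ℕ} (q : Seminorm ℂ 𝓢(Euc d, ℂ)) (hq : Continuous q) :
    ∃ (m : ℕ) (C : ℝ), 0 ≤ C ∧ ∀ φ, q φ ≤ C * schwartzNorm m φ := by
  obtain ⟨s, C, -, h⟩ := Seminorm.bound_of_continuous (schwartz_withSeminorms ℂ (Euc d) ℂ) q hq
  obtain ⟨m, hm⟩ := exists_sup_le_schwartzNorm (d := d) s
  exact ⟨m, C, C.2, fun φ => (h φ).trans (mul_le_mul_of_nonneg_left (hm φ) C.2)⟩

theorem exists_schwartzNorm_map_le {d : ℕ} (A : 𝓢(Euc d, ℂ) →L[ℂ] 𝓢(Euc d, ℂ)) (m : ℕ) :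
    ∃ (m' : ℕ) (C : ℝ), 0 ≤ C ∧ ∀ φ, schwartzNorm m (A φ) ≤ C * schwartzNorm m' φ :=
  exists_le_schwartzNorm ((schwartzNorm m).comp A.toLinearMap)
    ((continuous_schwartzNorm m).comp A.continuous)

theorem exists_norm_apply_le {d : ℕ} (u : 𝓢'(Euc d, ℂ)) :
    ∃ (m : ℕ) (C : ℝ), 0 ≤ C ∧ ∀ φ, ‖u φ‖ ≤ C * schwartzNorm m φ :=
  exists_le_schwartzNorm ((normSeminorm ℂ ℂ).comp u.toLinearMap)
    (continuous_norm.comp u.continuous)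

theorem tendsto_schwartz_iff {d : ℕ} {ι : Type*} {l : Filter ι} {f : ι → 𝓢(Euc d, ℂ)}
    {φ : 𝓢(Euc d, ℂ)} :
    Tendsto f l (𝓝 φ) ↔ ∀ m, Tendsto (fun i => schwartzNorm m (f i - φ)) l (𝓝 0) := by
  constructor
  · intro h m
    have := ((continuous_schwartzNorm (d := d) m).tendsto 0).comp (tendsto_sub_nhds_zero_iff.2 h)
    simpa [Function.comp_def] using this
  · intro h
    rw [(schwartz_withSeminorms ℂ (Euc d) ℂ).tendsto_nhds]
    intro i ε hε
    filter_upwards [(h (max i.1 i.2)).eventually_lt_const hε] with j hj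
    exact (seminorm_le_schwartzNorm (le_max_left _ _) (le_max_right _ _) _).trans_lt hj

/-! ### Translations and modulations on the Schwartz space -/

theorem one_add_norm_le_mul {d : ℕ} (x y : Euc d) : 1 + ‖y‖ ≤ (1 + ‖x‖) * (1 + ‖y - x‖) := by
  have : ‖y‖ ≤ ‖y - x‖ + ‖x‖ := by simpa using norm_add_le (y - x) x
  nlinarith [norm_nonneg x, norm_nonneg (y - x)]

theorem iteratedFDeriv_translate {d : ℕ} (g : 𝓢(Euc d, ℂ)) (x y : Euc d) (n : ℕ) :
    iteratedFDeriv ℝ n (compSubConstCLM ℂ x g) y = iteratedFDeriv ℝ n g (y - x) := by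
  have : (compSubConstCLM ℂ x g : Euc d → ℂ) = fun y => g (y - x) := rfl
  rw [this, iteratedFDeriv_comp_sub]

theorem schwartzNorm_translate_le {d m : ℕ} (g : 𝓢(Euc d, ℂ)) (x : Euc d) :
    schwartzNorm m (compSubConstCLM ℂ x g) ≤ (1 + ‖x‖) ^ m * (2 ^ m * schwartzNorm m g) := by
  refine schwartzNorm_le _ (by positivity) fun k hk n hn y => ?_
  rw [iteratedFDeriv_translate]
  calc (1 + ‖y‖) ^ k * ‖iteratedFDeriv ℝ n g (y - x)‖
      ≤ ((1 + ‖x‖) * (1 + ‖y - x‖)) ^ k * ‖iteratedFDeriv ℝ n g (y - x)‖ := by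
        gcongr; exact one_add_norm_le_mul x y
    _ = (1 + ‖x‖) ^ k * ((1 + ‖y - x‖) ^ k * ‖iteratedFDeriv ℝ n g (y - x)‖) := by
        rw [mul_pow, mul_assoc]
    _ ≤ (1 + ‖x‖) ^ m * (2 ^ m * schwartzNorm m g) := by
        refine mul_le_mul ?_ (one_add_pow_mul_le_schwartzNorm hk hn g _) (by positivity)
          (by positivity)
        exact pow_le_pow_right₀ (by linarith [norm_nonneg x]) hk

/-- Translations are Lipschitz at the identity, with the loss of one derivative. -/
theorem schwartzNorm_translate_sub_le {d m : ℕ} (g : 𝓢(Euc d, ℂ)) (x : Euc d) :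
    schwartzNorm m (compSubConstCLM ℂ x g - g) ≤
      ‖x‖ * ((1 + ‖x‖) ^ m * (2 ^ (m + 1) * schwartzNorm (m + 1) g)) := by
  refine schwartzNorm_le _ (by positivity) fun k hk n hn y => ?_
  have hsub : iteratedFDeriv ℝ n (compSubConstCLM ℂ x g - g : 𝓢(Euc d, ℂ)) y =
      iteratedFDeriv ℝ n g (y - x) - iteratedFDeriv ℝ n g y := by
    have h1 : ((compSubConstCLM ℂ x g - g : 𝓢(Euc d, ℂ)) : Euc d → ℂ) =
      (compSubConstCLM ℂ x g : Euc d → ℂ) - (g : Euc d → ℂ) := rfl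
    rw [h1, iteratedFDeriv_sub_apply ((compSubConstCLM ℂ x g).contDiffAt n) (g.contDiffAt n),
      iteratedFDeriv_translate]
  rw [hsub]
  set M := 2 ^ (m + 1) * schwartzNorm (m + 1) g with hMdef
  have hM : 0 ≤ M := by positivity
  have key : ‖iteratedFDeriv ℝ n g (y - x) - iteratedFDeriv ℝ n g y‖ ≤
      ((1 + ‖x‖) ^ k * M / (1 + ‖y‖) ^ k) * ‖(y - x) - y‖ := by
    refine (convex_segment (𝕜 := ℝ) y (y - x)).norm_image_sub_le_of_norm_fderiv_le (𝕜 := ℝ)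
      (f := iteratedFDeriv ℝ n g) (fun z _ => ?_) (fun z hz => ?_)
      (left_mem_segment ℝ _ _) (right_mem_segment ℝ _ _)
    · exact ((g.smooth ⊤).differentiable_iteratedFDeriv (by exact_mod_cast ENat.natCast_lt_top n)) z
    · rw [norm_fderiv_iteratedFDeriv, le_div_iff₀ (by positivity)]
      have hz' : ‖y - z‖ ≤ ‖x‖ := by
        rw [segment_eq_image'] at hz
        obtain ⟨t, ⟨h0, h1⟩, rfl⟩ := hz
        simp only [sub_sub_cancel_left, smul_neg, sub_add_cancel_left, neg_neg, norm_smul,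
          Real.norm_eq_abs, abs_of_nonneg h0]
        exact mul_le_of_le_one_left (norm_nonneg _) h1
      have hyz : 1 + ‖y‖ ≤ (1 + ‖x‖) * (1 + ‖z‖) := by
        have : ‖y‖ ≤ ‖y - z‖ + ‖z‖ := by simpa using norm_add_le (y - z) z
        nlinarith [norm_nonneg x, norm_nonneg z]
      calc ‖iteratedFDeriv ℝ (n + 1) g z‖ * (1 + ‖y‖) ^ k
          ≤ ‖iteratedFDeriv ℝ (n + 1) g z‖ * ((1 + ‖x‖) * (1 + ‖z‖)) ^ k := by gcongr
        _ = (1 + ‖x‖) ^ k * ((1 + ‖z‖) ^ k * ‖iteratedFDeriv ℝ (n + 1) g z‖) := by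
            rw [mul_pow]; ring
        _ ≤ (1 + ‖x‖) ^ k * M := by
            gcongr
            exact one_add_pow_mul_le_schwartzNorm (by omega) (by omega) g z
  calc (1 + ‖y‖) ^ k * ‖iteratedFDeriv ℝ n g (y - x) - iteratedFDeriv ℝ n g y‖
      ≤ (1 + ‖y‖) ^ k * (((1 + ‖x‖) ^ k * M / (1 + ‖y‖) ^ k) * ‖(y - x) - y‖) := by gcongr
    _ = ‖x‖ * ((1 + ‖x‖) ^ k * M) := by
        have : ‖(y - x) - y‖ = ‖x‖ := by simp
        rw [this]
        have : (1 + ‖y‖) ^ k ≠ 0 := by positivity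
        field_simp
    _ ≤ ‖x‖ * ((1 + ‖x‖) ^ m * M) := by
        gcongr
        linarith [norm_nonneg x]

theorem continuous_translate {d : ℕ} :
    Continuous fun p : Euc d × 𝓢(Euc d, ℂ) => compSubConstCLM ℂ p.1 p.2 := by
  rw [continuous_iff_continuousAt]
  rintro ⟨x₀, ψ₀⟩
  refine tendsto_schwartz_iff.2 fun m => ?_
  have hsplit : ∀ p : Euc d × 𝓢(Euc d, ℂ),
      compSubConstCLM ℂ p.1 p.2 - compSubConstCLM ℂ x₀ ψ₀ = compSubConstCLM ℂ p.1 (p.2 - ψ₀) +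
        compSubConstCLM ℂ x₀ (compSubConstCLM ℂ (p.1 - x₀) ψ₀ - ψ₀) := by
    intro p
    rw [map_sub, map_sub, compSubConstCLM_comp, sub_add_cancel]
    abel
  refine squeeze_zero (g := fun p : Euc d × 𝓢(Euc d, ℂ) =>
      (1 + ‖p.1‖) ^ m * (2 ^ m * schwartzNorm m (p.2 - ψ₀)) +
      (1 + ‖x₀‖) ^ m * (2 ^ m * (‖p.1 - x₀‖ *
        ((1 + ‖p.1 - x₀‖) ^ m * (2 ^ (m + 1) * schwartzNorm (m + 1) ψ₀)))))
    (fun _ => apply_nonneg _ _) (fun p => ?_) ?_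
  · rw [hsplit]
    refine (map_add_le_add _ _ _).trans (add_le_add (schwartzNorm_translate_le _ _) ?_)
    refine (schwartzNorm_translate_le _ _).trans ?_
    gcongr
    exact schwartzNorm_translate_sub_le _ _
  · have hc : Continuous fun p : Euc d × 𝓢(Euc d, ℂ) =>
      (1 + ‖p.1‖) ^ m * (2 ^ m * schwartzNorm m (p.2 - ψ₀)) +
      (1 + ‖x₀‖) ^ m * (2 ^ m * (‖p.1 - x₀‖ *
        ((1 + ‖p.1 - x₀‖) ^ m * (2 ^ (m + 1) * schwartzNorm (m + 1) ψ₀)))) := by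
      have := continuous_schwartzNorm (d := d) m
      fun_prop
    have := hc.tendsto (x₀, ψ₀)
    simpa using this

theorem character_eq_fourierChar {d : ℕ} (ξ y : Euc d) :
    character ξ y = (Real.fourierChar (-inner ℝ y ξ) : ℂ) := by
  rw [character, Real.fourierChar_apply]
  congr 1
  push_cast
  ring

theorem norm_character {d : ℕ} (ξ y : Euc d) : ‖character ξ y‖ = 1 := by
  rw [character_eq_fourierChar, Circle.norm_coe]

theorem continuous_character {d : ℕ} : Continuous fun p : Euc d × Euc d => character p.1 p.2 := by
  unfold character
  fun_prop

theorem character_add {d : ℕ} (ξ η y : Euc d) :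
    character (ξ + η) y = character ξ y * character η y := by
  simp only [character, ← Complex.exp_add, inner_add_right]
  congr 1
  push_cast
  ring

theorem character_add_right {d : ℕ} (ξ x y : Euc d) :
    character ξ (x + y) = character ξ x * character ξ y := by
  simp only [character, ← Complex.exp_add, inner_add_left]
  congr 1
  push_cast
  ring

theorem character_comm {d : ℕ} (ξ y : Euc d) : character ξ y = character y ξ := by
  simp only [character, real_inner_comm]

theorem fourier_eq_integral_character {d : ℕ} (f : Euc d → ℂ) (ξ : Euc d) :
    𝓕 f ξ = ∫ y, character ξ y * f y := by
  rw [Real.fourier_eq]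
  simp only [character_eq_fourierChar]
  rfl

theorem fourierInv_eq_integral_character {d : ℕ} (f : Euc d → ℂ) (ξ : Euc d) :
    𝓕⁻ f ξ = ∫ y, character (-ξ) y * f y := by
  rw [Real.fourierInv_eq_fourier_neg, fourier_eq_integral_character]

/-- Modulations are the Fourier conjugates of translations. -/
theorem smulLeftCLM_character {d : ℕ} (ψ : 𝓢(Euc d, ℂ)) (ξ : Euc d) :
    SchwartzMap.smulLeftCLM ℂ (character ξ) ψ = 𝓕 (compSubConstCLM ℂ ξ (𝓕⁻ ψ)) := by
  have h : compSubConstCLM ℂ ξ (𝓕⁻ ψ) = 𝓕⁻ (SchwartzMap.smulLeftCLM ℂ (character ξ) ψ) := by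
    ext η
    rw [compSubConstCLM_apply, fourierInv_coe, fourierInv_coe, fourierInv_eq_integral_character,
      fourierInv_eq_integral_character]
    refine integral_congr_ae (Eventually.of_forall fun y => ?_)
    simp only [SchwartzMap.smulLeftCLM_apply_apply (hasTemperateGrowth_character ξ), smul_eq_mul]
    rw [← mul_assoc, ← character_add]
    congr 2
    abel
  rw [h, fourier_fourierInv_eq]

theorem atom_eq_fourier {d : ℕ} (g : 𝓢(Euc d, ℂ)) (x ξ : Euc d) :
    atom g x ξ = 𝓕 (compSubConstCLM ℂ ξ (𝓕⁻ (compSubConstCLM ℂ x g))) :=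
  smulLeftCLM_character _ _

theorem continuous_atom {d : ℕ} (g : 𝓢(Euc d, ℂ)) :
    Continuous fun p : Euc d × Euc d => atom g p.1 p.2 := by
  simp only [atom_eq_fourier]
  refine (continuous_fourier (E := 𝓢(Euc d, ℂ))).comp (continuous_translate.comp
    (continuous_snd.prodMk ((continuous_fourierInv (E := 𝓢(Euc d, ℂ))).comp
      (continuous_translate.comp (continuous_fst.prodMk continuous_const)))))

theorem exists_schwartzNorm_atom_le {d : ℕ} (m : ℕ) :
    ∃ (k : ℕ) (C : ℝ), 0 ≤ C ∧ ∀ (g : 𝓢(Euc d, ℂ)) (x ξ : Euc d),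
      schwartzNorm m (atom g x ξ) ≤ C * schwartzNorm k g * (1 + ‖x‖) ^ k * (1 + ‖ξ‖) ^ k := by
  obtain ⟨a, C, hC, ha⟩ := exists_schwartzNorm_map_le (d := d) (fourierCLM ℂ 𝓢(Euc d, ℂ)) m
  obtain ⟨b, D, hD, hb⟩ := exists_schwartzNorm_map_le (d := d) (fourierInvCLM ℂ 𝓢(Euc d, ℂ)) a
  refine ⟨max a b, C * 2 ^ a * D * 2 ^ b, by positivity, fun g x ξ => ?_⟩
  rw [atom_eq_fourier]
  calc schwartzNorm m (𝓕 (compSubConstCLM ℂ ξ (𝓕⁻ (compSubConstCLM ℂ x g))))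
      ≤ C * schwartzNorm a (compSubConstCLM ℂ ξ (𝓕⁻ (compSubConstCLM ℂ x g))) := ha _
    _ ≤ C * ((1 + ‖ξ‖) ^ a * (2 ^ a * schwartzNorm a (𝓕⁻ (compSubConstCLM ℂ x g)))) := by
        gcongr; exact schwartzNorm_translate_le _ _
    _ ≤ C * ((1 + ‖ξ‖) ^ a * (2 ^ a * (D * schwartzNorm b (compSubConstCLM ℂ x g)))) := by
        gcongr; exact hb _
    _ ≤ C * ((1 + ‖ξ‖) ^ a * (2 ^ a * (D * ((1 + ‖x‖) ^ b * (2 ^ b * schwartzNorm b g))))) := by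
        gcongr; exact schwartzNorm_translate_le _ _
    _ ≤ C * ((1 + ‖ξ‖) ^ max a b * (2 ^ a * (D * ((1 + ‖x‖) ^ max a b *
          (2 ^ b * schwartzNorm (max a b) g))))) := by
        gcongr
        · linarith [norm_nonneg ξ]
        · exact le_max_left _ _
        · linarith [norm_nonneg x]
        · exact le_max_right _ _
        · exact schwartzNorm_mono (le_max_right _ _) _
    _ = _ := by ring

theorem continuous_windowedFourier {d : ℕ} (g : 𝓢(Euc d, ℂ)) (u : 𝓢'(Euc d, ℂ)) :
    Continuous fun p : Euc d × Euc d => windowedFourier g u p.1 p.2 :=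
  u.continuous.comp (continuous_atom g)

/-! ### Tempered distributions and Schwartz-valued integrals -/

open scoped BoundedContinuousFunction

/-- A linear functional that is bounded by finitely many Banach-space valued linear maps commutes
with those integrals with which these maps commute: by Hahn–Banach it factors through the product
of the Banach spaces. -/
theorem apply_eq_integral_of_norm_le {V X ι : Type*} [AddCommGroup V] [Module ℂ V] [Fintype ι]
    [MeasurableSpace X] {ν : Measure X} {F : ι → Type*} [∀ i, NormedAddCommGroup (F i)]
    [∀ i, NormedSpace ℝ (F i)] [∀ i, NormedSpace ℂ (F i)] [∀ i, CompleteSpace (F i)] (u : V →ₗ[ℂ] ℂ)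
    (A : ∀ i, V →ₗ[ℂ] F i) {C : ℝ} (hC : 0 ≤ C) (hu : ∀ v, ‖u v‖ ≤ C * ∑ i, ‖A i v‖)
    {Φ : X → V} {φ : V} (hint : ∀ i, Integrable (fun s => A i (Φ s)) ν)
    (hφ : ∀ i, A i φ = ∫ s, A i (Φ s) ∂ν) :
    u φ = ∫ s, u (Φ s) ∂ν := by
  let J : V →ₗ[ℂ] (∀ i, F i) := LinearMap.pi A
  have hJ : ∀ v, ∑ i, ‖A i v‖ ≤ Fintype.card ι * ‖J v‖ := fun v => by
    have : ∀ i ∈ Finset.univ, ‖A i v‖ ≤ ‖J v‖ := fun i _ => norm_le_pi_norm (J v) i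
    simpa using Finset.sum_le_sum this
  have hker : LinearMap.ker J ≤ LinearMap.ker u := fun v hv => by
    have h1 : ‖u v‖ ≤ C * (Fintype.card ι * ‖J v‖) := (hu v).trans (by gcongr; exact hJ v)
    rw [LinearMap.mem_ker.1 hv] at h1
    simpa using h1
  let f₀ : LinearMap.range J →ₗ[ℂ] ℂ :=
    ((LinearMap.ker J).liftQ u hker) ∘ₗ (J.quotKerEquivRange.symm : _ →ₗ[ℂ] _)
  have hf₀ : ∀ v, f₀ ⟨J v, v, rfl⟩ = u v := fun v => by
    have : J.quotKerEquivRange.symm ⟨J v, v, rfl⟩ = (LinearMap.ker J).mkQ v :=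
      (LinearEquiv.symm_apply_eq _).2 rfl
    change (LinearMap.ker J).liftQ u hker (J.quotKerEquivRange.symm ⟨J v, v, rfl⟩) = u v
    rw [this]
    rfl
  let f : LinearMap.range J →L[ℂ] ℂ := f₀.mkContinuous (C * Fintype.card ι) (by
    rintro ⟨_, v, rfl⟩
    rw [hf₀]
    refine (hu v).trans ?_
    rw [mul_assoc]
    gcongr
    exact hJ v)
  obtain ⟨L, hL, -⟩ := exists_extension_norm_eq _ f
  have hLJ : ∀ v, L (J v) = u v := fun v => (hL ⟨J v, v, rfl⟩).trans (hf₀ v)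
  have hJint : Integrable (fun s => J (Φ s)) ν := Integrable.of_eval hint
  have hJφ : J φ = ∫ s, J (Φ s) ∂ν := by
    ext1 i
    exact (hφ i).trans (MeasureTheory.eval_integral hint i).symm
  rw [← hLJ, hJφ, ← L.integral_comp_comm hJint]
  simp only [hLJ]

section Interchange

variable {E F : Type*} [NormedAddCommGroup E] [NormedSpace ℝ E] [NormedAddCommGroup F]
  [NormedSpace ℝ F] [NormedSpace ℂ F] [SMulCommClass ℝ ℂ F]

theorem norm_pow_smul_iteratedFDeriv_apply_le (k n : ℕ) (φ : 𝓢(E, F))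
    (p : E × (Fin n → Metric.closedBall (0 : E) 1)) :
    ‖‖p.1‖ ^ k • iteratedFDeriv ℝ n φ p.1 fun i => (p.2 i : E)‖ ≤
      SchwartzMap.seminorm ℂ k n φ := by
  rw [norm_smul, norm_pow, norm_norm]
  refine le_trans ?_ (SchwartzMap.le_seminorm ℂ k n φ p.1)
  gcongr
  refine (ContinuousMultilinearMap.le_opNorm _ _).trans (mul_le_of_le_one_right (norm_nonneg _) ?_)
  exact Finset.prod_le_one (fun i _ => norm_nonneg _)
    fun i _ => mem_closedBall_zero_iff.1 (p.2 i).2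

/-- The weighted derivative `(y, v) ↦ ‖y‖^k D^n φ(y)(v)`, for unit vectors `v`, as an element of a
Banach space of bounded continuous functions. -/
noncomputable def weightedDeriv (k n : ℕ) :
    𝓢(E, F) →L[ℂ] (E × (Fin n → Metric.closedBall (0 : E) 1) →ᵇ F) :=
  SchwartzMap.mkCLMtoNormedSpace (fun φ : 𝓢(E, F) =>
      BoundedContinuousFunction.ofNormedAddCommGroup
        (fun p => ‖p.1‖ ^ k • iteratedFDeriv ℝ n φ p.1 fun i => (p.2 i : E))
        (((continuous_norm.comp continuous_fst).pow k).smul (Continuous.eval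
          (((φ.smooth n).continuous_iteratedFDeriv le_rfl).comp continuous_fst) (by fun_prop)))
        (SchwartzMap.seminorm ℂ k n φ) (norm_pow_smul_iteratedFDeriv_apply_le k n φ))
    (fun φ ψ => BoundedContinuousFunction.ext fun p => by
      have h : iteratedFDeriv ℝ n (φ + ψ : 𝓢(E, F)) p.1 =
          iteratedFDeriv ℝ n φ p.1 + iteratedFDeriv ℝ n ψ p.1 :=
        iteratedFDeriv_add_apply (φ.contDiffAt n) (ψ.contDiffAt n)
      change ‖p.1‖ ^ k • iteratedFDeriv ℝ n (φ + ψ : 𝓢(E, F)) p.1 (fun i => (p.2 i : E)) = _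
      rw [h, add_apply, smul_add]
      rfl)
    (fun c φ => BoundedContinuousFunction.ext fun p => by
      have h : iteratedFDeriv ℝ n (c • φ : 𝓢(E, F)) p.1 = c • iteratedFDeriv ℝ n φ p.1 :=
        iteratedFDeriv_const_smul_apply (φ.contDiffAt n)
      change ‖p.1‖ ^ k • iteratedFDeriv ℝ n (c • φ : 𝓢(E, F)) p.1 (fun i => (p.2 i : E)) = _
      rw [h, smul_apply, smul_comm]
      rfl)
    ⟨{(k, n)}, 1, zero_le_one, fun φ => by
      simpa using BoundedContinuousFunction.norm_ofNormedAddCommGroup_le _ (apply_nonneg _ _) _⟩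

theorem weightedDeriv_apply (k n : ℕ) (φ : 𝓢(E, F))
    (p : E × (Fin n → Metric.closedBall (0 : E) 1)) :
    weightedDeriv k n φ p = ‖p.1‖ ^ k • iteratedFDeriv ℝ n φ p.1 fun i => (p.2 i : E) := rfl

theorem seminorm_le_norm_weightedDeriv (k n : ℕ) (φ : 𝓢(E, F)) :
    SchwartzMap.seminorm ℂ k n φ ≤ ‖weightedDeriv k n φ‖ := by
  refine SchwartzMap.seminorm_le_bound ℂ _ _ φ (norm_nonneg (weightedDeriv k n φ)) fun y => ?_
  have h : ‖‖y‖ ^ k • iteratedFDeriv ℝ n φ y‖ ≤ ‖weightedDeriv k n φ‖ := by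
    refine ContinuousMultilinearMap.opNorm_le_bound (norm_nonneg _) fun v => ?_
    have hu : ∀ i, ‖v i‖⁻¹ • v i ∈ Metric.closedBall (0 : E) 1 := fun i => by
      rw [mem_closedBall_zero_iff, norm_smul, norm_inv, norm_norm]
      exact inv_mul_le_one
    have hv : v = fun i => ‖v i‖ • (‖v i‖⁻¹ • v i) := by
      ext1 i
      rcases eq_or_ne (v i) 0 with h0 | h0
      · simp [h0]
      · rw [smul_smul, mul_inv_cancel₀ (norm_ne_zero_iff.2 h0), one_smul]
    have h1 := (weightedDeriv k n φ).norm_coe_le_norm (y, fun i => ⟨_, hu i⟩)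
    rw [weightedDeriv_apply] at h1
    nth_rewrite 1 [hv]
    rw [ContinuousMultilinearMap.map_smul_univ, norm_smul, mul_comm, norm_prod]
    simp only [norm_norm]
    gcongr
    simpa using h1
  rwa [norm_smul, norm_pow, norm_norm] at h

theorem norm_weightedDeriv_le (k n : ℕ) (φ : 𝓢(E, F)) :
    ‖weightedDeriv k n φ‖ ≤ SchwartzMap.seminorm ℂ k n φ :=
  (BoundedContinuousFunction.norm_le (apply_nonneg _ _)).2
    (norm_pow_smul_iteratedFDeriv_apply_le k n φ)

theorem continuous_iteratedFDeriv_apply (n : ℕ) (y : E) (v : Fin n → E) :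
    Continuous fun φ : 𝓢(E, F) => iteratedFDeriv ℝ n φ y v := by
  let L : 𝓢(E, F) →ₗ[ℂ] F :=
    { toFun := fun φ => iteratedFDeriv ℝ n φ y v
      map_add' := fun φ ψ => by
        have h : iteratedFDeriv ℝ n (φ + ψ : 𝓢(E, F)) y =
            iteratedFDeriv ℝ n φ y + iteratedFDeriv ℝ n ψ y :=
          iteratedFDeriv_add_apply (φ.contDiffAt n) (ψ.contDiffAt n)
        rw [h, add_apply]
      map_smul' := fun c φ => by
        have h : iteratedFDeriv ℝ n (c • φ : 𝓢(E, F)) y = c • iteratedFDeriv ℝ n φ y :=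
          iteratedFDeriv_const_smul_apply (φ.contDiffAt n)
        rw [h, smul_apply, RingHom.id_apply] }
  change Continuous L
  refine WithSeminorms.continuous_normedSpace_rng F (schwartz_withSeminorms ℂ E F) L
    ⟨{(0, n)}, ⟨∏ i, ‖v i‖, by positivity⟩, fun φ => ?_⟩
  rw [Finset.sup_singleton]
  change ‖iteratedFDeriv ℝ n φ y v‖ ≤ (∏ i, ‖v i‖) * SchwartzMap.seminorm ℂ 0 n φ
  rw [mul_comm]
  refine (ContinuousMultilinearMap.le_opNorm _ _).trans ?_
  gcongr
  exact SchwartzMap.norm_iteratedFDeriv_le_seminorm ℂ φ n y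

variable {X : Type*} [TopologicalSpace X] [SecondCountableTopology X]
  [MeasurableSpace X] [OpensMeasurableSpace X] {ν : Measure X} {Φ : X → 𝓢(E, F)} {φ : 𝓢(E, F)}

/-- Differentiation under the integral sign for an absolutely convergent integral of Schwartz
functions. -/
theorem iteratedFDeriv_eq_integral (hΦ : Continuous Φ)
    (hint : ∀ n, Integrable (fun s => SchwartzMap.seminorm ℂ 0 n (Φ s)) ν)
    (hφ : ∀ y, φ y = ∫ s, Φ s y ∂ν) (n : ℕ) (y : E) (v : Fin n → E) :
    iteratedFDeriv ℝ n φ y v = ∫ s, iteratedFDeriv ℝ n (Φ s) y v ∂ν := by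
  have hmeas : ∀ (n : ℕ) (y : E) (v : Fin n → E),
      AEStronglyMeasurable (fun s => iteratedFDeriv ℝ n (Φ s) y v) ν := fun n y v =>
    ((continuous_iteratedFDeriv_apply n y v).comp hΦ).aestronglyMeasurable
  have hbound : ∀ (n : ℕ) (y : E) (v : Fin n → E) (s : X), ‖iteratedFDeriv ℝ n (Φ s) y v‖ ≤
      SchwartzMap.seminorm ℂ 0 n (Φ s) * ∏ i, ‖v i‖ := fun n y v s =>
    (ContinuousMultilinearMap.le_opNorm _ _).trans (by
      gcongr
      exact SchwartzMap.norm_iteratedFDeriv_le_seminorm ℂ (Φ s) n y)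
  induction n generalizing y with
  | zero =>
    simp only [iteratedFDeriv_zero_apply]
    exact hφ y
  | succ n ih =>
    have hd : ∀ (ψ : 𝓢(E, F)) (t : ℝ), HasDerivAt
        (fun t => iteratedFDeriv ℝ n ψ (y + t • v 0) (Fin.tail v))
        (iteratedFDeriv ℝ (n + 1) ψ (y + t • v 0) v) t := fun ψ t => by
      have h1 : HasFDerivAt (iteratedFDeriv ℝ n ψ)
          (fderiv ℝ (iteratedFDeriv ℝ n ψ) (y + t • v 0)) (y + t • v 0) :=
        ((ψ.smooth ⊤).differentiable_iteratedFDeriv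
          (by exact_mod_cast ENat.natCast_lt_top n) _).hasFDerivAt
      have h2 : HasDerivAt (fun t : ℝ => y + t • v 0) (v 0) t := by
        simpa using ((hasDerivAt_id t).smul_const (v 0)).const_add y
      have h3 := h1.comp_hasDerivAt t h2
      have h4 := (ContinuousMultilinearMap.apply ℝ (fun _ : Fin n => E) F
        (Fin.tail v)).hasFDerivAt.comp_hasDerivAt t h3
      rw [iteratedFDeriv_succ_apply_left]
      exact h4
    have h1 := (hasDerivAt_integral_of_dominated_loc_of_deriv_le (𝕜 := ℝ) (μ := ν)
      (F := fun t s => iteratedFDeriv ℝ n (Φ s) (y + t • v 0) (Fin.tail v))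
      (F' := fun t s => iteratedFDeriv ℝ (n + 1) (Φ s) (y + t • v 0) v) (x₀ := 0)
      (bound := fun s => SchwartzMap.seminorm ℂ 0 (n + 1) (Φ s) * ∏ i, ‖v i‖)
      (Filter.univ_mem) (Eventually.of_forall fun t => hmeas n _ _)
      (((hint n).mul_const _).mono' (hmeas n _ _) (Eventually.of_forall (hbound n _ _)))
      (hmeas (n + 1) _ _) (Eventually.of_forall fun s t _ => hbound (n + 1) _ _ s)
      ((hint (n + 1)).mul_const _) (Eventually.of_forall fun s t _ => hd (Φ s) t)).2
    have h2 := hd φ 0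
    simp only [ih] at h2
    simpa using h2.unique h1

/-- A continuous functional on the Schwartz space commutes with absolutely convergent integrals of
Schwartz functions. Only finitely many seminorms matter for a given functional, so that it extends,
by Hahn–Banach, from the Schwartz space to a Banach space of weighted bounded continuous functions,
where Bochner integration is available. -/
theorem linearMap_apply_eq_integral [CompleteSpace F] (u : 𝓢(E, F) →ₗ[ℂ] ℂ)
    (hu : ∃ (s : Finset (ℕ × ℕ)) (C : ℝ), 0 ≤ C ∧
      ∀ ψ, ‖u ψ‖ ≤ C * s.sup (schwartzSeminormFamily ℂ E F) ψ) (hΦ : Continuous Φ)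
    (hint : ∀ k n, Integrable (fun s => SchwartzMap.seminorm ℂ k n (Φ s)) ν)
    (hφ : ∀ y, φ y = ∫ s, Φ s y ∂ν) :
    u φ = ∫ s, u (Φ s) ∂ν := by
  obtain ⟨s, C, hC, hu⟩ := hu
  have hwint : ∀ k n, Integrable (fun s => weightedDeriv k n (Φ s)) ν := fun k n =>
    (hint k n).mono' (((weightedDeriv k n).continuous.comp hΦ).aestronglyMeasurable)
      (Eventually.of_forall fun s => norm_weightedDeriv_le _ _ _)
  refine apply_eq_integral_of_norm_le (ι := s) u
    (fun i => (weightedDeriv i.1.1 i.1.2 : 𝓢(E, F) →L[ℂ] _).toLinearMap) hC (fun ψ => ?_)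
    (fun i => ?_) (fun i => ?_)
  · refine (hu ψ).trans ?_
    gcongr
    refine Seminorm.finset_sup_apply_le (Finset.sum_nonneg fun _ _ => norm_nonneg _)
      fun i hi => ?_
    refine (seminorm_le_norm_weightedDeriv i.1 i.2 ψ).trans ?_
    exact Finset.single_le_sum (f := fun j : s => ‖weightedDeriv j.1.1 j.1.2 ψ‖)
      (fun _ _ => norm_nonneg _) (Finset.mem_univ ⟨i, hi⟩)
  · exact hwint i.1.1 i.1.2
  · refine BoundedContinuousFunction.ext fun p => ?_
    have h2 : (∫ s, weightedDeriv i.1.1 i.1.2 (Φ s) ∂ν) p =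
        ∫ s, weightedDeriv i.1.1 i.1.2 (Φ s) p ∂ν :=
      ((BoundedContinuousFunction.evalCLM ℂ p).integral_comp_comm (hwint i.1.1 i.1.2)).symm
    refine Eq.trans ?_ h2.symm
    simp only [weightedDeriv_apply]
    rw [integral_smul, ← iteratedFDeriv_eq_integral hΦ (hint 0) hφ]
    rfl

end Interchange

/-- A tempered distribution commutes with absolutely convergent integrals of Schwartz functions. -/
theorem apply_eq_integral {d : ℕ} {X : Type*} [TopologicalSpace X] [SecondCountableTopology X]
    [MeasurableSpace X] [OpensMeasurableSpace X] {ν : Measure X} (u : 𝓢'(Euc d, ℂ))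
    {Φ : X → 𝓢(Euc d, ℂ)} {φ : 𝓢(Euc d, ℂ)} (hΦ : Continuous Φ)
    (hint : ∀ m, Integrable (fun s => schwartzNorm m (Φ s)) ν)
    (hφ : ∀ y, φ y = ∫ s, Φ s y ∂ν) :
    u φ = ∫ s, u (Φ s) ∂ν := by
  refine linearMap_apply_eq_integral u.toLinearMap ?_ hΦ (fun k n => ?_) hφ
  · obtain ⟨m, C, hC, hu⟩ := exists_norm_apply_le u
    exact ⟨Finset.Iic (m, m), C, hC, hu⟩
  · refine (hint (max k n)).mono' ?_ (Eventually.of_forall fun s => ?_)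
    · exact (((schwartz_withSeminorms ℂ (Euc d) ℂ).continuous_seminorm (k, n)).comp
        hΦ).aestronglyMeasurable
    · rw [Real.norm_of_nonneg (apply_nonneg _ _)]
      exact seminorm_le_schwartzNorm (le_max_left _ _) (le_max_right _ _) _

/-! ### Rapid decay of the windowed Fourier transform of a Schwartz function -/

/-- The tempered distribution given by a Schwartz function. -/
noncomputable abbrev ofSchwartz {d : ℕ} (ψ : 𝓢(Euc d, ℂ)) : 𝓢'(Euc d, ℂ) :=
  SchwartzMap.toTemperedDistributionCLM (Euc d) ℂ volume ψ

theorem ofSchwartz_apply {d : ℕ} (ψ φ : 𝓢(Euc d, ℂ)) :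
    ofSchwartz ψ φ = ∫ y, φ y * ψ y := by
  simp [ofSchwartz]

/-- The product of two Schwartz functions. -/
noncomputable abbrev schwartzMul {d : ℕ} (a b : 𝓢(Euc d, ℂ)) : 𝓢(Euc d, ℂ) :=
  SchwartzMap.smulLeftCLM ℂ (a : Euc d → ℂ) b

theorem schwartzMul_apply {d : ℕ} (a b : 𝓢(Euc d, ℂ)) (y : Euc d) :
    schwartzMul a b y = a y * b y := by
  simp [schwartzMul, SchwartzMap.smulLeftCLM_apply_apply a.hasTemperateGrowth]

theorem schwartzNorm_schwartzMul_le {d m : ℕ} (a b : 𝓢(Euc d, ℂ)) :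
    schwartzNorm m (schwartzMul a b) ≤
      2 ^ m * (2 ^ m * schwartzNorm m a) * (2 ^ m * schwartzNorm m b) := by
  refine schwartzNorm_le _ (by positivity) fun k hk n hn y => ?_
  have h1 : (schwartzMul a b : Euc d → ℂ) = fun y => a y * b y :=
    funext fun y => schwartzMul_apply a b y
  rw [h1]
  have hA : ∀ i ≤ n, ‖iteratedFDeriv ℝ i a y‖ ≤ 2 ^ m * schwartzNorm m a := fun i hi => by
    simpa using one_add_pow_mul_le_schwartzNorm (Nat.zero_le m) (hi.trans hn) a y
  calc (1 + ‖y‖) ^ k * ‖iteratedFDeriv ℝ n (fun y => a y * b y) y‖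
      ≤ (1 + ‖y‖) ^ k * ∑ i ∈ Finset.range (n + 1), (n.choose i : ℝ) *
          ‖iteratedFDeriv ℝ i a y‖ * ‖iteratedFDeriv ℝ (n - i) b y‖ := by
        gcongr
        exact norm_iteratedFDeriv_mul_le (a.smooth n) (b.smooth n) y le_rfl
    _ = ∑ i ∈ Finset.range (n + 1), (n.choose i : ℝ) *
          ‖iteratedFDeriv ℝ i a y‖ * ((1 + ‖y‖) ^ k * ‖iteratedFDeriv ℝ (n - i) b y‖) := by
        rw [Finset.mul_sum]
        exact Finset.sum_congr rfl fun i _ => by ring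
    _ ≤ ∑ i ∈ Finset.range (n + 1), (n.choose i : ℝ) *
          (2 ^ m * schwartzNorm m a) * (2 ^ m * schwartzNorm m b) := by
        refine Finset.sum_le_sum fun i hi => ?_
        refine mul_le_mul ?_ (one_add_pow_mul_le_schwartzNorm hk (by omega) b y) (by positivity)
          (by positivity)
        gcongr
        exact hA i (by have := Finset.mem_range.1 hi; omega)
    _ = 2 ^ n * (2 ^ m * schwartzNorm m a) * (2 ^ m * schwartzNorm m b) := by
        rw [← Finset.sum_mul, ← Finset.sum_mul, ← Nat.cast_sum, Nat.sum_range_choose]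
        push_cast
        ring
    _ ≤ _ := by
        gcongr
        norm_num

/-- An integrable weight on `ℝ^d`. -/
noncomputable def weight {d : ℕ} (y : Euc d) : ℝ := ((1 + ‖y‖) ^ (d + 1))⁻¹

theorem weight_pos {d : ℕ} (y : Euc d) : 0 < weight y := by
  unfold weight; positivity

theorem continuous_weight {d : ℕ} : Continuous (weight : Euc d → ℝ) := by
  unfold weight
  refine Continuous.inv₀ (by fun_prop) fun y => by positivity

theorem integrable_weight {d : ℕ} : Integrable (weight : Euc d → ℝ) := by
  have h := integrable_one_add_norm (E := Euc d) (μ := volume) (r := (d + 1 : ℕ)) (by simp)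
  refine h.congr (Eventually.of_forall fun y => ?_)
  simp only [weight]
  rw [Real.rpow_neg (by positivity), Real.rpow_natCast]

theorem weight_le_one {d : ℕ} (y : Euc d) : weight y ≤ 1 := by
  unfold weight
  exact inv_le_one_of_one_le₀ (one_le_pow₀ (by linarith [norm_nonneg y]))

theorem integrable_weight_mul_weight {d : ℕ} :
    Integrable fun p : Euc d × Euc d => weight p.1 * weight p.2 :=
  integrable_weight.mul_prod integrable_weight

theorem windowedFourier_ofSchwartz {d : ℕ} (g ψ : 𝓢(Euc d, ℂ)) (z η : Euc d) :
    windowedFourier g (ofSchwartz ψ) z η = 𝓕 (schwartzMul (compSubConstCLM ℂ z g) ψ) η := by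
  rw [windowedFourier, ofSchwartz_apply, SchwartzMap.fourier_coe, fourier_eq_integral_character]
  refine integral_congr_ae (Eventually.of_forall fun y => ?_)
  simp only [atom_apply, schwartzMul_apply, compSubConstCLM_apply]
  ring

theorem integral_one_add_pow_mul_norm_le {d : ℕ} (P : ℕ) (ψ : 𝓢(Euc d, ℂ)) :
    Integrable (fun y => (1 + ‖y‖) ^ P * ‖ψ y‖) ∧ ∫ y, (1 + ‖y‖) ^ P * ‖ψ y‖ ≤
      2 ^ (P + (d + 1)) * schwartzNorm (P + (d + 1)) ψ * ∫ y : Euc d, weight y := by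
  have hb : ∀ y, (1 + ‖y‖) ^ P * ‖ψ y‖ ≤
      2 ^ (P + (d + 1)) * schwartzNorm (P + (d + 1)) ψ * weight y := fun y => by
    have h1 := one_add_pow_mul_norm_le le_rfl ψ y (m := P + (d + 1))
    rw [weight, ← div_eq_mul_inv, le_div_iff₀ (by positivity)]
    calc (1 + ‖y‖) ^ P * ‖ψ y‖ * (1 + ‖y‖) ^ (d + 1) = (1 + ‖y‖) ^ (P + (d + 1)) * ‖ψ y‖ := by
          rw [pow_add]; ring
      _ ≤ _ := h1
  have hI : Integrable (fun y => (1 + ‖y‖) ^ P * ‖ψ y‖) := by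
    refine (integrable_weight.const_mul
      (2 ^ (P + (d + 1)) * schwartzNorm (P + (d + 1)) ψ)).mono' ?_
      (Eventually.of_forall fun y => ?_)
    · have := ψ.continuous
      exact Continuous.aestronglyMeasurable (by fun_prop)
    · rw [Real.norm_of_nonneg (by positivity)]
      exact hb y
  refine ⟨hI, ?_⟩
  rw [← integral_const_mul]
  exact integral_mono hI (integrable_weight.const_mul _) hb

/-- The windowed Fourier transform of a Schwartz function decays rapidly in both variables. Decay in
`η` is paid for by polynomial growth in `z`, decay in `z` comes for free; the geometric mean of the
two bounds decays in both. -/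
theorem exists_windowedFourier_ofSchwartz_le {d : ℕ} (N : ℕ) :
    ∃ (m : ℕ) (C : ℝ), 0 ≤ C ∧ ∀ (g ψ : 𝓢(Euc d, ℂ)) (z η : Euc d),
      (1 + ‖z‖) ^ N * (1 + ‖η‖) ^ N * ‖windowedFourier g (ofSchwartz ψ) z η‖ ≤
        C * (schwartzNorm m g * schwartzNorm m ψ) := by
  obtain ⟨m₁, C₁, hC₁, h₁⟩ := exists_schwartzNorm_map_le (d := d) (fourierCLM ℂ 𝓢(Euc d, ℂ)) (2 * N)
  set P := m₁ + 2 * N with hP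
  set m := P + (d + 1) with hm
  set I := ∫ y : Euc d, weight y
  have hI0 : 0 ≤ I := integral_nonneg fun y => (weight_pos y).le
  set D₁ : ℝ := 2 ^ (2 * N) * (C₁ * (2 ^ m₁ * (2 ^ m₁ * 2 ^ m₁) * 2 ^ m₁)) with hD₁
  set D₂ : ℝ := 2 ^ m * (2 ^ m * I) with hD₂
  have hD₁0 : 0 ≤ D₁ := by positivity
  have hD₂0 : 0 ≤ D₂ := by positivity
  refine ⟨m, √(D₁ * D₂), Real.sqrt_nonneg _, fun g ψ z η => ?_⟩
  set A := ‖windowedFourier g (ofSchwartz ψ) z η‖ with hA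
  set S := schwartzNorm m g * schwartzNorm m ψ with hS
  have hm₁ : m₁ ≤ m := by omega
  have hPm : P ≤ m := by omega
  have b₁ : (1 + ‖η‖) ^ (2 * N) * A ≤ (1 + ‖z‖) ^ m₁ * (D₁ * S) := by
    rw [hA, windowedFourier_ofSchwartz]
    calc (1 + ‖η‖) ^ (2 * N) * ‖𝓕 (schwartzMul (compSubConstCLM ℂ z g) ψ) η‖
        ≤ 2 ^ (2 * N) * schwartzNorm (2 * N) (𝓕 (schwartzMul (compSubConstCLM ℂ z g) ψ)) :=
          one_add_pow_mul_norm_le le_rfl _ _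
      _ ≤ 2 ^ (2 * N) * (C₁ * schwartzNorm m₁ (schwartzMul (compSubConstCLM ℂ z g) ψ)) := by
          gcongr
          exact h₁ _
      _ ≤ 2 ^ (2 * N) * (C₁ * (2 ^ m₁ * (2 ^ m₁ * ((1 + ‖z‖) ^ m₁ * (2 ^ m₁ * schwartzNorm m g))) *
            (2 ^ m₁ * schwartzNorm m ψ))) := by
          gcongr
          refine (schwartzNorm_schwartzMul_le _ _).trans ?_
          gcongr
          · refine (schwartzNorm_translate_le _ _).trans ?_
            gcongr
            exact schwartzNorm_mono hm₁ g
          · exact schwartzNorm_mono hm₁ ψ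
      _ = _ := by rw [hD₁, hS]; ring
  have b₂ : (1 + ‖z‖) ^ P * A ≤ D₂ * S := by
    obtain ⟨hint, hle⟩ := integral_one_add_pow_mul_norm_le P ψ
    have hA' : A ≤ ∫ y, ‖g (y - z)‖ * ‖ψ y‖ := by
      rw [hA, windowedFourier, ofSchwartz_apply]
      refine (norm_integral_le_integral_norm _).trans (le_of_eq ?_)
      refine integral_congr_ae (Eventually.of_forall fun y => ?_)
      simp [atom_apply, norm_character]
    calc (1 + ‖z‖) ^ P * A ≤ (1 + ‖z‖) ^ P * ∫ y, ‖g (y - z)‖ * ‖ψ y‖ := by gcongr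
      _ = ∫ y, (1 + ‖z‖) ^ P * (‖g (y - z)‖ * ‖ψ y‖) := (integral_const_mul _ _).symm
      _ ≤ ∫ y, 2 ^ m * schwartzNorm m g * ((1 + ‖y‖) ^ P * ‖ψ y‖) := by
          refine integral_mono_of_nonneg (Eventually.of_forall fun y => by positivity)
            (hint.const_mul _) (Eventually.of_forall fun y => ?_)
          have h1 := one_add_pow_mul_norm_le hPm g (y - z)
          have h2 : (1 + ‖z‖) ^ P ≤ (1 + ‖y‖) ^ P * (1 + ‖y - z‖) ^ P := by
            rw [← mul_pow, norm_sub_rev]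
            gcongr
            exact one_add_norm_le_mul y z
          calc (1 + ‖z‖) ^ P * (‖g (y - z)‖ * ‖ψ y‖)
              ≤ (1 + ‖y‖) ^ P * (1 + ‖y - z‖) ^ P * (‖g (y - z)‖ * ‖ψ y‖) := by gcongr
            _ = ((1 + ‖y - z‖) ^ P * ‖g (y - z)‖) * ((1 + ‖y‖) ^ P * ‖ψ y‖) := by ring
            _ ≤ _ := mul_le_mul_of_nonneg_right h1 (by positivity)
      _ = 2 ^ m * schwartzNorm m g * ∫ y, (1 + ‖y‖) ^ P * ‖ψ y‖ := integral_const_mul _ _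
      _ ≤ 2 ^ m * schwartzNorm m g * (2 ^ m * schwartzNorm m ψ * I) := by gcongr
      _ = _ := by rw [hD₂, hS]; ring
  have hAS : ((1 + ‖z‖) ^ N * (1 + ‖η‖) ^ N * A) ^ 2 ≤ (D₁ * D₂) * S ^ 2 := by
    have hz : 0 < (1 + ‖z‖) ^ m₁ := by positivity
    refine le_of_mul_le_mul_left ?_ hz
    calc (1 + ‖z‖) ^ m₁ * ((1 + ‖z‖) ^ N * (1 + ‖η‖) ^ N * A) ^ 2
        = ((1 + ‖η‖) ^ (2 * N) * A) * ((1 + ‖z‖) ^ P * A) := by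
          rw [hP, pow_add, pow_mul', pow_mul']; ring
      _ ≤ ((1 + ‖z‖) ^ m₁ * (D₁ * S)) * (D₂ * S) := by gcongr
      _ = _ := by ring
  have hS0 : 0 ≤ S := by positivity
  calc (1 + ‖z‖) ^ N * (1 + ‖η‖) ^ N * A ≤ √((D₁ * D₂) * S ^ 2) := Real.le_sqrt_of_sq_le hAS
    _ = √(D₁ * D₂) * S := by rw [Real.sqrt_mul' _ (sq_nonneg _), Real.sqrt_sq hS0]

theorem exists_windowedFourier_ofSchwartz_le_weight {d : ℕ} (k : ℕ) :
    ∃ (m : ℕ) (C : ℝ), 0 ≤ C ∧ ∀ (g ψ : 𝓢(Euc d, ℂ)) (z η : Euc d),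
      ‖windowedFourier g (ofSchwartz ψ) z η‖ * (1 + ‖z‖) ^ k * (1 + ‖η‖) ^ k ≤
        C * (schwartzNorm m g * schwartzNorm m ψ) * (weight z * weight η) := by
  obtain ⟨m, C, hC, h⟩ := exists_windowedFourier_ofSchwartz_le (d := d) (k + (d + 1))
  refine ⟨m, C, hC, fun g ψ z η => ?_⟩
  rw [weight, weight, ← mul_inv, ← div_eq_mul_inv, le_div_iff₀ (by positivity)]
  refine le_trans (le_of_eq ?_) (h g ψ z η)
  rw [pow_add, pow_add]
  ring

theorem continuous_windowedFourier_neg {d : ℕ} (g : 𝓢(Euc d, ℂ)) (u : 𝓢'(Euc d, ℂ)) :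
    Continuous fun p : Euc d × Euc d => windowedFourier g u p.1 (-p.2) :=
  (continuous_windowedFourier g u).comp₂ continuous_fst continuous_snd.neg

/-! ### The reproducing formula -/

theorem integrable_schwartzNorm_windowedFourier_smul_atom {d : ℕ} (b γ ψ : 𝓢(Euc d, ℂ)) (m : ℕ) :
    Integrable fun p : Euc d × Euc d =>
      schwartzNorm m (windowedFourier b (ofSchwartz ψ) p.1 (-p.2) • atom γ p.1 p.2) := by
  obtain ⟨k, D, hD, hk⟩ := exists_schwartzNorm_atom_le (d := d) m
  obtain ⟨m', C, hC, h⟩ := exists_windowedFourier_ofSchwartz_le_weight (d := d) k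
  refine (integrable_weight_mul_weight.const_mul (D * schwartzNorm k γ *
    (C * (schwartzNorm m' b * schwartzNorm m' ψ)))).mono' ?_ (Eventually.of_forall fun p => ?_)
  · exact ((continuous_schwartzNorm m).comp ((continuous_windowedFourier_neg b _).smul
      (continuous_atom γ))).aestronglyMeasurable
  · rw [Real.norm_of_nonneg (apply_nonneg _ _), map_smul_eq_mul]
    have h1 := h b ψ p.1 (-p.2)
    rw [norm_neg] at h1
    calc ‖windowedFourier b (ofSchwartz ψ) p.1 (-p.2)‖ * schwartzNorm m (atom γ p.1 p.2)
        ≤ ‖windowedFourier b (ofSchwartz ψ) p.1 (-p.2)‖ *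
          (D * schwartzNorm k γ * (1 + ‖p.1‖) ^ k * (1 + ‖p.2‖) ^ k) := by
          gcongr
          exact hk _ _ _
      _ = D * schwartzNorm k γ * (‖windowedFourier b (ofSchwartz ψ) p.1 (-p.2)‖ *
          (1 + ‖p.1‖) ^ k * (1 + ‖p.2‖) ^ k) := by ring
      _ ≤ D * schwartzNorm k γ * (C * (schwartzNorm m' b * schwartzNorm m' ψ) *
          (weight p.1 * weight (-p.2))) := by gcongr
      _ = _ := by
          have : weight (-p.2) = weight p.2 := by simp [weight]
          rw [this]; ring

/-- A Schwartz function is the superposition of the atoms of a window `γ`, with its windowed Fourier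
transform for a dual window `b` as coefficients. -/
theorem eq_integral_windowedFourier_mul_atom {d : ℕ} {b γ : 𝓢(Euc d, ℂ)}
    (hbγ : ∫ y, b y * γ y = 1) (ψ : 𝓢(Euc d, ℂ)) (y : Euc d) :
    ψ y = ∫ p : Euc d × Euc d, windowedFourier b (ofSchwartz ψ) p.1 (-p.2) * atom γ p.1 p.2 y := by
  have hint : Integrable fun p : Euc d × Euc d =>
      windowedFourier b (ofSchwartz ψ) p.1 (-p.2) * atom γ p.1 p.2 y := by
    refine (integrable_schwartzNorm_windowedFourier_smul_atom b γ ψ 0).mono' ?_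
      (Eventually.of_forall fun p => ?_)
    · refine Continuous.aestronglyMeasurable ((continuous_windowedFourier_neg b _).mul ?_)
      simp only [atom_apply]
      have := continuous_character (d := d)
      have h2 := γ.continuous
      exact (this.comp (continuous_snd.prodMk continuous_const)).mul (by fun_prop)
    · have := one_add_pow_mul_norm_le le_rfl
        (windowedFourier b (ofSchwartz ψ) p.1 (-p.2) • atom γ p.1 p.2) y (m := 0)
      simpa using this
  rw [Measure.volume_eq_prod, integral_prod _ (by rwa [← Measure.volume_eq_prod])]
  have inner : ∀ z, ∫ η, windowedFourier b (ofSchwartz ψ) z (-η) * atom γ z η y =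
      (b (y - z) * γ (y - z)) * ψ y := by
    intro z
    set F := schwartzMul (compSubConstCLM ℂ z b) ψ with hF
    have h1 : ∫ η, windowedFourier b (ofSchwartz ψ) z (-η) * character η y = F y := by
      rw [← integral_neg_eq_self]
      have : 𝓕⁻ (𝓕 F) y = F y := by rw [fourierInv_fourier_eq]
      rw [← this, SchwartzMap.fourierInv_coe, fourierInv_eq_integral_character]
      refine integral_congr_ae (Eventually.of_forall fun η => ?_)
      simp only [neg_neg]
      rw [windowedFourier_ofSchwartz, mul_comm, character_comm, character, character]
      simp [hF]
    simp only [atom_apply, ← mul_assoc]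
    rw [integral_mul_const, h1, hF, schwartzMul_apply, compSubConstCLM_apply]
    ring
  simp only [inner]
  rw [integral_mul_const, integral_sub_left_eq_self (fun z => b z * γ z) volume y, hbγ, one_mul]

/-- The reproducing formula: the action of a tempered distribution on a Schwartz function in terms
of the windowed Fourier transforms of both, for dual windows. -/
theorem apply_eq_integral_windowedFourier {d : ℕ} {b γ : 𝓢(Euc d, ℂ)}
    (hbγ : ∫ y, b y * γ y = 1) (u : 𝓢'(Euc d, ℂ)) (ψ : 𝓢(Euc d, ℂ)) :
    u ψ = ∫ p : Euc d × Euc d,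
      windowedFourier b (ofSchwartz ψ) p.1 (-p.2) * windowedFourier γ u p.1 p.2 := by
  rw [apply_eq_integral (ν := volume) u
    ((continuous_windowedFourier_neg b (ofSchwartz ψ)).smul (continuous_atom γ))
    (integrable_schwartzNorm_windowedFourier_smul_atom b γ ψ)
    (eq_integral_windowedFourier_mul_atom hbγ ψ)]
  refine integral_congr_ae (Eventually.of_forall fun p => ?_)
  simp [windowedFourier]

theorem windowedFourier_ofSchwartz_atom {d : ℕ} (b g : 𝓢(Euc d, ℂ)) (x ξ z η : Euc d) :
    windowedFourier b (ofSchwartz (atom g x ξ)) z η =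
      character (η + ξ) x * windowedFourier b (ofSchwartz g) (z - x) (η + ξ) := by
  rw [windowedFourier, windowedFourier, ofSchwartz_apply, ofSchwartz_apply,
    ← integral_const_mul, ← integral_add_left_eq_self _ x]
  refine integral_congr_ae (Eventually.of_forall fun y => ?_)
  simp only [atom_apply, add_sub_cancel_left, character_add_right, character_add]
  rw [show x + y - z = y - (z - x) by abel]
  ring

theorem norm_windowedFourier_atom {d : ℕ} (b g : 𝓢(Euc d, ℂ)) (x ξ z η : Euc d) :
    ‖windowedFourier b (ofSchwartz (atom g x ξ)) z η‖ =
      ‖windowedFourier b (ofSchwartz g) (z - x) (η + ξ)‖ := by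
  rw [windowedFourier_ofSchwartz_atom, norm_mul, norm_character, one_mul]

/-- The pointwise form of the change of window. -/
theorem enorm_windowedFourier_le_lintegral {d : ℕ} {b γ : 𝓢(Euc d, ℂ)}
    (hbγ : ∫ y, b y * γ y = 1) (g : 𝓢(Euc d, ℂ)) (u : 𝓢'(Euc d, ℂ)) (x ξ : Euc d) :
    ‖windowedFourier g u x ξ‖ₑ ≤ ∫⁻ p : Euc d × Euc d,
      ‖windowedFourier b (ofSchwartz g) p.1 p.2‖ₑ *
        ‖windowedFourier γ u (x + p.1) (ξ - p.2)‖ₑ := by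
  rw [windowedFourier, apply_eq_integral_windowedFourier hbγ u (atom g x ξ)]
  refine (enorm_integral_le_lintegral_enorm _).trans ?_
  have h1 : ∀ p : Euc d × Euc d,
      ‖windowedFourier b (ofSchwartz (atom g x ξ)) p.1 (-p.2) * windowedFourier γ u p.1 p.2‖ₑ =
      ‖windowedFourier b (ofSchwartz g) (p.1 - x) (ξ - p.2)‖ₑ *
        ‖windowedFourier γ u p.1 p.2‖ₑ := fun p => by
    rw [enorm_mul, ← ofReal_norm, norm_windowedFourier_atom, ofReal_norm]
    congr 4
    abel
  simp only [h1]
  have hmp : MeasurePreserving (fun p : Euc d × Euc d => (x + p.1, ξ - p.2)) volume volume :=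
    (measurePreserving_add_left volume x).prod (Measure.measurePreserving_sub_left volume ξ)
  rw [← hmp.lintegral_comp (f := fun p : Euc d × Euc d =>
    ‖windowedFourier b (ofSchwartz g) (p.1 - x) (ξ - p.2)‖ₑ * ‖windowedFourier γ u p.1 p.2‖ₑ)]
  · simp
  · exact ((continuous_windowedFourier b (ofSchwartz g)).comp₂
      (continuous_fst.sub continuous_const)
      (continuous_const.sub continuous_snd)).enorm.measurable.mul
      (continuous_windowedFourier γ u).enorm.measurable

theorem lintegral_windowedFourier_ofSchwartz_lt_top {d : ℕ} (b g : 𝓢(Euc d, ℂ)) :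
    ∫⁻ p : Euc d × Euc d, ‖windowedFourier b (ofSchwartz g) p.1 p.2‖ₑ < ∞ := by
  obtain ⟨m, C, hC, h⟩ := exists_windowedFourier_ofSchwartz_le_weight (d := d) 0
  have hI : Integrable fun p : Euc d × Euc d => windowedFourier b (ofSchwartz g) p.1 p.2 := by
    refine (integrable_weight_mul_weight.const_mul
      (C * (schwartzNorm m b * schwartzNorm m g))).mono'
      (continuous_windowedFourier b _).aestronglyMeasurable (Eventually.of_forall fun p => ?_)
    simpa using h b g p.1 p.2
  exact hI.2

/-- Every window has a dual window. -/
theorem exists_dual_window {d : ℕ} {γ : 𝓢(Euc d, ℂ)} (hγ : γ ≠ 0) :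
    ∃ b : 𝓢(Euc d, ℂ), ∫ y, b y * γ y = 1 := by
  have hI : ∫ y, conjWindow γ y * γ y = ((∫ y, ‖γ y‖ ^ 2 : ℝ) : ℂ) := by
    rw [← integral_complex_ofReal]
    refine integral_congr_ae (Eventually.of_forall fun y => ?_)
    simp only [conjWindow_apply]
    rw [← Complex.normSq_eq_conj_mul_self, Complex.normSq_eq_norm_sq]
  have hpos : 0 < ∫ y, ‖γ y‖ ^ 2 := by
    obtain ⟨y₀, hy₀⟩ : ∃ y, γ y ≠ 0 := by
      by_contra! h
      exact hγ (SchwartzMap.ext h)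
    have hsq : Integrable fun y => ‖γ y‖ ^ 2 := (γ.memLp 2).integrable_norm_pow (by norm_num)
    refine integral_pos_of_integrable_nonneg_nonzero (x := y₀) (by have := γ.continuous; fun_prop)
      hsq (fun y => by positivity) ?_
    simpa using hy₀
  refine ⟨((∫ y, ‖γ y‖ ^ 2 : ℝ) : ℂ)⁻¹ • conjWindow γ, ?_⟩
  have : ∀ y, (((∫ y, ‖γ y‖ ^ 2 : ℝ) : ℂ)⁻¹ • conjWindow γ) y * γ y =
      ((∫ y, ‖γ y‖ ^ 2 : ℝ) : ℂ)⁻¹ * (conjWindow γ y * γ y) := fun y => by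
    simp [mul_assoc]
  simp only [this]
  rw [integral_const_mul, hI, inv_mul_cancel₀]
  exact_mod_cast hpos.ne'

/-! ### Minkowski's integral inequality -/

section Minkowski

variable {X S : Type*} [MeasurableSpace X] [MeasurableSpace S] {μ : Measure X} {ν : Measure S}
  {p : ℝ≥0∞}

theorem eLpNorm_ennreal_eq_lintegral (hp : 1 ≤ p) (hp' : p ≠ ∞) (F : X → ℝ≥0∞) :
    eLpNorm F p μ = (∫⁻ x, F x ^ p.toReal ∂μ) ^ (1 / p.toReal) := by
  rw [eLpNorm_eq_lintegral_rpow_enorm_toReal (zero_lt_one.trans_le hp).ne' hp']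
  simp

theorem eLpNorm_ennreal_top (F : X → ℝ≥0∞) : eLpNorm F ∞ μ = essSup F μ := by
  simp [eLpNorm_exponent_top, eLpNormEssSup]

theorem eLpNorm_ennreal_mono {F G : X → ℝ≥0∞} (h : ∀ x, F x ≤ G x) :
    eLpNorm F p μ ≤ eLpNorm G p μ :=
  eLpNorm_mono_enorm (by simpa using h)

theorem eLpNorm_ennreal_const_mul (hp : 1 ≤ p) (c : ℝ≥0∞) {F : X → ℝ≥0∞} (hF : Measurable F) :
    eLpNorm (fun x => c * F x) p μ = c * eLpNorm F p μ := by
  rcases eq_or_ne p ∞ with rfl | hp'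
  · simp only [eLpNorm_ennreal_top]
    exact ENNReal.essSup_const_mul
  · have hr : 0 < p.toReal := ENNReal.toReal_pos (zero_lt_one.trans_le hp).ne' hp'
    rw [eLpNorm_ennreal_eq_lintegral hp hp', eLpNorm_ennreal_eq_lintegral hp hp']
    simp only [ENNReal.mul_rpow_of_nonneg _ _ hr.le]
    rw [lintegral_const_mul _ (hF.pow_const _), ENNReal.mul_rpow_of_nonneg _ _ (by positivity),
      ← ENNReal.rpow_mul, mul_one_div_cancel hr.ne', ENNReal.rpow_one]

theorem measurable_essSup_right [SFinite μ] {G : X → S → ℝ≥0∞}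
    (hG : Measurable (Function.uncurry G)) : Measurable fun s => essSup (fun x => G x s) μ := by
  refine measurable_of_Iic fun a => ?_
  have h : (fun s => essSup (fun x => G x s) μ) ⁻¹' Set.Iic a =
      {s | μ ((fun x => (x, s)) ⁻¹' {q : X × S | a < G q.1 q.2}) = 0} := by
    ext s
    simp only [Set.mem_preimage, Set.mem_Iic, Set.mem_ofPred_eq, Set.preimage_ofPred_eq]
    constructor
    · intro hs
      have := (ENNReal.ae_le_essSup (μ := μ) fun x => G x s)
      have h2 : ∀ᵐ x ∂μ, G x s ≤ a := this.mono fun x hx => hx.trans hs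
      simpa [ae_iff] using h2
    · intro hs
      refine essSup_le_of_ae_le _ ?_
      simpa [EventuallyLE, ae_iff] using hs
  rw [h]
  exact measurable_measure_prodMk_right (measurableSet_lt measurable_const hG)
    (measurableSet_singleton 0)

theorem measurable_eLpNorm_right [SFinite μ] (hp : 1 ≤ p) {G : X → S → ℝ≥0∞}
    (hG : Measurable (Function.uncurry G)) : Measurable fun s => eLpNorm (fun x => G x s) p μ := by
  rcases eq_or_ne p ∞ with rfl | hp'
  · simp only [eLpNorm_ennreal_top]
    exact measurable_essSup_right hG
  · simp only [eLpNorm_ennreal_eq_lintegral hp hp']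
    have hG' : Measurable (Function.uncurry fun s x => G x s ^ p.toReal) :=
      (hG.comp measurable_swap).pow_const _
    exact hG'.lintegral_prod_right'.pow_const _

/-- Minkowski's integral inequality for a finite exponent `r > 1`: Hölder's inequality is applied to
the factorization `G = N^{1/r'} · (G N^{-1/r'})`, where `N` is the norm of `G` in the first
variable. -/
theorem lintegral_rpow_lintegral_le [SFinite μ] [SFinite ν] {r : ℝ} (hr : 1 < r)
    {G : X → S → ℝ≥0∞} (hG : Measurable (Function.uncurry G)) :
    (∫⁻ x, (∫⁻ s, G x s ∂ν) ^ r ∂μ) ^ (1 / r) ≤ ∫⁻ s, (∫⁻ x, G x s ^ r ∂μ) ^ (1 / r) ∂ν := by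
  have hr0 : 0 < r := zero_lt_one.trans hr
  have hpq := Real.HolderConjugate.conjExponent hr
  set q := r.conjExponent with hq
  have hq0 : 0 < q := hpq.symm.pos
  have hrq : r / q + 1 = r := by
    have := hpq.div_conj_eq_sub_one
    linarith
  set N : S → ℝ≥0∞ := fun s => (∫⁻ x, G x s ^ r ∂μ) ^ (1 / r) with hN
  have hGr : Measurable (Function.uncurry fun s x => G x s ^ r) :=
    (hG.comp measurable_swap).pow_const _
  have hNm : Measurable N := hGr.lintegral_prod_right'.pow_const _
  set M := ∫⁻ s, N s ∂ν with hM
  rcases eq_or_ne M ∞ with hMtop | hMtop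
  · rw [hMtop]; exact le_top
  have hNr : ∀ s, N s ^ r = ∫⁻ x, G x s ^ r ∂μ := fun s => by
    rw [hN, ← ENNReal.rpow_mul, one_div_mul_cancel hr0.ne', ENNReal.rpow_one]
  -- where the norm vanishes, so does the function, almost everywhere
  have hzero : ∀ᵐ x ∂μ, ∀ᵐ s ∂ν, N s = 0 → G x s = 0 := by
    refine (Measure.ae_ae_comm (p := fun x s => N s = 0 → G x s = 0) ?_).2
      (Eventually.of_forall fun s => ?_)
    · have h1 : MeasurableSet {z : X × S | N z.2 = 0} :=
        (hNm.comp measurable_snd) (measurableSet_singleton 0)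
      have h2 : MeasurableSet {z : X × S | G z.1 z.2 = 0} := hG (measurableSet_singleton 0)
      have : {z : X × S | N z.2 = 0 → G z.1 z.2 = 0} =
          {z : X × S | N z.2 = 0}ᶜ ∪ {z : X × S | G z.1 z.2 = 0} := by
        ext z; simp [imp_iff_not_or]
      exact this ▸ h1.compl.union h2
    · by_cases hs : N s = 0
      · have h1 : ∫⁻ x, G x s ^ r ∂μ = 0 := by
          rw [← hNr, hs, ENNReal.zero_rpow_of_pos hr0]
        have hm : Measurable fun x => G x s ^ r := hGr.of_uncurry_left
        filter_upwards [(lintegral_eq_zero_iff hm).1 h1] with x hx _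
        exact (ENNReal.rpow_eq_zero_iff_of_pos hr0).1 hx
      · exact Eventually.of_forall fun x h => absurd h hs
  have hfin : ∀ᵐ s ∂ν, N s < ∞ := ae_lt_top hNm hMtop
  have hpt : ∀ᵐ x ∂μ, (∫⁻ s, G x s ∂ν) ^ r ≤
      (∫⁻ s, G x s ^ r * N s ^ (-(r / q)) ∂ν) * M ^ (r / q) := by
    filter_upwards [hzero] with x hx
    have hGx : Measurable fun s => G x s := hG.of_uncurry_left
    have h1 : ∫⁻ s, G x s ∂ν ≤
        ∫⁻ s, ((fun s => G x s * N s ^ (-(1 / q))) * fun s => N s ^ (1 / q)) s ∂ν := by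
      refine lintegral_mono_ae ?_
      filter_upwards [hx, hfin] with s hs hsfin
      rcases eq_or_ne (N s) 0 with h0 | h0
      · rw [hs h0]; exact zero_le
      · rw [Pi.mul_apply, mul_assoc, ← ENNReal.rpow_add _ _ h0 hsfin.ne, neg_add_cancel,
          ENNReal.rpow_zero, mul_one]
    have h2 := h1.trans (ENNReal.lintegral_mul_le_Lp_mul_Lq ν hpq
      (hGx.mul (hNm.pow_const _)).aemeasurable (hNm.pow_const _).aemeasurable)
    have h3 := ENNReal.rpow_le_rpow h2 hr0.le
    refine h3.trans (le_of_eq ?_)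
    rw [ENNReal.mul_rpow_of_nonneg _ _ hr0.le, ← ENNReal.rpow_mul, ← ENNReal.rpow_mul,
      one_div_mul_cancel hr0.ne', ENNReal.rpow_one, one_div_mul_eq_div]
    congr 1
    · refine lintegral_congr fun s => ?_
      rw [ENNReal.mul_rpow_of_nonneg _ _ hr0.le, ← ENNReal.rpow_mul]
      congr 2
      ring
    · congr 1
      refine lintegral_congr fun s => ?_
      rw [← ENNReal.rpow_mul, one_div_mul_cancel hq0.ne', ENNReal.rpow_one]
  have hmain : ∫⁻ x, (∫⁻ s, G x s ∂ν) ^ r ∂μ ≤ M ^ r := by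
    have hm : Measurable (Function.uncurry fun x s => G x s ^ r * N s ^ (-(r / q))) :=
      (hG.pow_const _).mul ((hNm.comp measurable_snd).pow_const _)
    calc ∫⁻ x, (∫⁻ s, G x s ∂ν) ^ r ∂μ
        ≤ ∫⁻ x, (∫⁻ s, G x s ^ r * N s ^ (-(r / q)) ∂ν) * M ^ (r / q) ∂μ := lintegral_mono_ae hpt
      _ = (∫⁻ s, ∫⁻ x, G x s ^ r * N s ^ (-(r / q)) ∂μ ∂ν) * M ^ (r / q) := by
          have hm' : Measurable fun x => ∫⁻ s, G x s ^ r * N s ^ (-(r / q)) ∂ν :=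
            hm.lintegral_prod_right'
          rw [lintegral_mul_const _ hm', lintegral_lintegral_swap hm.aemeasurable]
      _ ≤ M * M ^ (r / q) := by
          gcongr
          rw [hM]
          refine lintegral_mono_ae ?_
          filter_upwards [hfin] with s hs
          rw [lintegral_mul_const _ hGr.of_uncurry_left, ← hNr]
          rcases eq_or_ne (N s) 0 with h0 | h0
          · rw [h0, ENNReal.zero_rpow_of_pos hr0, zero_mul]
          · rw [← ENNReal.rpow_add _ _ h0 hs.ne]
            refine le_of_eq ?_
            rw [show r + -(r / q) = 1 by linarith, ENNReal.rpow_one]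
      _ = M ^ r := by
          nth_rewrite 1 [← ENNReal.rpow_one M]
          rw [← ENNReal.rpow_add_of_nonneg _ _ zero_le_one (by positivity), add_comm, hrq]
  calc (∫⁻ x, (∫⁻ s, G x s ∂ν) ^ r ∂μ) ^ (1 / r) ≤ (M ^ r) ^ (1 / r) :=
        ENNReal.rpow_le_rpow hmain (by positivity)
    _ = M := by rw [← ENNReal.rpow_mul, mul_one_div_cancel hr0.ne', ENNReal.rpow_one]

/-- Minkowski's integral inequality. -/
theorem eLpNorm_lintegral_le [SFinite μ] [SFinite ν] (hp : 1 ≤ p) {G : X → S → ℝ≥0∞}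
    (hG : Measurable (Function.uncurry G)) :
    eLpNorm (fun x => ∫⁻ s, G x s ∂ν) p μ ≤ ∫⁻ s, eLpNorm (fun x => G x s) p μ ∂ν := by
  rcases eq_or_ne p ∞ with rfl | hp'
  · simp only [eLpNorm_ennreal_top]
    refine essSup_le_of_ae_le _ ?_
    have h1 : ∀ᵐ x ∂μ, ∀ᵐ s ∂ν, G x s ≤ essSup (fun x => G x s) μ := by
      refine (Measure.ae_ae_comm (p := fun x s => G x s ≤ essSup (fun x => G x s) μ) ?_).2
        (Eventually.of_forall fun s => ENNReal.ae_le_essSup _)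
      exact measurableSet_le hG ((measurable_essSup_right hG).comp measurable_snd)
    filter_upwards [h1] with x hx
    exact lintegral_mono_ae hx
  · simp only [eLpNorm_ennreal_eq_lintegral hp hp']
    have h1 : 1 ≤ p.toReal := by
      rw [← ENNReal.toReal_one]
      exact (ENNReal.toReal_le_toReal ENNReal.one_ne_top hp').2 hp
    rcases h1.eq_or_lt with h1 | h1
    · rw [← h1]
      simp only [ENNReal.rpow_one, div_one]
      exact (lintegral_lintegral_swap hG.aemeasurable).le
    · exact lintegral_rpow_lintegral_le h1 hG

end Minkowski

/-! ### Change of window -/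

theorem eLpNorm_comp_add_right {d : ℕ} (F : Euc d → ℝ≥0∞) (hF : Measurable F) (a : Euc d)
    (p : ℝ≥0∞) : eLpNorm (fun x => F (x + a)) p volume = eLpNorm F p volume :=
  eLpNorm_comp_measurePreserving hF.aestronglyMeasurable (measurePreserving_add_right volume a)

/-- Mixed norms are dominated by those of a larger function, up to a superposition of translates. -/
theorem mixedNorm_le_of_le_lintegral {d : ℕ} {p q : ℝ≥0∞} (hp : 1 ≤ p) (hq : 1 ≤ q)
    {K F G : Euc d → Euc d → ℝ≥0∞} (hK : Measurable (Function.uncurry K))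
    (hG : Measurable (Function.uncurry G))
    (h : ∀ x ξ, F x ξ ≤ ∫⁻ s : Euc d × Euc d, K s.1 s.2 * G (x + s.1) (ξ - s.2)) :
    eLpNorm (fun ξ => eLpNorm (fun x => F x ξ) p volume) q volume ≤
      (∫⁻ s : Euc d × Euc d, K s.1 s.2) *
        eLpNorm (fun ξ => eLpNorm (fun x => G x ξ) p volume) q volume := by
  set N : Euc d → ℝ≥0∞ := fun ξ => eLpNorm (fun x => G x ξ) p volume with hN
  have hNm : Measurable N := measurable_eLpNorm_right hp hG
  have hKm : Measurable fun s : Euc d × Euc d => K s.1 s.2 := hK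
  have hGξ : ∀ ξ, Measurable fun x => G x ξ := fun ξ => hG.comp (measurable_id.prodMk measurable_const)
  have inner : ∀ ξ, eLpNorm (fun x => F x ξ) p volume ≤
      ∫⁻ s : Euc d × Euc d, K s.1 s.2 * N (ξ - s.2) := fun ξ => by
    refine (eLpNorm_ennreal_mono fun x => h x ξ).trans ?_
    refine (eLpNorm_lintegral_le hp (G := fun x (s : Euc d × Euc d) =>
      K s.1 s.2 * G (x + s.1) (ξ - s.2)) ?_).trans (le_of_eq ?_)
    · exact (hKm.comp measurable_snd).mul (hG.comp (f := fun z : Euc d × (Euc d × Euc d) =>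
        (z.1 + z.2.1, ξ - z.2.2)) (by fun_prop))
    · refine lintegral_congr fun s => ?_
      rw [eLpNorm_ennreal_const_mul hp (F := fun x => G (x + s.1) (ξ - s.2)) _
          ((hGξ _).comp (measurable_id.add_const _)),
        eLpNorm_comp_add_right (fun x => G x (ξ - s.2)) (hGξ _)]
  refine (eLpNorm_ennreal_mono inner).trans ?_
  refine (eLpNorm_lintegral_le hq (G := fun ξ (s : Euc d × Euc d) =>
    K s.1 s.2 * N (ξ - s.2)) ?_).trans (le_of_eq ?_)
  · exact (hKm.comp measurable_snd).mul (hNm.comp (f := fun z : Euc d × (Euc d × Euc d) =>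
      z.1 - z.2.2) (by fun_prop))
  · rw [← lintegral_mul_const _ hKm]
    refine lintegral_congr fun s => ?_
    rw [eLpNorm_ennreal_const_mul hq (F := fun ξ => N (ξ - s.2)) _
      (hNm.comp (measurable_id.sub_const _))]
    simp only [sub_eq_add_neg]
    rw [eLpNorm_comp_add_right N hNm]

theorem modulationENorm_eq {d : ℕ} (g : 𝓢(Euc d, ℂ)) (p q : ℝ≥0∞) (f : 𝓢'(Euc d, ℂ)) :
    modulationENorm g p q f =
      eLpNorm (fun ξ => eLpNorm (fun x => ‖stft g f x ξ‖ₑ) p volume) q volume := by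
  simp only [modulationENorm, eLpNorm_enorm]

theorem measurable_enorm_windowedFourier_comp {d : ℕ} {Z : Type*} [MeasurableSpace Z]
    (g : 𝓢(Euc d, ℂ)) (u : 𝓢'(Euc d, ℂ)) {a b : Z → Euc d} (ha : Measurable a)
    (hb : Measurable b) : Measurable fun z => ‖windowedFourier g u (a z) (b z)‖ₑ := by
  have h := (continuous_windowedFourier g u).enorm.measurable.comp (ha.prodMk hb)
  simpa only [Function.comp_def] using h

theorem measurable_enorm_stft_comp {d : ℕ} {Z : Type*} [MeasurableSpace Z]
    (g : 𝓢(Euc d, ℂ)) (f : 𝓢'(Euc d, ℂ)) {a b : Z → Euc d} (ha : Measurable a)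
    (hb : Measurable b) : Measurable fun z => ‖stft g f (a z) (b z)‖ₑ :=
  measurable_enorm_windowedFourier_comp (conjWindow g) f ha hb

theorem measurable_enorm_stft {d : ℕ} (g : 𝓢(Euc d, ℂ)) (f : 𝓢'(Euc d, ℂ)) :
    Measurable (Function.uncurry fun x ξ => ‖stft g f x ξ‖ₑ) :=
  (continuous_windowedFourier (conjWindow g) f).enorm.measurable

theorem conjWindow_ne_zero {d : ℕ} {g : 𝓢(Euc d, ℂ)} (hg : g ≠ 0) : conjWindow g ≠ 0 := by
  intro h
  refine hg (SchwartzMap.ext fun y => ?_)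
  have : conjWindow g y = 0 := by rw [h]; rfl
  rw [conjWindow_apply] at this
  simpa using this

/-- Different windows give equivalent norms on the modulation spaces. -/
theorem exists_modulationENorm_le {d : ℕ} {g₀ : 𝓢(Euc d, ℂ)} (hg₀ : g₀ ≠ 0) (g : 𝓢(Euc d, ℂ)) :
    ∃ C : ℝ≥0, ∀ p q : ℝ≥0∞, 1 ≤ p → 1 ≤ q → ∀ f : 𝓢'(Euc d, ℂ),
      modulationENorm g p q f ≤ C * modulationENorm g₀ p q f := by
  obtain ⟨b, hb⟩ := exists_dual_window (conjWindow_ne_zero hg₀)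
  have hfin := lintegral_windowedFourier_ofSchwartz_lt_top b (conjWindow g)
  refine ⟨(∫⁻ s : Euc d × Euc d, ‖windowedFourier b (ofSchwartz (conjWindow g)) s.1 s.2‖ₑ).toNNReal,
    fun p q hp hq f => ?_⟩
  rw [ENNReal.coe_toNNReal hfin.ne, modulationENorm_eq, modulationENorm_eq]
  exact mixedNorm_le_of_le_lintegral hp hq
    (K := fun z η => ‖windowedFourier b (ofSchwartz (conjWindow g)) z η‖ₑ)
    (continuous_windowedFourier b _).enorm.measurable (measurable_enorm_stft g₀ f)
    (fun x ξ => enorm_windowedFourier_le_lintegral hb (conjWindow g) f x ξ)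

/-- Different windows give equivalent norms on the Wiener amalgam space. -/
theorem exists_distAmalgamENorm_le {d : ℕ} {g₀ : 𝓢(Euc d, ℂ)} (hg₀ : g₀ ≠ 0) (g : 𝓢(Euc d, ℂ)) :
    ∃ C : ℝ≥0, ∀ u : 𝓢'(Euc d, ℂ), distAmalgamENorm g u ≤ C * distAmalgamENorm g₀ u := by
  obtain ⟨b, hb⟩ := exists_dual_window hg₀
  set K : Euc d × Euc d → ℝ≥0∞ := fun s => ‖windowedFourier b (ofSchwartz g) s.1 s.2‖ₑ with hK
  have hfin : ∫⁻ s, K s < ∞ := lintegral_windowedFourier_ofSchwartz_lt_top b g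
  have hKm : Measurable K := (continuous_windowedFourier b _).enorm.measurable
  refine ⟨(∫⁻ s, K s).toNNReal, fun u => ?_⟩
  rw [ENNReal.coe_toNNReal hfin.ne]
  refine iSup_le fun x => ?_
  rw [eLpNorm_one_eq_lintegral_enorm]
  calc ∫⁻ ξ, ‖windowedFourier g u x ξ‖ₑ
      ≤ ∫⁻ ξ, ∫⁻ s : Euc d × Euc d, K s * ‖windowedFourier g₀ u (x + s.1) (ξ - s.2)‖ₑ :=
        lintegral_mono fun ξ => enorm_windowedFourier_le_lintegral hb g u x ξ
    _ = ∫⁻ s : Euc d × Euc d, ∫⁻ ξ, K s * ‖windowedFourier g₀ u (x + s.1) (ξ - s.2)‖ₑ := by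
        refine lintegral_lintegral_swap (Measurable.aemeasurable ?_)
        exact (hKm.comp measurable_snd).mul (measurable_enorm_windowedFourier_comp g₀ u
          (by fun_prop) (by fun_prop))
    _ ≤ ∫⁻ s : Euc d × Euc d, K s * distAmalgamENorm g₀ u := by
        refine lintegral_mono fun s => ?_
        rw [lintegral_const_mul _ (measurable_enorm_windowedFourier_comp g₀ u (by fun_prop)
            (by fun_prop)),
          lintegral_sub_right_eq_self (fun ξ => ‖windowedFourier g₀ u (x + s.1) ξ‖ₑ) s.2,
          ← eLpNorm_one_eq_lintegral_enorm]
        gcongr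
        exact le_iSup (fun x => eLpNorm (windowedFourier g₀ u x) 1 volume) (x + s.1)
    _ = (∫⁻ s, K s) * distAmalgamENorm g₀ u := lintegral_mul_const _ hKm

/-! ### Embeddings between modulation spaces -/

theorem lintegral_weight_lt_top {d : ℕ} : ∫⁻ y : Euc d, ENNReal.ofReal (weight y) < ∞ :=
  integrable_weight.lintegral_lt_top

theorem ofReal_weight_rpow_le {d : ℕ} (y : Euc d) {r : ℝ} (hr : 1 ≤ r) :
    ENNReal.ofReal (weight y) ^ r ≤ ENNReal.ofReal (weight y) := by
  rw [ENNReal.ofReal_rpow_of_pos (weight_pos y)]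
  refine ENNReal.ofReal_le_ofReal ?_
  simpa using Real.rpow_le_rpow_of_exponent_ge (weight_pos y) (weight_le_one y) hr

theorem one_le_toReal {p : ℝ≥0∞} (hp : 1 ≤ p) (hp' : p ≠ ∞) : 1 ≤ p.toReal := by
  rw [← ENNReal.toReal_one]
  exact (ENNReal.toReal_le_toReal ENNReal.one_ne_top hp').2 hp

theorem measurable_ofReal_weight {d : ℕ} : Measurable fun y : Euc d => ENNReal.ofReal (weight y) :=
  continuous_weight.measurable.ennreal_ofReal

theorem eLpNorm_weight_lt_top {d : ℕ} {p : ℝ≥0∞} (hp : 1 ≤ p) :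
    eLpNorm (fun y : Euc d => ENNReal.ofReal (weight y)) p volume < ∞ := by
  rcases eq_or_ne p ∞ with rfl | hp'
  · rw [eLpNorm_ennreal_top]
    refine lt_of_le_of_lt (essSup_le_of_ae_le 1 (Eventually.of_forall fun y => ?_))
      ENNReal.one_lt_top
    simpa using weight_le_one y
  · rw [eLpNorm_ennreal_eq_lintegral hp hp']
    refine ENNReal.rpow_lt_top_of_nonneg (by positivity) (lt_of_le_of_lt ?_
      (lintegral_weight_lt_top (d := d))).ne
    exact lintegral_mono fun y => ofReal_weight_rpow_le y (one_le_toReal hp hp')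

theorem exists_lintegral_weight_mul_le {d : ℕ} {p : ℝ≥0∞} (hp : 1 ≤ p) :
    ∃ C : ℝ≥0∞, C < ∞ ∧ ∀ F : Euc d → ℝ≥0∞, Measurable F →
      ∫⁻ y, ENNReal.ofReal (weight y) * F y ≤ C * eLpNorm F p volume := by
  rcases eq_or_ne p ∞ with rfl | hp'
  · refine ⟨_, lintegral_weight_lt_top (d := d), fun F hF => ?_⟩
    rw [eLpNorm_ennreal_top, ← lintegral_mul_const _ measurable_ofReal_weight]
    refine lintegral_mono_ae ?_
    filter_upwards [ENNReal.ae_le_essSup F] with y hy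
    gcongr
  rcases (one_le_toReal hp hp').eq_or_lt with h1 | h1
  · refine ⟨1, ENNReal.one_lt_top, fun F hF => ?_⟩
    rw [eLpNorm_ennreal_eq_lintegral hp hp', ← h1, one_mul]
    simp only [ENNReal.rpow_one, div_one]
    refine lintegral_mono fun y => mul_le_of_le_one_left zero_le ?_
    simpa using weight_le_one y
  · have hpq := (Real.HolderConjugate.conjExponent h1).symm
    refine ⟨_, ENNReal.rpow_lt_top_of_nonneg (y := 1 / p.toReal.conjExponent)
      (div_nonneg zero_le_one hpq.nonneg) (lt_of_le_of_lt (lintegral_mono fun y : Euc d =>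
        ofReal_weight_rpow_le y hpq.lt.le) (lintegral_weight_lt_top (d := d))).ne, fun F hF => ?_⟩
    rw [eLpNorm_ennreal_eq_lintegral hp hp']
    exact ENNReal.lintegral_mul_le_Lp_mul_Lq volume hpq measurable_ofReal_weight.aemeasurable
      hF.aemeasurable

/-- Every modulation space is contained in `M^{∞,∞}`. -/
theorem exists_norm_stft_le {d : ℕ} {g : 𝓢(Euc d, ℂ)} (hg : g ≠ 0) {p q : ℝ≥0∞} (hp : 1 ≤ p)
    (hq : 1 ≤ q) {f : 𝓢'(Euc d, ℂ)} (hf : modulationENorm g p q f < ∞) :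
    ∃ M : ℝ, ∀ x ξ, ‖stft g f x ξ‖ ≤ M := by
  obtain ⟨b, hb⟩ := exists_dual_window (conjWindow_ne_zero hg)
  obtain ⟨m, C, hC, hdecay⟩ := exists_windowedFourier_ofSchwartz_le_weight (d := d) 0
  obtain ⟨Cp, hCp, hp'⟩ := exists_lintegral_weight_mul_le (d := d) hp
  obtain ⟨Cq, hCq, hq'⟩ := exists_lintegral_weight_mul_le (d := d) hq
  set D := C * (schwartzNorm m b * schwartzNorm m (conjWindow g)) with hD
  have hD0 : 0 ≤ D := by positivity
  set w : Euc d → ℝ≥0∞ := fun y => ENNReal.ofReal (weight y) with hw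
  set B := ENNReal.ofReal D * (Cp * (Cq * modulationENorm g p q f)) with hB
  have hBfin : B < ∞ := ENNReal.mul_lt_top ENNReal.ofReal_lt_top
    (ENNReal.mul_lt_top hCp (ENNReal.mul_lt_top hCq hf))
  have hm := measurable_enorm_stft g f
  refine ⟨B.toReal, fun x ξ => ?_⟩
  rw [← toReal_enorm]
  refine ENNReal.toReal_mono hBfin.ne ?_
  have hN : Measurable fun ξ => eLpNorm (fun x => ‖stft g f x ξ‖ₑ) p volume :=
    measurable_eLpNorm_right hp hm
  have hint : Measurable fun s : Euc d × Euc d => w s.1 * ‖stft g f (x + s.1) (ξ - s.2)‖ₑ :=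
    (measurable_ofReal_weight.comp measurable_fst).mul (measurable_enorm_stft_comp g f
      (by fun_prop) (by fun_prop))
  have hint' : Measurable fun s : Euc d × Euc d =>
      w s.2 * (w s.1 * ‖stft g f (x + s.1) (ξ - s.2)‖ₑ) :=
    (measurable_ofReal_weight.comp measurable_snd).mul hint
  calc ‖stft g f x ξ‖ₑ ≤ ∫⁻ s : Euc d × Euc d,
        ‖windowedFourier b (ofSchwartz (conjWindow g)) s.1 s.2‖ₑ *
          ‖stft g f (x + s.1) (ξ - s.2)‖ₑ :=
        enorm_windowedFourier_le_lintegral hb (conjWindow g) f x ξ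
    _ ≤ ∫⁻ s : Euc d × Euc d, ENNReal.ofReal D * (w s.2 *
          (w s.1 * ‖stft g f (x + s.1) (ξ - s.2)‖ₑ)) := by
        refine lintegral_mono fun s => ?_
        rw [← mul_assoc, ← mul_assoc, mul_assoc (ENNReal.ofReal D), mul_comm (w s.2), hw,
          ← ENNReal.ofReal_mul (weight_pos _).le, ← ENNReal.ofReal_mul hD0]
        gcongr
        rw [← ofReal_norm]
        refine ENNReal.ofReal_le_ofReal ?_
        simpa using hdecay b (conjWindow g) s.1 s.2
    _ = ENNReal.ofReal D * ∫⁻ η, ∫⁻ z, w η * (w z * ‖stft g f (x + z) (ξ - η)‖ₑ) := by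
        rw [lintegral_const_mul _ hint', Measure.volume_eq_prod, lintegral_prod_symm' _ hint']
    _ ≤ ENNReal.ofReal D * ∫⁻ η, Cp * (w η * eLpNorm (fun x => ‖stft g f x (ξ - η)‖ₑ) p volume) := by
        gcongr with η
        have hmη : Measurable fun z => ‖stft g f z (ξ - η)‖ₑ :=
          measurable_enorm_stft_comp g f measurable_id measurable_const
        have hmη' : Measurable fun z => ‖stft g f (x + z) (ξ - η)‖ₑ :=
          measurable_enorm_stft_comp g f (by fun_prop) measurable_const
        have hmw : Measurable fun z => w z * ‖stft g f (x + z) (ξ - η)‖ₑ :=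
          measurable_ofReal_weight.mul hmη'
        rw [lintegral_const_mul _ hmw, mul_left_comm]
        gcongr
        refine (hp' _ hmη').trans (le_of_eq ?_)
        congr 1
        simp only [add_comm x]
        exact eLpNorm_comp_add_right (fun z => ‖stft g f z (ξ - η)‖ₑ) hmη x p
    _ ≤ B := by
        have hN' : Measurable fun η => eLpNorm (fun x => ‖stft g f x (ξ - η)‖ₑ) p volume :=
          hN.comp (measurable_const.sub measurable_id)
        have hNw : Measurable fun η => w η * eLpNorm (fun x => ‖stft g f x (ξ - η)‖ₑ) p volume :=
          measurable_ofReal_weight.mul hN'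
        rw [lintegral_const_mul _ hNw, hB]
        gcongr
        refine (hq' _ hN').trans (le_of_eq ?_)
        rw [modulationENorm_eq]
        congr 1
        exact eLpNorm_comp_measurePreserving hN.aestronglyMeasurable
          (Measure.measurePreserving_sub_left volume ξ)

theorem modulationENorm_ofSchwartz_lt_top {d : ℕ} (g φ : 𝓢(Euc d, ℂ)) {p q : ℝ≥0∞} (hp : 1 ≤ p)
    (hq : 1 ≤ q) : modulationENorm g p q (ofSchwartz φ) < ∞ := by
  obtain ⟨m, C, hC, hdecay⟩ := exists_windowedFourier_ofSchwartz_le_weight (d := d) 0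
  set D := C * (schwartzNorm m (conjWindow g) * schwartzNorm m φ) with hD
  have hD0 : 0 ≤ D := by positivity
  set w : Euc d → ℝ≥0∞ := fun y => ENNReal.ofReal (weight y) with hw
  have hwm : Measurable w := measurable_ofReal_weight
  have h1 : ∀ ξ, eLpNorm (fun x => ‖stft g (ofSchwartz φ) x ξ‖ₑ) p volume ≤
      ENNReal.ofReal D * eLpNorm w p volume * w ξ := fun ξ => by
    calc eLpNorm (fun x => ‖stft g (ofSchwartz φ) x ξ‖ₑ) p volume
        ≤ eLpNorm (fun x => (ENNReal.ofReal D * w ξ) * w x) p volume := by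
          refine eLpNorm_ennreal_mono fun x => ?_
          rw [hw, mul_assoc, ← ENNReal.ofReal_mul (weight_pos _).le, ← ENNReal.ofReal_mul hD0,
            ← ofReal_norm]
          refine ENNReal.ofReal_le_ofReal ?_
          rw [mul_comm (weight ξ)]
          simpa [stft] using hdecay (conjWindow g) φ x ξ
      _ = _ := by rw [eLpNorm_ennreal_const_mul hp _ hwm]; ring
  rw [modulationENorm_eq]
  refine (eLpNorm_ennreal_mono h1).trans_lt ?_
  rw [eLpNorm_ennreal_const_mul hq _ hwm]
  exact ENNReal.mul_lt_top (ENNReal.mul_lt_top ENNReal.ofReal_lt_top (eLpNorm_weight_lt_top hp))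
    (eLpNorm_weight_lt_top hq)

theorem modulationENorm_add_le {d : ℕ} (g : 𝓢(Euc d, ℂ)) {p q : ℝ≥0∞} (hp : 1 ≤ p)
    (hq : 1 ≤ q) (f f' : 𝓢'(Euc d, ℂ)) :
    modulationENorm g p q (f + f') ≤ modulationENorm g p q f + modulationENorm g p q f' := by
  have hm := fun f => measurable_enorm_stft g f
  have hN : ∀ f, Measurable fun ξ => eLpNorm (fun x => ‖stft g f x ξ‖ₑ) p volume := fun f =>
    measurable_eLpNorm_right hp (hm f)
  simp only [modulationENorm_eq]
  refine (eLpNorm_ennreal_mono fun ξ => ?_).trans (eLpNorm_add_le (hN f).aestronglyMeasurable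
    (hN f').aestronglyMeasurable hq)
  refine (eLpNorm_ennreal_mono fun x => ?_).trans (eLpNorm_add_le
    (measurable_enorm_stft_comp g f measurable_id measurable_const).aestronglyMeasurable
    (measurable_enorm_stft_comp g f' measurable_id measurable_const).aestronglyMeasurable hp)
  exact enorm_add_le _ _

theorem modulationENorm_smul {d : ℕ} (g : 𝓢(Euc d, ℂ)) {p q : ℝ≥0∞} (hp : 1 ≤ p)
    (hq : 1 ≤ q) (c : ℂ) (f : 𝓢'(Euc d, ℂ)) :
    modulationENorm g p q (c • f) = ‖c‖ₑ * modulationENorm g p q f := by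
  have hm := measurable_enorm_stft g f
  simp only [modulationENorm_eq]
  rw [← eLpNorm_ennreal_const_mul hq _ (measurable_eLpNorm_right hp hm)]
  congr 1
  ext1 ξ
  have hmξ : Measurable fun x => ‖stft g f x ξ‖ₑ :=
    measurable_enorm_stft_comp g f measurable_id measurable_const
  rw [← eLpNorm_ennreal_const_mul hp _ hmξ]
  congr 1
  ext1 x
  rw [← enorm_mul]
  rfl

/-! ### The algebra of Fourier transforms of integrable functions -/

/-- The function `f` is the inverse Fourier transform of an integrable function of `L¹` norm at
most `r`. -/
def IsFourierL1 {d : ℕ} (f : Euc d → ℂ) (r : ℝ) : Prop :=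
  ∃ a : Euc d → ℂ, Integrable a ∧ ∫ η, ‖a η‖ ≤ r ∧ ∀ y, f y = ∫ η, a η * character (-η) y

theorem continuous_character_neg_left {d : ℕ} (y : Euc d) :
    Continuous fun η : Euc d => character (-η) y := by
  unfold character
  fun_prop

theorem integrable_mul_character_neg {d : ℕ} {X : Type*} [MeasurableSpace X] {ν : Measure X}
    {a : X → ℂ} (ha : Integrable a ν) {v : X → Euc d} (hv : Measurable v) (y : Euc d) :
    Integrable (fun s => a s * character (-v s) y) ν :=
  ha.mul_of_top_left (memLp_top_of_bound
    (((continuous_character_neg_left y).measurable.comp hv).aestronglyMeasurable) 1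
    (Eventually.of_forall fun _ => (norm_character _ _).le))

namespace IsFourierL1

theorem nonneg {d : ℕ} {f : Euc d → ℂ} {r : ℝ} (hf : IsFourierL1 f r) : 0 ≤ r := by
  obtain ⟨a, -, h, -⟩ := hf
  exact (integral_nonneg fun _ => norm_nonneg _).trans h

theorem mono {d : ℕ} {f : Euc d → ℂ} {r s : ℝ} (hf : IsFourierL1 f r) (h : r ≤ s) :
    IsFourierL1 f s := by
  obtain ⟨a, ha, hr, hfa⟩ := hf
  exact ⟨a, ha, hr.trans h, hfa⟩

/-- A superposition of inverse Fourier transforms of integrable functions is of the same kind. -/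
theorem of_integral {d : ℕ} {X : Type*} [MeasurableSpace X] {ν : Measure X} [SFinite ν]
    {H : X → Euc d → ℂ} (hH : Integrable (Function.uncurry H) (ν.prod volume)) {f : Euc d → ℂ}
    (hf : ∀ y, f y = ∫ s, (∫ ζ, H s ζ * character (-ζ) y) ∂ν) :
    IsFourierL1 f (∫ s, (∫ ζ, ‖H s ζ‖) ∂ν) := by
  refine ⟨fun ζ => ∫ s, H s ζ ∂ν, hH.integral_prod_right, ?_, fun y => ?_⟩
  · rw [integral_integral_swap hH.norm]
    exact integral_mono hH.integral_prod_right.norm hH.norm.integral_prod_right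
      fun ζ => norm_integral_le_integral_norm _
  · rw [hf, integral_integral_swap
      (integrable_mul_character_neg hH (v := Prod.snd) measurable_snd y)]
    simp only [integral_mul_const]

/-- The product of the inverse Fourier transform of an integrable function with that of a
finite measure. -/
theorem mul_of_superposition {d : ℕ} {X : Type*} [MeasurableSpace X] {ν : Measure X} [SFinite ν]
    {w : X → ℂ} (hw : Integrable w ν) {v : X → Euc d} (hv : Measurable v) {m : Euc d → ℂ}
    (hm : ∀ y, m y = ∫ s, w s * character (-v s) y ∂ν) {f : Euc d → ℂ} {r : ℝ}
    (hf : IsFourierL1 f r) : IsFourierL1 (fun y => f y * m y) (r * ∫ s, ‖w s‖ ∂ν) := by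
  obtain ⟨a, ha, hr, hfa⟩ := hf
  have hmp : MeasurePreserving (fun p : X × Euc d => (p.1, p.2 - v p.1)) (ν.prod volume)
      (ν.prod volume) :=
    (MeasurePreserving.id ν).skew_product (g := fun s ζ => ζ - v s)
      (measurable_snd.sub (hv.comp measurable_fst))
      (Eventually.of_forall fun s => (measurePreserving_sub_right volume (v s)).map_eq)
  have hH : Integrable (Function.uncurry fun s ζ => w s * a (ζ - v s)) (ν.prod volume) :=
    hmp.integrable_comp_of_integrable (hw.mul_prod ha)
  refine (of_integral hH fun y => ?_).mono ?_
  · rw [hfa, hm, ← integral_const_mul]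
    refine integral_congr_ae (Eventually.of_forall fun s => ?_)
    simp only
    rw [← integral_add_right_eq_self (fun ζ => w s * a (ζ - v s) * character (-ζ) y) (v s),
      ← integral_mul_const]
    refine integral_congr_ae (Eventually.of_forall fun ζ => ?_)
    simp only
    rw [add_sub_cancel_right, neg_add, character_add]
    ring
  · simp only [norm_mul, integral_const_mul]
    simp only [integral_sub_right_eq_self (fun ζ => ‖a ζ‖), integral_mul_const]
    rw [mul_comm]
    gcongr

theorem mul {d : ℕ} {f g : Euc d → ℂ} {r s : ℝ} (hf : IsFourierL1 f r) (hg : IsFourierL1 g s) :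
    IsFourierL1 (fun y => f y * g y) (r * s) := by
  have hr := hf.nonneg
  obtain ⟨b, hb, hs, hgb⟩ := hg
  refine (hf.mul_of_superposition hb measurable_id hgb).mono ?_
  gcongr

theorem mul_character {d : ℕ} {f : Euc d → ℂ} {r : ℝ} (hf : IsFourierL1 f r) (ξ : Euc d) :
    IsFourierL1 (fun y => f y * character ξ y) r := by
  have h := hf.mul_of_superposition (ν := Measure.dirac ()) (w := fun _ => 1)
    (integrable_const _) (v := fun _ => -ξ) measurable_const (m := character ξ) (by simp)
  simpa using h

theorem const_mul {d : ℕ} {f : Euc d → ℂ} {r : ℝ} (hf : IsFourierL1 f r) (c : ℂ) :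
    IsFourierL1 (fun y => c * f y) (‖c‖ * r) := by
  obtain ⟨a, ha, hr, hfa⟩ := hf
  refine ⟨fun η => c * a η, ha.const_mul c, ?_, fun y => ?_⟩
  · simp only [norm_mul, integral_const_mul]
    gcongr
  · simp only
    rw [hfa, ← integral_const_mul]
    simp only [mul_assoc]

theorem zero {d : ℕ} : IsFourierL1 (fun _ : Euc d => 0) 0 :=
  ⟨fun _ => 0, integrable_zero _ _ _, by simp, by simp⟩

theorem add {d : ℕ} {f g : Euc d → ℂ} {r s : ℝ} (hf : IsFourierL1 f r) (hg : IsFourierL1 g s) :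
    IsFourierL1 (fun y => f y + g y) (r + s) := by
  obtain ⟨a, ha, hr, hfa⟩ := hf
  obtain ⟨b, hb, hs, hgb⟩ := hg
  refine ⟨fun η => a η + b η, ha.add hb, ?_, fun y => ?_⟩
  · calc ∫ η, ‖a η + b η‖ ≤ ∫ η, (‖a η‖ + ‖b η‖) :=
          integral_mono (ha.add hb).norm (ha.norm.add hb.norm) fun η => norm_add_le _ _
      _ = (∫ η, ‖a η‖) + ∫ η, ‖b η‖ := integral_add ha.norm hb.norm
      _ ≤ r + s := add_le_add hr hs
  · simp only [add_mul]
    rw [hfa, hgb]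
    exact (integral_add (integrable_mul_character_neg ha measurable_id y)
      (integrable_mul_character_neg hb measurable_id y)).symm

theorem sum {d : ℕ} {ι : Type*} (S : Finset ι) {f : ι → Euc d → ℂ} {r : ι → ℝ}
    (hf : ∀ i ∈ S, IsFourierL1 (f i) (r i)) :
    IsFourierL1 (fun y => ∑ i ∈ S, f i y) (∑ i ∈ S, r i) := by
  classical
  induction S using Finset.induction_on with
  | empty => simpa using zero
  | insert i S hi ih =>
    simp only [Finset.sum_insert hi]
    exact (hf i (Finset.mem_insert_self i S)).add
      (ih fun j hj => hf j (Finset.mem_insert_of_mem hj))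

theorem of_hasSum {d : ℕ} {f : ℕ → Euc d → ℂ} {r : ℕ → ℝ} (hf : ∀ n, IsFourierL1 (f n) (r n))
    {s : ℝ} (hr : HasSum r s) {F : Euc d → ℂ} (hF : ∀ y, HasSum (fun n => f n y) (F y)) :
    IsFourierL1 F s := by
  choose a ha har hfa using hf
  -- measurable representatives, so that the family is jointly measurable
  set b : ℕ → Euc d → ℂ := fun n => (ha n).aestronglyMeasurable.mk (a n) with hb
  have hab : ∀ n, a n =ᵐ[volume] b n := fun n => (ha n).aestronglyMeasurable.ae_eq_mk
  have hbi : ∀ n, Integrable (b n) := fun n => (ha n).congr (hab n)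
  have hbn : ∀ n, ∫ η, ‖b n η‖ = ∫ η, ‖a n η‖ := fun n =>
    integral_congr_ae ((hab n).symm.fun_comp norm)
  have hsum : Summable fun n => ∫ η, ‖b n η‖ :=
    hr.summable.of_nonneg_of_le (fun n => integral_nonneg fun _ => norm_nonneg _)
      fun n => (hbn n).trans_le (har n)
  have hmeas : Measurable (Function.uncurry b) :=
    measurable_from_prod_countable_right fun n =>
      (ha n).aestronglyMeasurable.stronglyMeasurable_mk.measurable
  have hH : Integrable (Function.uncurry b) (Measure.count.prod volume) := by
    rw [integrable_prod_iff hmeas.aestronglyMeasurable]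
    refine ⟨Eventually.of_forall hbi, ?_⟩
    rw [integrable_count_iff]
    exact hsum.norm
  refine (of_integral hH (f := F) fun y => ?_).mono ?_
  · have hI := integrable_mul_character_neg hH (v := Prod.snd) measurable_snd y
    rw [show (∫ s, (∫ ζ, b s ζ * character (-ζ) y) ∂Measure.count) = _ from
      integral_countable hI.integral_prod_left]
    simp only [measureReal_def, Measure.count_singleton, ENNReal.toReal_one, one_smul]
    rw [← (hF y).tsum_eq]
    refine tsum_congr fun n => ?_
    rw [hfa]
    exact integral_congr_ae ((hab n).mono fun η h => by simp only [h])
  · rw [show (∫ s, (∫ ζ, ‖b s ζ‖) ∂Measure.count) = _ from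
      integral_countable hH.norm.integral_prod_left]
    simp only [measureReal_def, Measure.count_singleton, ENNReal.toReal_one, one_smul]
    rw [← hr.tsum_eq]
    exact Summable.tsum_le_tsum (fun n => (hbn n).trans_le (har n)) hsum hr.summable

theorem mul_pow {d : ℕ} {f g : Euc d → ℂ} {r s : ℝ} (hf : IsFourierL1 f r)
    (hg : IsFourierL1 g s) (n : ℕ) : IsFourierL1 (fun y => f y * g y ^ n) (r * s ^ n) := by
  induction n with
  | zero => simpa using hf
  | succ n ih =>
    simp only [pow_succ, ← mul_assoc]
    exact ih.mul hg

/-- The exponential series converges in the algebra. The factor `f` is needed since the constant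
function `1` is not the inverse Fourier transform of an integrable function. -/
theorem mul_exp {d : ℕ} {f g : Euc d → ℂ} {r s : ℝ} (hf : IsFourierL1 f r)
    (hg : IsFourierL1 g s) :
    IsFourierL1 (fun y => f y * Complex.exp (Complex.I * g y)) (r * Real.exp s) := by
  have hterm : ∀ n : ℕ, IsFourierL1 (fun y => f y * ((Complex.I * g y) ^ n / n.factorial))
      (r * (s ^ n / n.factorial)) := fun n => by
    have h := (hf.mul_pow hg n).const_mul (Complex.I ^ n / n.factorial)
    have e1 : ‖Complex.I ^ n / (n.factorial : ℂ)‖ * (r * s ^ n) = r * (s ^ n / n.factorial) := by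
      simp; ring
    rw [e1] at h
    convert h using 2
    rw [_root_.mul_pow]; ring
  refine of_hasSum hterm (HasSum.mul_left r ?_) fun y => HasSum.mul_left (f y) ?_
  · rw [Real.exp_eq_exp_ℝ]
    exact NormedSpace.expSeries_div_hasSum_exp s
  · rw [Complex.exp_eq_exp_ℂ]
    exact NormedSpace.expSeries_div_hasSum_exp _

theorem of_continuous {d : ℕ} {f : Euc d → ℂ} (hc : Continuous f) (hf : Integrable f)
    (hf' : Integrable (𝓕 f)) : IsFourierL1 f (∫ ξ, ‖𝓕 f ξ‖) := by
  refine ⟨𝓕 f, hf', le_rfl, fun y => ?_⟩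
  conv_lhs => rw [← hc.fourierInv_fourier_eq hf hf']
  rw [fourierInv_eq_integral_character]
  refine integral_congr_ae (Eventually.of_forall fun η => ?_)
  simp only
  rw [mul_comm, character, character]
  simp [real_inner_comm]

theorem of_schwartz {d : ℕ} (φ : 𝓢(Euc d, ℂ)) : IsFourierL1 φ (∫ ξ, ‖𝓕 φ ξ‖) := by
  have h := of_continuous φ.continuous φ.integrable
    (by rw [← SchwartzMap.fourier_coe]; exact (𝓕 φ).integrable)
  rwa [← SchwartzMap.fourier_coe] at h

/-- Uniqueness: an integrable function which is an inverse Fourier transform of an integrable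
function `a` has `a` as its Fourier transform. -/
theorem integrable_fourier {d : ℕ} {f : Euc d → ℂ} {r : ℝ} (hf : IsFourierL1 f r)
    (hi : Integrable f) : Integrable (𝓕 f) ∧ ∫ ξ, ‖𝓕 f ξ‖ ≤ r := by
  obtain ⟨a, ha, hr, hfa⟩ := hf
  have hcont : Continuous (𝓕 f) :=
    VectorFourier.fourierIntegral_continuous Real.continuous_fourierChar
      (by exact continuous_inner) hi
  have key : 𝓕 f =ᵐ[volume] a := by
    refine ae_eq_of_integral_contDiff_smul_eq hcont.locallyIntegrable ha.locallyIntegrable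
      fun g hg hgc => ?_
    set φ : 𝓢(Euc d, ℂ) := HasCompactSupport.toSchwartzMap
      (f := fun y => (g y : ℂ)) (hgc.comp_left (g := fun t : ℝ => (t : ℂ)) (by simp))
      (Complex.ofRealCLM.contDiff.comp hg) with hφ
    have hφg : ∀ y, φ y = (g y : ℂ) := fun y => rfl
    have e1 : ∀ h : Euc d → ℂ, ∫ x, g x • h x = ∫ x, φ x * h x := fun h => by
      refine integral_congr_ae (Eventually.of_forall fun x => ?_)
      simp [hφg]
    rw [e1, e1]
    have h1 : ∫ x, φ x * 𝓕 f x = ∫ y, 𝓕 φ y * f y := by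
      have := VectorFourier.integral_fourierIntegral_smul_eq_flip (L := innerₗ (Euc d))
        Real.continuous_fourierChar continuous_inner (φ.integrable (μ := volume)) hi
      simp only [flip_innerₗ, smul_eq_mul] at this
      exact this.symm
    have h2 : ∀ y, 𝓕 φ y * f y = ∫ η, 𝓕 φ y * (a η * character (-η) y) := fun y => by
      rw [hfa, ← integral_const_mul]
    rw [h1]
    simp only [h2]
    have hI : Integrable (Function.uncurry fun y η : Euc d => 𝓕 φ y * (a η * character (-η) y))
        (volume.prod volume) := by
      have h := ((𝓕 φ).integrable (μ := volume)).mul_prod ha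
      refine (h.mul_of_top_left (f := fun p => character (-p.2) p.1) (memLp_top_of_bound
        (Continuous.aestronglyMeasurable ?_) 1
        (Eventually.of_forall fun _ => (norm_character _ _).le))).congr
        (Eventually.of_forall fun p => ?_)
      · unfold character
        fun_prop
      · simp [Function.uncurry, mul_assoc]
    rw [integral_integral_swap hI]
    refine integral_congr_ae (Eventually.of_forall fun η => ?_)
    have h3 : φ η = ∫ y, character (-η) y * 𝓕 φ y := by
      rw [← fourierInv_eq_integral_character, ← SchwartzMap.fourierInv_coe, fourierInv_fourier_eq]
    simp only
    rw [h3, ← integral_mul_const]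
    refine integral_congr_ae (Eventually.of_forall fun y => ?_)
    simp only
    ring
  refine ⟨ha.congr key.symm, ?_⟩
  refine (le_of_eq (integral_congr_ae ?_)).trans hr
  exact key.fun_comp norm

end IsFourierL1

/-! ### Second order Taylor expansion of the phase -/

theorem secondPartial_eq {d : ℕ} {μ : Euc d → ℝ} (hμ : ContDiff ℝ 2 μ) (i j : Fin d) (z : Euc d) :
    secondPartial μ i j z =
      ((fderiv ℝ (fderiv ℝ μ) z (EuclideanSpace.single i 1) (EuclideanSpace.single j 1) : ℝ) : ℂ) := by
  have h1 : ContDiff ℝ 1 (fderiv ℝ μ) := hμ.fderiv_right (by norm_num)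
  have h2 : DifferentiableAt ℝ (fderiv ℝ μ) z := h1.differentiable (by norm_num) z
  rw [secondPartial, fderiv_clm_apply h2 (differentiableAt_const _)]
  simp

theorem secondPartial_comm {d : ℕ} {μ : Euc d → ℝ} (hμ : ContDiff ℝ 2 μ) (i j : Fin d) :
    secondPartial μ i j = secondPartial μ j i := by
  ext z
  rw [secondPartial_eq hμ, secondPartial_eq hμ]
  have h : IsSymmSndFDerivAt ℝ μ z := hμ.contDiffAt.isSymmSndFDerivAt (by simp)
  rw [h]

theorem continuous_secondPartial {d : ℕ} {μ : Euc d → ℝ} (hμ : ContDiff ℝ 2 μ) (i j : Fin d) :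
    Continuous (secondPartial μ i j) := by
  rw [funext (secondPartial_eq hμ i j)]
  have h1 : ContDiff ℝ 1 (fderiv ℝ μ) := hμ.fderiv_right (by norm_num)
  have h2 : Continuous (fderiv ℝ (fderiv ℝ μ)) := h1.continuous_fderiv (by norm_num)
  exact Complex.continuous_ofReal.comp ((h2.clm_apply continuous_const).clm_apply continuous_const)

theorem taylor_two {d : ℕ} {μ : Euc d → ℝ} (hμ : ContDiff ℝ 2 μ) (x y : Euc d) :
    μ (x + y) = μ x + fderiv ℝ μ x y +
      ∫ t in (0 : ℝ)..1, (1 - t) * fderiv ℝ (fderiv ℝ μ) (x + t • y) y y := by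
  have h1 : ContDiff ℝ 1 (fderiv ℝ μ) := hμ.fderiv_right (by norm_num)
  have h2 : Continuous (fderiv ℝ (fderiv ℝ μ)) := h1.continuous_fderiv (by norm_num)
  have hline : ∀ t : ℝ, HasDerivAt (fun t : ℝ => x + t • y) y t := fun t => by
    simpa using ((hasDerivAt_id t).smul_const y).const_add x
  have d0 : ∀ t : ℝ, HasDerivAt (fun t : ℝ => μ (x + t • y)) (fderiv ℝ μ (x + t • y) y) t :=
    fun t => (hμ.differentiable (by norm_num) _).hasFDerivAt.comp_hasDerivAt t (hline t)
  have d1 : ∀ t : ℝ, HasDerivAt (fun t : ℝ => fderiv ℝ μ (x + t • y) y)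
      (fderiv ℝ (fderiv ℝ μ) (x + t • y) y y) t := fun t => by
    have h := (h1.differentiable (by norm_num) (x + t • y)).hasFDerivAt.comp_hasDerivAt t (hline t)
    exact (ContinuousLinearMap.apply ℝ ℝ y).hasFDerivAt.comp_hasDerivAt t h
  have d2 : ∀ t : ℝ, HasDerivAt
      (fun t : ℝ => (1 - t) * fderiv ℝ μ (x + t • y) y + μ (x + t • y))
      ((1 - t) * fderiv ℝ (fderiv ℝ μ) (x + t • y) y y) t := fun t => by
    have h := (((hasDerivAt_id t).const_sub 1).mul (d1 t)).add (d0 t)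
    have e : (1 - t) * fderiv ℝ (fderiv ℝ μ) (x + t • y) y y =
        -1 * fderiv ℝ μ (x + t • y) y + (1 - id t) * fderiv ℝ (fderiv ℝ μ) (x + t • y) y y +
          fderiv ℝ μ (x + t • y) y := by
      simp only [id]; ring
    rw [e]
    exact h
  have hcont : Continuous fun t : ℝ => (1 - t) * fderiv ℝ (fderiv ℝ μ) (x + t • y) y y := by
    have h3 : Continuous fun t : ℝ => fderiv ℝ (fderiv ℝ μ) (x + t • y) :=
      h2.comp (by fun_prop)
    exact (by fun_prop : Continuous fun t : ℝ => 1 - t).mul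
      ((h3.clm_apply continuous_const).clm_apply continuous_const)
  rw [intervalIntegral.integral_eq_sub_of_hasDerivAt (fun t _ => d2 t)
    (hcont.intervalIntegrable _ _)]
  simp
  ring

theorem ofReal_snd_fderiv_eq_sum {d : ℕ} {μ : Euc d → ℝ} (hμ : ContDiff ℝ 2 μ) (z y : Euc d) :
    ((fderiv ℝ (fderiv ℝ μ) z y y : ℝ) : ℂ) =
      ∑ i : Fin d, ∑ j : Fin d, (y i : ℂ) * (y j : ℂ) * secondPartial μ i j z := by
  have hy : y = ∑ i : Fin d, y i • EuclideanSpace.single i (1 : ℝ) := by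
    have h := (EuclideanSpace.basisFun (Fin d) ℝ).sum_repr y
    simpa using h.symm
  have h : fderiv ℝ (fderiv ℝ μ) z y y = ∑ i : Fin d, ∑ j : Fin d, y i * y j *
      fderiv ℝ (fderiv ℝ μ) z (EuclideanSpace.single i 1) (EuclideanSpace.single j 1) := by
    set B := fderiv ℝ (fderiv ℝ μ) z
    calc B y y = B (∑ i : Fin d, y i • EuclideanSpace.single i (1 : ℝ))
          (∑ j : Fin d, y j • EuclideanSpace.single j (1 : ℝ)) := by rw [← hy]
      _ = _ := by
        simp only [map_sum, map_smul, _root_.sum_apply, _root_.smul_apply,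
          smul_eq_mul, Finset.mul_sum, ← mul_assoc]
        rw [Finset.sum_comm]
        exact Finset.sum_congr rfl fun i _ => Finset.sum_congr rfl fun j _ => by ring
  rw [h]
  push_cast
  simp only [secondPartial_eq hμ]

/-- The average of the second derivatives along the segment from `x` to `x + y` that occurs in the
integral form of the remainder. -/
noncomputable def segmentAverage {d : ℕ} (h : Euc d → ℂ) (x y : Euc d) : ℂ :=
  ∫ t in (0 : ℝ)..1, ((1 - t : ℝ) : ℂ) * h (x + t • y)

theorem ofReal_apply_add {d : ℕ} {μ : Euc d → ℝ} (hμ : ContDiff ℝ 2 μ) (x y : Euc d) :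
    (μ (x + y) : ℂ) = μ x + (fderiv ℝ μ x y : ℝ) + ∑ i : Fin d, ∑ j : Fin d,
      (y i : ℂ) * (y j : ℂ) * segmentAverage (secondPartial μ i j) x y := by
  rw [taylor_two hμ x y]
  push_cast
  congr 1
  rw [← intervalIntegral.integral_ofReal]
  have hc : ∀ i j : Fin d, IntervalIntegrable (fun t : ℝ => (y i : ℂ) * (y j : ℂ) *
      (((1 - t : ℝ) : ℂ) * secondPartial μ i j (x + t • y))) volume 0 1 := fun i j => by
    refine Continuous.intervalIntegrable ?_ _ _
    have := continuous_secondPartial hμ i j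
    fun_prop
  simp only [segmentAverage, ← intervalIntegral.integral_const_mul]
  simp only [← intervalIntegral.integral_finsetSum fun j _ => hc _ j]
  rw [← intervalIntegral.integral_finsetSum]
  · congr 1
    ext t
    push_cast
    rw [ofReal_snd_fderiv_eq_sum hμ, Finset.mul_sum]
    refine Finset.sum_congr rfl fun i _ => ?_
    rw [Finset.mul_sum]
    exact Finset.sum_congr rfl fun j _ => by ring
  · intro i _
    refine Continuous.intervalIntegrable ?_ _ _
    have := fun j => continuous_secondPartial hμ i j
    fun_prop

/-- The exponential of a linear functional is a character. -/
theorem exists_exp_eq_character {d : ℕ} (L : Euc d →L[ℝ] ℝ) :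
    ∃ ξ : Euc d, ∀ y, Complex.exp (Complex.I * (L y : ℝ)) = character ξ y := by
  refine ⟨-((2 * Real.pi)⁻¹ • (InnerProductSpace.toDual ℝ (Euc d)).symm L), fun y => ?_⟩
  have h : inner ℝ y ((InnerProductSpace.toDual ℝ (Euc d)).symm L) = L y := by
    rw [real_inner_comm, InnerProductSpace.toDual_symm_apply]
  rw [character, inner_neg_right, inner_smul_right, h]
  congr 1
  push_cast
  have : (Real.pi : ℂ) ≠ 0 := by exact_mod_cast Real.pi_ne_zero
  field_simp

/-- The average of the dilates of `P` is the inverse Fourier transform of a finite measure, the image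
of `(1 - t) 𝓕P(η) dt dη` under `(t, η) ↦ t η`. -/
theorem IsFourierL1.mul_segmentAverage {d : ℕ} {f P : Euc d → ℂ} {r s : ℝ} (hf : IsFourierL1 f r)
    (hP : IsFourierL1 P s) : IsFourierL1 (fun y => f y * segmentAverage P 0 y) (r * s) := by
  have hr := hf.nonneg
  obtain ⟨b, hb, hs, hPb⟩ := hP
  set ν : Measure ℝ := volume.restrict (Set.Ioc 0 1) with hν
  have hfin : ν Set.univ = 1 := by simp [hν]
  have : IsFiniteMeasure ν := ⟨by rw [hfin]; exact ENNReal.one_lt_top⟩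
  have h1t : Integrable (fun t : ℝ => ((1 - t : ℝ) : ℂ)) ν :=
    (Continuous.integrableOn_Icc (by fun_prop)).mono_set Set.Ioc_subset_Icc_self
  have hw : Integrable (fun p : ℝ × Euc d => ((1 - p.1 : ℝ) : ℂ) * b p.2) (ν.prod volume) :=
    h1t.mul_prod hb
  have hvm : Measurable fun p : ℝ × Euc d => p.1 • p.2 := by fun_prop
  refine (hf.mul_of_superposition hw hvm (m := segmentAverage P 0) fun y => ?_).mono ?_
  · rw [integral_prod _ (integrable_mul_character_neg hw hvm y), segmentAverage,
      intervalIntegral.integral_of_le zero_le_one]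
    refine integral_congr_ae (Eventually.of_forall fun t => ?_)
    simp only
    rw [zero_add, hPb, ← integral_const_mul]
    refine integral_congr_ae (Eventually.of_forall fun η => ?_)
    simp only [mul_assoc]
    congr 2
    rw [character, character]
    congr 3
    simp [inner_smul_left, inner_smul_right]
  · gcongr
    simp only [norm_mul]
    rw [integral_prod_mul (fun t : ℝ => ‖((1 - t : ℝ) : ℂ)‖) fun η => ‖b η‖]
    have h2 : ∫ t, ‖((1 - t : ℝ) : ℂ)‖ ∂ν ≤ 1 := by
      calc ∫ t, ‖((1 - t : ℝ) : ℂ)‖ ∂ν ≤ ∫ _t, (1 : ℝ) ∂ν := by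
            refine integral_mono_ae h1t.norm (integrable_const _) ?_
            filter_upwards [ae_restrict_mem measurableSet_Ioc] with t ht
            rw [Complex.norm_real, Real.norm_of_nonneg (by linarith [ht.2])]
            linarith [ht.1]
        _ = 1 := by simp [measureReal_def, hfin]
    calc (∫ t, ‖((1 - t : ℝ) : ℂ)‖ ∂ν) * ∫ η, ‖b η‖ ≤ 1 * s := by
          gcongr
      _ = s := one_mul s

/-! ### Functions as tempered distributions -/

theorem hasCompactSupport_atom {d : ℕ} {g : 𝓢(Euc d, ℂ)} (hg : HasCompactSupport (g : Euc d → ℂ))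
    (x ξ : Euc d) : HasCompactSupport (atom g x ξ : Euc d → ℂ) := by
  have h1 : HasCompactSupport fun y => g (y - x) :=
    hg.comp_homeomorph (Homeomorph.subRight x)
  have h2 : (atom g x ξ : Euc d → ℂ) = fun y => character ξ y * g (y - x) :=
    funext fun y => atom_apply g x ξ y
  rw [h2]
  exact h1.mul_left

theorem integral_mul_atom {d : ℕ} (F : Euc d → ℂ) (g : 𝓢(Euc d, ℂ)) (x ξ : Euc d) :
    ∫ y, F y * atom g x ξ y = character ξ x * 𝓕 (fun y => g y * F (x + y)) ξ := by
  rw [fourier_eq_integral_character, ← integral_const_mul, ← integral_add_left_eq_self _ x]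
  refine integral_congr_ae (Eventually.of_forall fun y => ?_)
  simp only [atom_apply, add_sub_cancel_left, character_add_right]
  ring

theorem windowedFourier_of_represents {d : ℕ} {F : Euc d → ℂ} {u : 𝓢'(Euc d, ℂ)}
    (h : Represents F u) {g : 𝓢(Euc d, ℂ)} (hg : HasCompactSupport (g : Euc d → ℂ)) (x ξ : Euc d) :
    windowedFourier g u x ξ = character ξ x * 𝓕 (fun y => g y * F (x + y)) ξ := by
  rw [windowedFourier, h.2 _ (hasCompactSupport_atom hg x ξ), integral_mul_atom]

/-- The amalgam norm bounds the Fourier transforms of all localizations by a compactly supported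
window. -/
theorem exists_lintegral_fourier_le {d : ℕ} {g₀ : 𝓢(Euc d, ℂ)} (hg₀ : g₀ ≠ 0) {g : 𝓢(Euc d, ℂ)}
    (hg : HasCompactSupport (g : Euc d → ℂ)) : ∃ C : ℝ≥0, ∀ (F : Euc d → ℂ) (x : Euc d),
      ∫⁻ ξ, ‖𝓕 (fun y => g y * F (x + y)) ξ‖ₑ ≤ C * amalgamENorm g₀ F := by
  obtain ⟨C, hC⟩ := exists_distAmalgamENorm_le hg₀ g
  refine ⟨C + 1, fun F x => ?_⟩
  have hC0 : ((C + 1 : ℝ≥0) : ℝ≥0∞) ≠ 0 := by simp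
  rw [mul_comm, ← ENNReal.div_le_iff hC0 ENNReal.coe_ne_top]
  refine le_iInf₂ fun u hu => ?_
  rw [ENNReal.div_le_iff hC0 ENNReal.coe_ne_top, mul_comm]
  calc ∫⁻ ξ, ‖𝓕 (fun y => g y * F (x + y)) ξ‖ₑ = eLpNorm (windowedFourier g u x) 1 volume := by
        rw [eLpNorm_one_eq_lintegral_enorm]
        refine lintegral_congr fun ξ => ?_
        rw [windowedFourier_of_represents hu hg, enorm_mul, ← ofReal_norm (character ξ x),
          norm_character]
        simp
    _ ≤ distAmalgamENorm g u := le_iSup (fun x => eLpNorm (windowedFourier g u x) 1 volume) x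
    _ ≤ C * distAmalgamENorm g₀ u := hC u
    _ ≤ _ := by gcongr; simp

/-- The tempered distribution given by a bounded continuous function. -/
theorem exists_tempered_of_bounded {d : ℕ} {σ : Euc d → ℂ} (hσ : Continuous σ) {M : ℝ}
    (hM : ∀ y, ‖σ y‖ ≤ M) :
    ∃ u : 𝓢'(Euc d, ℂ), ∀ φ : 𝓢(Euc d, ℂ), u φ = ∫ y, σ y * φ y := by
  have hL : MemLp σ ∞ volume :=
    memLp_top_of_bound hσ.aestronglyMeasurable M (Eventually.of_forall hM)
  refine ⟨Lp.toTemperedDistribution hL.toLp, fun φ => ?_⟩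
  rw [Lp.toTemperedDistribution_apply]
  refine integral_congr_ae ?_
  filter_upwards [hL.coeFn_toLp] with y hy
  rw [hy, smul_eq_mul, mul_comm]

/-! ### The amalgam norm of a unimodular function -/

theorem norm_unimodular {d : ℕ} (μ : Euc d → ℝ) (y : Euc d) : ‖unimodular μ y‖ = 1 := by
  rw [unimodular, mul_comm, Complex.norm_exp_ofReal_mul_I]

theorem continuous_unimodular {d : ℕ} {μ : Euc d → ℝ} (hμ : Continuous μ) :
    Continuous (unimodular μ) := by
  unfold unimodular
  fun_prop

/-- A smooth bump function centred at the origin, as a complex-valued Schwartz function. -/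
noncomputable def cutoff {d : ℕ} (b : ContDiffBump (0 : Euc d)) : 𝓢(Euc d, ℂ) :=
  HasCompactSupport.toSchwartzMap (f := fun y => (b y : ℂ))
    (b.hasCompactSupport.comp_left (g := fun t : ℝ => (t : ℂ)) Complex.ofReal_zero)
    (Complex.ofRealCLM.contDiff.comp b.contDiff)

theorem cutoff_apply {d : ℕ} (b : ContDiffBump (0 : Euc d)) (y : Euc d) :
    cutoff b y = (b y : ℂ) := rfl

theorem hasCompactSupport_cutoff {d : ℕ} (b : ContDiffBump (0 : Euc d)) :
    HasCompactSupport (cutoff b : Euc d → ℂ) :=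
  b.hasCompactSupport.comp_left (g := fun t : ℝ => (t : ℂ)) Complex.ofReal_zero

theorem cutoff_ne_zero {d : ℕ} (b : ContDiffBump (0 : Euc d)) : cutoff b ≠ 0 := by
  intro h
  have h1 : cutoff b 0 = 0 := by rw [h]; rfl
  rw [cutoff_apply, b.one_of_mem_closedBall (by simp [b.rIn_pos.le])] at h1
  simp at h1

theorem hasTemperateGrowth_coord_mul_coord {d : ℕ} (i j : Fin d) :
    (fun y : Euc d => (y i : ℂ) * (y j : ℂ)).HasTemperateGrowth := by
  have h : ∀ i : Fin d, (fun y : Euc d => (y i : ℂ)).HasTemperateGrowth := fun i =>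
    (Complex.ofRealCLM.comp (EuclideanSpace.proj i)).hasTemperateGrowth
  exact (h i).mul (h j)

theorem IsFourierL1.of_amalgamENorm {d : ℕ} {g₀ g : 𝓢(Euc d, ℂ)}
    (hg : HasCompactSupport (g : Euc d → ℂ)) {C : ℝ≥0} {F : Euc d → ℂ} {x : Euc d}
    (hC : ∫⁻ ξ, ‖𝓕 (fun y => g y * F (x + y)) ξ‖ₑ ≤ C * amalgamENorm g₀ F) (hF : Continuous F)
    (hfin : amalgamENorm g₀ F < ∞) :
    IsFourierL1 (fun y => g y * F (x + y)) (C * (amalgamENorm g₀ F).toReal) := by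
  have hc : Continuous fun y => g y * F (x + y) :=
    g.continuous.mul (hF.comp (continuous_const.add continuous_id))
  have hi : Integrable fun y => g y * F (x + y) := hc.integrable_of_hasCompactSupport hg.mul_right
  have hlt : (C : ℝ≥0∞) * amalgamENorm g₀ F < ∞ := ENNReal.mul_lt_top ENNReal.coe_lt_top hfin
  have hcont : Continuous (𝓕 fun y => g y * F (x + y)) :=
    VectorFourier.fourierIntegral_continuous Real.continuous_fourierChar
      (by exact continuous_inner) hi
  have hi' : Integrable (𝓕 fun y => g y * F (x + y)) :=
    ⟨hcont.aestronglyMeasurable, hC.trans_lt hlt⟩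
  refine (IsFourierL1.of_continuous hc hi hi').mono ?_
  rw [integral_norm_eq_lintegral_enorm hcont.aestronglyMeasurable]
  refine (ENNReal.toReal_mono hlt.ne hC).trans (le_of_eq ?_)
  rw [ENNReal.toReal_mul, ENNReal.coe_toReal]

theorem distAmalgamENorm_le_of_isFourierL1 {d : ℕ} {g : 𝓢(Euc d, ℂ)}
    (hg : HasCompactSupport (g : Euc d → ℂ)) {F : Euc d → ℂ} (hF : Continuous F)
    {u : 𝓢'(Euc d, ℂ)} (hu : Represents F u) {r : ℝ}
    (hr : ∀ x, IsFourierL1 (fun y => g y * F (x + y)) r) :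
    distAmalgamENorm g u ≤ ENNReal.ofReal r := by
  refine iSup_le fun x => ?_
  have hc : Continuous fun y => g y * F (x + y) :=
    g.continuous.mul (hF.comp (continuous_const.add continuous_id))
  obtain ⟨hi, hle⟩ := (hr x).integrable_fourier (hc.integrable_of_hasCompactSupport hg.mul_right)
  rw [eLpNorm_one_eq_lintegral_enorm]
  calc ∫⁻ ξ, ‖windowedFourier g u x ξ‖ₑ = ∫⁻ ξ, ‖𝓕 (fun y => g y * F (x + y)) ξ‖ₑ := by
        refine lintegral_congr fun ξ => ?_
        rw [windowedFourier_of_represents hu hg, enorm_mul, ← ofReal_norm (character ξ x),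
          norm_character]
        simp
    _ = ENNReal.ofReal (∫ ξ, ‖𝓕 (fun y => g y * F (x + y)) ξ‖) :=
        (ofReal_integral_norm_eq_lintegral_enorm hi).symm
    _ ≤ _ := ENNReal.ofReal_le_ofReal hle

/-- Near a point `x` the Taylor expansion splits `e^{iμ}` into a constant, a character and
the exponential of the remainder. The first two are harmless for the `𝓕L¹` norm; the remainder is
bounded in `𝓕L¹`, uniformly in `x`, by the amalgam norms of the second derivatives. -/
theorem isFourierL1_cutoff_mul_unimodular {d : ℕ} {g₀ : 𝓢(Euc d, ℂ)}
    {b c : ContDiffBump (0 : Euc d)} (hbc : b.rOut ≤ c.rIn) {C : ℝ≥0}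
    (hC : ∀ (F : Euc d → ℂ) (x : Euc d),
      ∫⁻ ξ, ‖𝓕 (fun y => cutoff c y * F (x + y)) ξ‖ₑ ≤ C * amalgamENorm g₀ F)
    {A : ℝ} (hA : ∀ i j : Fin d, ∫ ξ, ‖𝓕 (SchwartzMap.smulLeftCLM ℂ
      (fun y : Euc d => (y i : ℂ) * (y j : ℂ)) (cutoff c)) ξ‖ ≤ A)
    {μ : Euc d → ℝ} (hμ : AdmissiblePhase g₀ μ) (x : Euc d) :
    IsFourierL1 (fun y => cutoff b y * unimodular μ (x + y)) ((∫ ξ, ‖𝓕 (cutoff b) ξ‖) *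
      Real.exp (∑ i : Fin d, ∑ j : Fin d,
        A * (C * (amalgamENorm g₀ (secondPartial μ i j)).toReal))) := by
  obtain ⟨hμ2, hfin⟩ := hμ
  obtain ⟨ξ, hξ⟩ := exists_exp_eq_character (fderiv ℝ μ x)
  set S : Fin d → Fin d → 𝓢(Euc d, ℂ) := fun i j =>
    SchwartzMap.smulLeftCLM ℂ (fun y : Euc d => (y i : ℂ) * (y j : ℂ)) (cutoff c) with hS
  set P : Fin d → Fin d → Euc d → ℂ := fun i j y =>
    cutoff c y * secondPartial μ i j (x + y) with hP
  have hPF : ∀ i j, IsFourierL1 (P i j) (C * (amalgamENorm g₀ (secondPartial μ i j)).toReal) :=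
    fun i j => IsFourierL1.of_amalgamENorm (hasCompactSupport_cutoff c) (hC _ x)
      (continuous_secondPartial hμ2 i j) (hfin i j)
  have hR : IsFourierL1 (fun y => ∑ i : Fin d, ∑ j : Fin d, S i j y * segmentAverage (P i j) 0 y)
      (∑ i : Fin d, ∑ j : Fin d, A * (C * (amalgamENorm g₀ (secondPartial μ i j)).toReal)) :=
    IsFourierL1.sum _ fun i _ => IsFourierL1.sum _ fun j _ =>
      ((IsFourierL1.of_schwartz (S i j)).mono (hA i j)).mul_segmentAverage (hPF i j)
  have h := ((((IsFourierL1.of_schwartz (cutoff b)).mul_exp hR).mul_character ξ).const_mul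
    (unimodular μ x))
  rw [norm_unimodular, one_mul] at h
  convert h using 1
  ext y
  by_cases hy : b y = 0
  · simp [cutoff_apply, hy]
  have hy' : ‖y‖ < b.rOut := by
    have : y ∈ Function.support b := hy
    rw [b.support_eq] at this
    simpa using this
  -- the cutoff `c` is `1` on the segment from `0` to `y`, so the remainder is the one of Taylor
  have hone : ∀ z : Euc d, ‖z‖ ≤ ‖y‖ → cutoff c z = 1 := fun z hz => by
    rw [cutoff_apply, c.one_of_mem_closedBall (by simpa using hz.trans (hy'.le.trans hbc))]
    simp
  have hSy : ∀ i j, S i j y = (y i : ℂ) * (y j : ℂ) := fun i j => by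
    rw [hS]
    simp only
    rw [SchwartzMap.smulLeftCLM_apply_apply (hasTemperateGrowth_coord_mul_coord i j),
      hone y le_rfl]
    simp
  have hPy : ∀ i j, segmentAverage (P i j) 0 y = segmentAverage (secondPartial μ i j) x y := by
    intro i j
    refine intervalIntegral.integral_congr fun t ht => ?_
    rw [Set.uIcc_of_le zero_le_one] at ht
    simp only [hP, zero_add]
    rw [hone (t • y), one_mul]
    rw [norm_smul, Real.norm_of_nonneg ht.1]
    exact mul_le_of_le_one_left (norm_nonneg _) ht.2
  simp only [hSy, hPy]
  rw [unimodular, ofReal_apply_add hμ2 x y, ← hξ y, unimodular, mul_add, mul_add, Complex.exp_add,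
    Complex.exp_add]
  ring

/-- The bound on the amalgam norm of `e^{iμ}`, for the tempered distribution that it gives. -/
theorem exists_distAmalgamENorm_unimodular_le {d : ℕ} {g₀ : 𝓢(Euc d, ℂ)} (hg₀ : g₀ ≠ 0)
    (g : 𝓢(Euc d, ℂ)) : ∃ C : ℝ, 0 < C ∧ ∀ μ : Euc d → ℝ, AdmissiblePhase g₀ μ →
      ∀ u : 𝓢'(Euc d, ℂ), Represents (unimodular μ) u → distAmalgamENorm g u ≤
        ENNReal.ofReal (C * Real.exp (C * ∑ i : Fin d, ∑ j ∈ Finset.Ici i,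
          (amalgamENorm g₀ (secondPartial μ i j)).toReal)) := by
  let b : ContDiffBump (0 : Euc d) := ⟨1, 2, by norm_num, by norm_num⟩
  let c : ContDiffBump (0 : Euc d) := ⟨2, 3, by norm_num, by norm_num⟩
  obtain ⟨C₁, hC₁⟩ := exists_lintegral_fourier_le hg₀ (hasCompactSupport_cutoff c)
  obtain ⟨C₂, hC₂⟩ := exists_distAmalgamENorm_le (cutoff_ne_zero b) g
  set A₀ : Fin d → Fin d → ℝ := fun i j => ∫ ξ, ‖𝓕 (SchwartzMap.smulLeftCLM ℂ
      (fun y : Euc d => (y i : ℂ) * (y j : ℂ)) (cutoff c)) ξ‖ with hA₀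
  have hA₀0 : ∀ i j, 0 ≤ A₀ i j := fun i j => integral_nonneg fun _ => norm_nonneg _
  set A : ℝ := ∑ i : Fin d, ∑ j : Fin d, A₀ i j with hA
  have hAle : ∀ i j, A₀ i j ≤ A := fun i j =>
    (Finset.single_le_sum (f := fun j => A₀ i j) (fun j _ => hA₀0 i j) (Finset.mem_univ j)).trans
      (Finset.single_le_sum (f := fun i => ∑ j : Fin d, A₀ i j)
        (fun i _ => Finset.sum_nonneg fun j _ => hA₀0 i j) (Finset.mem_univ i))
  have hA0 : 0 ≤ A := Finset.sum_nonneg fun i _ => Finset.sum_nonneg fun j _ => hA₀0 i j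
  set r : ℝ := ∫ ξ, ‖𝓕 (cutoff b) ξ‖ with hr
  have hr0 : 0 ≤ r := integral_nonneg fun _ => norm_nonneg _
  set K : ℝ := C₂ * r + 2 * (A * C₁) + 1 with hK
  have hK1 : C₂ * r ≤ K := by rw [hK]; linarith [mul_nonneg hA0 C₁.coe_nonneg]
  have hK2 : 2 * (A * C₁) ≤ K := by rw [hK]; linarith [mul_nonneg C₂.coe_nonneg hr0]
  have hK0 : 0 < K := by
    rw [hK]; linarith [mul_nonneg hA0 C₁.coe_nonneg, mul_nonneg C₂.coe_nonneg hr0]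
  clear_value K A r
  refine ⟨K, hK0, fun μ hμ u hu => ?_⟩
  set N : Fin d → Fin d → ℝ := fun i j => (amalgamENorm g₀ (secondPartial μ i j)).toReal with hN
  have hN0 : ∀ i j, 0 ≤ N i j := fun i j => ENNReal.toReal_nonneg
  have hNs : ∀ i j, N i j = N j i := fun i j => by
    simp only [hN]
    rw [secondPartial_comm hμ.1]
  -- by symmetry of the second derivative, the pairs `i ≤ j` suffice, at the cost of a factor `2`
  have hsum : ∑ i : Fin d, ∑ j : Fin d, N i j ≤ 2 * ∑ i : Fin d, ∑ j ∈ Finset.Ici i, N i j := by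
    have h1 : ∀ i j, N i j ≤ (if i ≤ j then N i j else 0) + if j ≤ i then N j i else 0 := by
      intro i j
      rcases le_total i j with h | h
      · rw [if_pos h]
        have : 0 ≤ if j ≤ i then N j i else 0 := by split_ifs; exacts [hN0 _ _, le_rfl]
        linarith
      · rw [if_pos h, hNs j i]
        have : 0 ≤ if i ≤ j then N i j else 0 := by split_ifs; exacts [hN0 _ _, le_rfl]
        linarith
    have h2 : ∑ i : Fin d, ∑ j ∈ Finset.Ici i, N i j =
        ∑ i : Fin d, ∑ j : Fin d, if i ≤ j then N i j else 0 := by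
      refine Finset.sum_congr rfl fun i _ => ?_
      rw [← Finset.sum_filter]
      congr 1
      ext j
      simp
    calc ∑ i : Fin d, ∑ j : Fin d, N i j
        ≤ ∑ i : Fin d, ∑ j : Fin d,
          ((if i ≤ j then N i j else 0) + if j ≤ i then N j i else 0) :=
          Finset.sum_le_sum fun i _ => Finset.sum_le_sum fun j _ => h1 i j
      _ = _ := by
          simp only [Finset.sum_add_distrib]
          rw [Finset.sum_comm (f := fun i j => if j ≤ i then N j i else 0), h2]
          ring
  have hσ := continuous_unimodular hμ.1.continuous
  have hloc := distAmalgamENorm_le_of_isFourierL1 (hasCompactSupport_cutoff b) hσ hu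
    (isFourierL1_cutoff_mul_unimodular (b := b) (c := c) le_rfl hC₁ hAle hμ)
  calc distAmalgamENorm g u ≤ C₂ * distAmalgamENorm (cutoff b) u := hC₂ u
    _ ≤ C₂ * ENNReal.ofReal (r * Real.exp (∑ i : Fin d, ∑ j : Fin d, A * (C₁ * N i j))) := by
        gcongr
        rw [hr]
        exact hloc
    _ = ENNReal.ofReal (C₂ * r * Real.exp (A * C₁ * ∑ i : Fin d, ∑ j : Fin d, N i j)) := by
        rw [← ENNReal.ofReal_coe_nnreal (p := C₂), ← ENNReal.ofReal_mul C₂.coe_nonneg]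
        simp only [Finset.mul_sum, mul_assoc]
    _ ≤ _ := by
        refine ENNReal.ofReal_le_ofReal ?_
        have hs0 : 0 ≤ ∑ i : Fin d, ∑ j ∈ Finset.Ici i, N i j :=
          Finset.sum_nonneg fun i _ => Finset.sum_nonneg fun j _ => hN0 i j
        refine mul_le_mul hK1 (Real.exp_le_exp.2 ?_) (Real.exp_pos _).le hK0.le
        calc A * C₁ * ∑ i : Fin d, ∑ j : Fin d, N i j
            ≤ A * C₁ * (2 * ∑ i : Fin d, ∑ j ∈ Finset.Ici i, N i j) := by gcongr
          _ = 2 * (A * C₁) * ∑ i : Fin d, ∑ j ∈ Finset.Ici i, N i j := by ring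
          _ ≤ _ := by gcongr

theorem represents_of_apply_eq {d : ℕ} {σ : Euc d → ℂ} (hσ : Continuous σ) {u : 𝓢'(Euc d, ℂ)}
    (hu : ∀ φ : 𝓢(Euc d, ℂ), u φ = ∫ y, σ y * φ y) : Represents σ u :=
  ⟨hσ.locallyIntegrable, fun φ _ => hu φ⟩

/-! ### The product of a distribution in the amalgam space with another distribution -/

/-- The Fourier transform of a product is the convolution of the Fourier transforms, for a localized
tempered distribution and a Schwartz function. -/
theorem apply_atom_mul_eq_integral {d : ℕ} (s : 𝓢'(Euc d, ℂ)) (θ G : 𝓢(Euc d, ℂ)) (z η : Euc d) :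
    s (schwartzMul (atom θ z η) G) = ∫ ζ, 𝓕 G ζ * windowedFourier θ s z (η - ζ) := by
  have hc : Continuous fun ζ => 𝓕 G ζ • atom θ z (η - ζ) :=
    (𝓕 G).continuous.smul ((continuous_atom θ).comp₂ continuous_const (by fun_prop))
  rw [apply_eq_integral (ν := volume) s hc (fun m => ?_) fun y => ?_]
  · refine integral_congr_ae (Eventually.of_forall fun ζ => ?_)
    simp [windowedFourier]
  · obtain ⟨k, C, hC, hk⟩ := exists_schwartzNorm_atom_le (d := d) m
    refine ((integral_one_add_pow_mul_norm_le k (𝓕 G)).1.const_mul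
      (C * schwartzNorm k θ * (1 + ‖z‖) ^ k * (1 + ‖η‖) ^ k)).mono'
      ((continuous_schwartzNorm m).comp hc).aestronglyMeasurable (Eventually.of_forall fun ζ => ?_)
    rw [Real.norm_of_nonneg (apply_nonneg _ _), map_smul_eq_mul]
    have h1 : 1 + ‖η - ζ‖ ≤ (1 + ‖η‖) * (1 + ‖ζ‖) := by
      nlinarith [norm_sub_le η ζ, norm_nonneg η, norm_nonneg ζ]
    calc ‖𝓕 G ζ‖ * schwartzNorm m (atom θ z (η - ζ))
        ≤ ‖𝓕 G ζ‖ * (C * schwartzNorm k θ * (1 + ‖z‖) ^ k * ((1 + ‖η‖) * (1 + ‖ζ‖)) ^ k) := by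
          gcongr
          refine (hk _ _ _).trans ?_
          gcongr
      _ = _ := by rw [mul_pow]; ring
  · have h3 : G y = ∫ ζ, character (-y) ζ * 𝓕 G ζ := by
      rw [← fourierInv_eq_integral_character, ← SchwartzMap.fourierInv_coe, fourierInv_fourier_eq]
    rw [schwartzMul_apply, h3, ← integral_const_mul]
    refine integral_congr_ae (Eventually.of_forall fun ζ => ?_)
    have h4 : character (-y) ζ = character (-ζ) y := by
      rw [character, character]; simp [real_inner_comm]
    simp only [_root_.smul_apply, smul_eq_mul, atom_apply]
    rw [sub_eq_add_neg η ζ, character_add, h4]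
    ring

/-- The product of a tempered distribution with a Schwartz function. -/
noncomputable abbrev distMul {d : ℕ} (φ : 𝓢(Euc d, ℂ)) (s : 𝓢'(Euc d, ℂ)) : 𝓢'(Euc d, ℂ) :=
  TemperedDistribution.smulLeftCLM ℂ (φ : Euc d → ℂ) s

theorem distMul_apply {d : ℕ} (φ ψ : 𝓢(Euc d, ℂ)) (s : 𝓢'(Euc d, ℂ)) :
    distMul φ s ψ = s (schwartzMul φ ψ) := rfl

theorem windowedFourier_distMul_add {d : ℕ} (b φ ψ : 𝓢(Euc d, ℂ)) (s : 𝓢'(Euc d, ℂ))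
    (z η : Euc d) : windowedFourier b (distMul (φ + ψ) s) z η =
      windowedFourier b (distMul φ s) z η + windowedFourier b (distMul ψ s) z η := by
  simp only [windowedFourier, distMul_apply]
  rw [← map_add]
  congr 1
  ext y
  simp only [schwartzMul_apply, _root_.add_apply]
  ring

theorem windowedFourier_distMul_smul {d : ℕ} (b φ : 𝓢(Euc d, ℂ)) (c : ℂ) (s : 𝓢'(Euc d, ℂ))
    (z η : Euc d) : windowedFourier b (distMul (c • φ) s) z η =
      c * windowedFourier b (distMul φ s) z η := by
  simp only [windowedFourier, distMul_apply]
  rw [← smul_eq_mul, ← map_smul]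
  congr 1
  ext y
  simp only [schwartzMul_apply, _root_.smul_apply, smul_eq_mul]
  ring

/-- For a product window, the windowed Fourier transform of the product `φ s` is the convolution in
the frequency variable of those of `φ` and `s`. -/
theorem windowedFourier_distMul {d : ℕ} (θ θ' φ : 𝓢(Euc d, ℂ)) (s : 𝓢'(Euc d, ℂ)) (z η : Euc d) :
    windowedFourier (schwartzMul θ θ') (distMul φ s) z η =
      ∫ ζ, windowedFourier θ' (ofSchwartz φ) z ζ * windowedFourier θ s z (η - ζ) := by
  have h : schwartzMul φ (atom (schwartzMul θ θ') z η) =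
      schwartzMul (atom θ z η) (schwartzMul (compSubConstCLM ℂ z θ') φ) := by
    ext y
    simp only [schwartzMul_apply, atom_apply, compSubConstCLM_apply]
    ring
  rw [windowedFourier, distMul_apply, h, apply_atom_mul_eq_integral]
  simp only [windowedFourier_ofSchwartz]

/-- The same convolution with the window of the distribution transferred to `s`: the factor `φ` of
the atom serves as the window for `s`. -/
theorem windowedFourier_distMul_atom {d : ℕ} (b φ ψ : 𝓢(Euc d, ℂ)) (s : 𝓢'(Euc d, ℂ))
    (x ξ z ζ : Euc d) :
    windowedFourier b (distMul (atom (schwartzMul φ ψ) x ξ) s) z ζ =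
      ∫ η, windowedFourier b (ofSchwartz (atom ψ x η)) z ζ * windowedFourier φ s x (ξ - η) := by
  have h : schwartzMul (atom (schwartzMul φ ψ) x ξ) (atom b z ζ) =
      schwartzMul (atom φ x ξ) (schwartzMul (compSubConstCLM ℂ x ψ) (atom b z ζ)) := by
    ext y
    simp only [schwartzMul_apply, atom_apply, compSubConstCLM_apply]
    ring
  rw [windowedFourier, distMul_apply, h, apply_atom_mul_eq_integral]
  refine integral_congr_ae (Eventually.of_forall fun η => ?_)
  simp only
  congr 1
  rw [← windowedFourier_ofSchwartz, windowedFourier, windowedFourier, ofSchwartz_apply,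
    ofSchwartz_apply]
  simp only [mul_comm]

theorem lintegral_windowedFourier_le {d : ℕ} (g : 𝓢(Euc d, ℂ)) (s : 𝓢'(Euc d, ℂ)) (z : Euc d) :
    ∫⁻ η, ‖windowedFourier g s z η‖ₑ ≤ distAmalgamENorm g s := by
  rw [← eLpNorm_one_eq_lintegral_enorm]
  exact le_iSup (fun x => eLpNorm (windowedFourier g s x) 1 volume) z

theorem continuous_windowedFourier_right {d : ℕ} (g : 𝓢(Euc d, ℂ)) (s : 𝓢'(Euc d, ℂ)) (z : Euc d) :
    Continuous (windowedFourier g s z) :=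
  (continuous_windowedFourier g s).comp₂ continuous_const continuous_id

theorem integrable_windowedFourier {d : ℕ} {g : 𝓢(Euc d, ℂ)} {s : 𝓢'(Euc d, ℂ)}
    (h : distAmalgamENorm g s < ∞) (z : Euc d) : Integrable (windowedFourier g s z) :=
  ⟨(continuous_windowedFourier_right g s z).aestronglyMeasurable,
    (lintegral_windowedFourier_le g s z).trans_lt h⟩

/-- Young's inequality in the frequency variable, followed by integration in the other one. -/
theorem lintegral_windowedFourier_distMul_le {d : ℕ} (θ θ' φ : 𝓢(Euc d, ℂ)) (s : 𝓢'(Euc d, ℂ)) :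
    ∫⁻ p : Euc d × Euc d, ‖windowedFourier (schwartzMul θ θ') (distMul φ s) p.1 p.2‖ₑ ≤
      distAmalgamENorm θ s * ∫⁻ p : Euc d × Euc d, ‖windowedFourier θ' (ofSchwartz φ) p.1 p.2‖ₑ := by
  set A := distAmalgamENorm θ s with hA
  have hm : ∀ (g : 𝓢(Euc d, ℂ)) (v : 𝓢'(Euc d, ℂ)),
      Measurable fun p : Euc d × Euc d => ‖windowedFourier g v p.1 p.2‖ₑ := fun g v =>
    measurable_enorm_windowedFourier_comp g v measurable_fst measurable_snd
  have hmz : ∀ (g : 𝓢(Euc d, ℂ)) (v : 𝓢'(Euc d, ℂ)) (z : Euc d),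
      Measurable fun ζ => ‖windowedFourier g v z ζ‖ₑ := fun g v z =>
    measurable_enorm_windowedFourier_comp g v measurable_const measurable_id
  have hN : Measurable fun z => ∫⁻ ζ, ‖windowedFourier θ' (ofSchwartz φ) z ζ‖ₑ :=
    Measurable.lintegral_prod_right (hm θ' (ofSchwartz φ))
  rw [Measure.volume_eq_prod, lintegral_prod _ (hm _ _).aemeasurable,
    lintegral_prod _ (hm _ _).aemeasurable, ← lintegral_const_mul _ hN]
  refine lintegral_mono fun z => ?_
  calc ∫⁻ η, ‖windowedFourier (schwartzMul θ θ') (distMul φ s) z η‖ₑ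
      ≤ ∫⁻ η, ∫⁻ ζ, ‖windowedFourier θ' (ofSchwartz φ) z ζ‖ₑ * ‖windowedFourier θ s z (η - ζ)‖ₑ := by
        refine lintegral_mono fun η => ?_
        rw [windowedFourier_distMul]
        refine (enorm_integral_le_lintegral_enorm _).trans (le_of_eq ?_)
        simp only [enorm_mul]
    _ = ∫⁻ ζ, ∫⁻ η, ‖windowedFourier θ' (ofSchwartz φ) z ζ‖ₑ * ‖windowedFourier θ s z (η - ζ)‖ₑ := by
        refine lintegral_lintegral_swap (Measurable.aemeasurable ?_)
        exact (measurable_enorm_windowedFourier_comp θ' (ofSchwartz φ) measurable_const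
          measurable_snd).mul (measurable_enorm_windowedFourier_comp θ s measurable_const
          (by fun_prop))
    _ ≤ ∫⁻ ζ, A * ‖windowedFourier θ' (ofSchwartz φ) z ζ‖ₑ := by
        refine lintegral_mono fun ζ => ?_
        rw [lintegral_const_mul _ (measurable_enorm_windowedFourier_comp θ s measurable_const
          (by fun_prop)), mul_comm,
          lintegral_sub_right_eq_self (fun η => ‖windowedFourier θ s z η‖ₑ) ζ]
        gcongr
        exact lintegral_windowedFourier_le θ s z
    _ = _ := lintegral_const_mul _ (hmz _ _ _)

theorem integrable_windowedFourier_distMul {d : ℕ} {θ : 𝓢(Euc d, ℂ)} {s : 𝓢'(Euc d, ℂ)}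
    (hs : distAmalgamENorm θ s < ∞) (θ' φ : 𝓢(Euc d, ℂ)) : Integrable fun p : Euc d × Euc d =>
      windowedFourier (schwartzMul θ θ') (distMul φ s) p.1 (-p.2) := by
  have h : Integrable fun p : Euc d × Euc d =>
      windowedFourier (schwartzMul θ θ') (distMul φ s) p.1 p.2 :=
    ⟨(continuous_windowedFourier _ _).aestronglyMeasurable,
      (lintegral_windowedFourier_distMul_le θ θ' φ s).trans_lt
        (ENNReal.mul_lt_top hs (lintegral_windowedFourier_ofSchwartz_lt_top θ' φ))⟩
  have hmp : MeasurePreserving (fun p : Euc d × Euc d => (p.1, -p.2)) volume volume :=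
    (MeasurePreserving.id volume).prod (Measure.measurePreserving_neg volume)
  exact hmp.integrable_comp_of_integrable h

theorem exists_integral_norm_windowedFourier_distMul_le {d : ℕ} {θ : 𝓢(Euc d, ℂ)}
    {s : 𝓢'(Euc d, ℂ)} (hs : distAmalgamENorm θ s < ∞) (θ' : 𝓢(Euc d, ℂ)) :
    ∃ (m : ℕ) (C : ℝ), 0 ≤ C ∧ ∀ φ : 𝓢(Euc d, ℂ), ∫ p : Euc d × Euc d,
      ‖windowedFourier (schwartzMul θ θ') (distMul φ s) p.1 (-p.2)‖ ≤ C * schwartzNorm m φ := by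
  obtain ⟨m, C, hC, hdecay⟩ := exists_windowedFourier_ofSchwartz_le_weight (d := d) 0
  set I := ∫ p : Euc d × Euc d, weight p.1 * weight p.2 with hI
  have hI0 : 0 ≤ I := integral_nonneg fun p => mul_nonneg (weight_pos _).le (weight_pos _).le
  refine ⟨m, (distAmalgamENorm θ s).toReal * (C * schwartzNorm m θ' * I), by positivity,
    fun φ => ?_⟩
  set D := C * (schwartzNorm m θ' * schwartzNorm m φ) with hD
  have hD0 : 0 ≤ D := by positivity
  have h1 : ∫⁻ p : Euc d × Euc d, ‖windowedFourier θ' (ofSchwartz φ) p.1 p.2‖ₑ ≤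
      ENNReal.ofReal (D * I) := by
    rw [hI, ← integral_const_mul, ofReal_integral_eq_lintegral_ofReal
      (integrable_weight_mul_weight.const_mul D) (Eventually.of_forall fun p =>
        mul_nonneg hD0 (mul_nonneg (weight_pos _).le (weight_pos _).le))]
    refine lintegral_mono fun p => ?_
    rw [← ofReal_norm]
    refine ENNReal.ofReal_le_ofReal ?_
    simpa using hdecay θ' φ p.1 p.2
  have hmp : MeasurePreserving (fun p : Euc d × Euc d => (p.1, -p.2)) volume volume :=
    (MeasurePreserving.id volume).prod (Measure.measurePreserving_neg volume)
  have h2 : ∫⁻ p : Euc d × Euc d,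
      ‖windowedFourier (schwartzMul θ θ') (distMul φ s) p.1 (-p.2)‖ₑ ≤
      distAmalgamENorm θ s * ENNReal.ofReal (D * I) := by
    rw [hmp.lintegral_comp (f := fun p : Euc d × Euc d =>
      ‖windowedFourier (schwartzMul θ θ') (distMul φ s) p.1 p.2‖ₑ)
      (measurable_enorm_windowedFourier_comp _ _ measurable_fst measurable_snd)]
    refine (lintegral_windowedFourier_distMul_le θ θ' φ s).trans ?_
    gcongr
  rw [integral_norm_eq_lintegral_enorm
    (integrable_windowedFourier_distMul hs θ' φ).aestronglyMeasurable]
  refine (ENNReal.toReal_mono (ENNReal.mul_lt_top hs ENNReal.ofReal_lt_top).ne h2).trans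
    (le_of_eq ?_)
  rw [ENNReal.toReal_mul, ENNReal.toReal_ofReal (by positivity), hD]
  ring

/-- The product of `s` in the amalgam space with `u`, tested on `φ`, should be `u (φ s)`; the
reproducing formula gives a meaning to this expression. -/
theorem exists_product {d : ℕ} {θ : 𝓢(Euc d, ℂ)} {s : 𝓢'(Euc d, ℂ)}
    (hs : distAmalgamENorm θ s < ∞) (θ' γ : 𝓢(Euc d, ℂ)) {u : 𝓢'(Euc d, ℂ)} {M : ℝ}
    (hu : ∀ x ξ, ‖windowedFourier γ u x ξ‖ ≤ M) :
    ∃ h : 𝓢'(Euc d, ℂ), ∀ φ : 𝓢(Euc d, ℂ), h φ = ∫ p : Euc d × Euc d,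
      windowedFourier (schwartzMul θ θ') (distMul φ s) p.1 (-p.2) *
        windowedFourier γ u p.1 p.2 := by
  obtain ⟨m, C, hC, hbound⟩ := exists_integral_norm_windowedFourier_distMul_le hs θ'
  have hM : 0 ≤ M := (norm_nonneg _).trans (hu 0 0)
  have hI : ∀ φ : 𝓢(Euc d, ℂ), Integrable fun p : Euc d × Euc d =>
      windowedFourier (schwartzMul θ θ') (distMul φ s) p.1 (-p.2) *
        windowedFourier γ u p.1 p.2 := fun φ =>
    (integrable_windowedFourier_distMul hs θ' φ).mul_of_top_left (memLp_top_of_bound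
      (continuous_windowedFourier γ u).aestronglyMeasurable M (Eventually.of_forall fun p => hu _ _))
  let L : 𝓢(Euc d, ℂ) →L[ℂ] ℂ := SchwartzMap.mkCLMtoNormedSpace
    (fun φ => ∫ p : Euc d × Euc d, windowedFourier (schwartzMul θ θ') (distMul φ s) p.1 (-p.2) *
        windowedFourier γ u p.1 p.2)
    (fun φ ψ => by
      rw [← integral_add (hI φ) (hI ψ)]
      refine integral_congr_ae (Eventually.of_forall fun p => ?_)
      simp only
      rw [windowedFourier_distMul_add, add_mul])
    (fun c φ => by
      rw [RingHom.id_apply, smul_eq_mul, ← integral_const_mul]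
      refine integral_congr_ae (Eventually.of_forall fun p => ?_)
      simp only
      rw [windowedFourier_distMul_smul, mul_assoc])
    ⟨Finset.Iic (m, m), C * M, by positivity, fun φ => by
      calc ‖∫ p : Euc d × Euc d, windowedFourier (schwartzMul θ θ') (distMul φ s) p.1 (-p.2) *
            windowedFourier γ u p.1 p.2‖
          ≤ ∫ p : Euc d × Euc d,
              ‖windowedFourier (schwartzMul θ θ') (distMul φ s) p.1 (-p.2)‖ * M := by
            refine norm_integral_le_of_norm_le
              ((integrable_windowedFourier_distMul hs θ' φ).norm.mul_const M)
              (Eventually.of_forall fun p => ?_)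
            rw [norm_mul]
            gcongr
            exact hu _ _
        _ = (∫ p : Euc d × Euc d,
              ‖windowedFourier (schwartzMul θ θ') (distMul φ s) p.1 (-p.2)‖) * M :=
            integral_mul_const _ _
        _ ≤ C * schwartzNorm m φ * M := by
            gcongr
            exact hbound φ
        _ = C * M * schwartzNorm m φ := by ring⟩
  exact ⟨ContinuousLinearMap.toPointwiseConvergenceCLM _ _ _ _ L, fun φ => rfl⟩

theorem integrable_mul_windowedFourier {d : ℕ} {X : Type*} [MeasurableSpace X] {ν : Measure X}
    {F : X → ℂ} (hF : Integrable F ν) {γ : 𝓢(Euc d, ℂ)} {u : 𝓢'(Euc d, ℂ)} {M : ℝ}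
    (hu : ∀ x ξ, ‖windowedFourier γ u x ξ‖ ≤ M) {a b : X → Euc d} (ha : Measurable a)
    (hb : Measurable b) : Integrable (fun p => F p * windowedFourier γ u (a p) (b p)) ν := by
  have hm : Measurable fun p => windowedFourier γ u (a p) (b p) := by
    have h := (continuous_windowedFourier γ u).measurable.comp (ha.prodMk hb)
    simpa only [Function.comp_def] using h
  exact hF.mul_of_top_left (memLp_top_of_bound hm.aestronglyMeasurable M
    (Eventually.of_forall fun p => hu _ _))

/-- The windowed Fourier transform of the product `h` of `s` and `u` is the convolution of those of
the factors. Expand the action of `u` by the reproducing formula, and exchange the integrals. -/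
theorem windowedFourier_product {d : ℕ} {b γ : 𝓢(Euc d, ℂ)} (hbγ : ∫ y, b y * γ y = 1)
    {s u h : 𝓢'(Euc d, ℂ)} {M : ℝ} (hu : ∀ x ξ, ‖windowedFourier γ u x ξ‖ ≤ M)
    (hh : ∀ φ : 𝓢(Euc d, ℂ), h φ = ∫ p : Euc d × Euc d,
      windowedFourier b (distMul φ s) p.1 (-p.2) * windowedFourier γ u p.1 p.2)
    {φ : 𝓢(Euc d, ℂ)} (hs : distAmalgamENorm φ s < ∞) (ψ : 𝓢(Euc d, ℂ)) (x ξ : Euc d) :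
    windowedFourier (schwartzMul φ ψ) h x ξ =
      ∫ η, windowedFourier φ s x (ξ - η) * windowedFourier ψ u x η := by
  have hF : Integrable fun p : Euc d × Euc d => windowedFourier b (ofSchwartz ψ) p.1 p.2 :=
    ⟨(continuous_windowedFourier b _).aestronglyMeasurable,
      lintegral_windowedFourier_ofSchwartz_lt_top b ψ⟩
  have hK : Integrable fun η => windowedFourier φ s x (ξ - η) :=
    (integrable_windowedFourier hs x).comp_sub_left ξ
  have hmp : MeasurePreserving
      (fun q : Euc d × (Euc d × Euc d) => (q.1, (q.2.1 - x, q.1 - q.2.2)))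
      ((volume : Measure (Euc d)).prod (volume : Measure (Euc d × Euc d)))
      ((volume : Measure (Euc d)).prod (volume : Measure (Euc d × Euc d))) := by
    refine (MeasurePreserving.id volume).skew_product
      (g := fun η (p : Euc d × Euc d) => (p.1 - x, η - p.2)) (by fun_prop)
      (Eventually.of_forall fun η => ?_)
    exact ((measurePreserving_sub_right volume x).prod
      (Measure.measurePreserving_sub_left volume η)).map_eq
  have hQ₀ : Integrable (fun q : Euc d × (Euc d × Euc d) =>
      windowedFourier φ s x (ξ - q.1) *
        windowedFourier b (ofSchwartz ψ) (q.2.1 - x) (q.1 - q.2.2))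
      ((volume : Measure (Euc d)).prod (volume : Measure (Euc d × Euc d))) :=
    hmp.integrable_comp_of_integrable (hK.mul_prod hF)
  -- absolute convergence of the double integral: `W_γ u` is bounded, and up to a phase and a change
  -- of variables the other two factors form a product of integrable functions
  have hQ : Integrable (Function.uncurry fun (η : Euc d) (p : Euc d × Euc d) =>
      windowedFourier b (ofSchwartz (atom ψ x η)) p.1 (-p.2) * windowedFourier φ s x (ξ - η) *
        windowedFourier γ u p.1 p.2)
      ((volume : Measure (Euc d)).prod (volume : Measure (Euc d × Euc d))) := by
    have hchar : Continuous fun q : Euc d × (Euc d × Euc d) => character (-q.2.2 + q.1) x := by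
      unfold character
      fun_prop
    have h1 := integrable_mul_windowedFourier (hQ₀.mul_of_top_left (memLp_top_of_bound
      hchar.aestronglyMeasurable 1 (Eventually.of_forall fun _ => (norm_character _ _).le))) hu
      (a := fun q : Euc d × (Euc d × Euc d) => q.2.1) (b := fun q => q.2.2) (by fun_prop)
      (by fun_prop)
    refine h1.congr (Eventually.of_forall fun q => ?_)
    simp only [Function.uncurry, windowedFourier_ofSchwartz_atom, Pi.mul_apply]
    rw [neg_add_eq_sub]
    ring
  calc windowedFourier (schwartzMul φ ψ) h x ξ
      = ∫ p : Euc d × Euc d, ∫ η, windowedFourier b (ofSchwartz (atom ψ x η)) p.1 (-p.2) *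
          windowedFourier φ s x (ξ - η) * windowedFourier γ u p.1 p.2 := by
        rw [windowedFourier, hh]
        refine integral_congr_ae (Eventually.of_forall fun p => ?_)
        simp only
        rw [windowedFourier_distMul_atom, integral_mul_const]
    _ = ∫ η, ∫ p : Euc d × Euc d, windowedFourier b (ofSchwartz (atom ψ x η)) p.1 (-p.2) *
          windowedFourier φ s x (ξ - η) * windowedFourier γ u p.1 p.2 :=
        (integral_integral_swap hQ).symm
    _ = _ := by
        refine integral_congr_ae (Eventually.of_forall fun η => ?_)
        simp only
        rw [show windowedFourier ψ u x η = u (atom ψ x η) from rfl,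
          apply_eq_integral_windowedFourier hbγ u (atom ψ x η), ← integral_const_mul]
        refine integral_congr_ae (Eventually.of_forall fun p => ?_)
        simp only
        ring

/-- If `u` is a Schwartz function `χ`, then the defining integral of the product is an instance of the
reproducing formula, with the roles of the two dual windows exchanged, for `φ s` acting on `χ`. -/
theorem product_ofSchwartz_apply {d : ℕ} {b γ : 𝓢(Euc d, ℂ)} (hbγ : ∫ y, b y * γ y = 1)
    {s h : 𝓢'(Euc d, ℂ)} (χ : 𝓢(Euc d, ℂ))
    (hh : ∀ φ : 𝓢(Euc d, ℂ), h φ = ∫ p : Euc d × Euc d,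
      windowedFourier b (distMul φ s) p.1 (-p.2) * windowedFourier γ (ofSchwartz χ) p.1 p.2)
    (φ : 𝓢(Euc d, ℂ)) : h φ = s (schwartzMul φ χ) := by
  have hγb : ∫ y, γ y * b y = 1 := by simpa only [mul_comm] using hbγ
  have hmp : MeasurePreserving (fun p : Euc d × Euc d => (p.1, -p.2)) volume volume :=
    (MeasurePreserving.id volume).prod (Measure.measurePreserving_neg volume)
  have hemb : MeasurableEmbedding fun p : Euc d × Euc d => (p.1, -p.2) :=
    ((MeasurableEquiv.refl (Euc d)).prodCongr (MeasurableEquiv.neg (Euc d))).measurableEmbedding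
  rw [← distMul_apply, apply_eq_integral_windowedFourier hγb (distMul φ s) χ, hh,
    ← hmp.integral_comp hemb]
  simp only [neg_neg, mul_comm]

/-! ### The Fourier transform and the short-time Fourier transform -/

theorem fourier_atom {d : ℕ} (G : 𝓢(Euc d, ℂ)) (a b : Euc d) :
    𝓕 (atom G a b) = character a b • atom (𝓕 G) (-b) a := by
  ext y
  rw [_root_.smul_apply, smul_eq_mul, atom_apply, SchwartzMap.fourier_coe,
    fourier_eq_integral_character, SchwartzMap.fourier_coe, fourier_eq_integral_character,
    ← integral_add_left_eq_self _ a, ← integral_const_mul, ← integral_const_mul]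
  refine integral_congr_ae (Eventually.of_forall fun t => ?_)
  simp only [atom_apply, add_sub_cancel_left, character_add_right, sub_neg_eq_add, character_add]
  rw [character_comm a b, character_comm a y]
  ring

theorem conjWindow_conjWindow {d : ℕ} (g : 𝓢(Euc d, ℂ)) : conjWindow (conjWindow g) = g := by
  ext y
  simp [conjWindow_apply]

/-- The fundamental identity of time-frequency analysis: the Fourier transform rotates the
time-frequency plane by a quarter turn. -/
theorem norm_stft_conjWindow_fourier {d : ℕ} (G : 𝓢(Euc d, ℂ)) (f : 𝓢'(Euc d, ℂ))
    (x ξ : Euc d) :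
    ‖stft (conjWindow (𝓕 G)) f x ξ‖ = ‖windowedFourier G (𝓕 f) ξ (-x)‖ := by
  rw [stft, conjWindow_conjWindow, windowedFourier, windowedFourier,
    TemperedDistribution.fourier_apply, fourier_atom, map_smul, smul_eq_mul, norm_mul,
    norm_character, neg_neg, one_mul]

theorem conjWindow_fourier_ne_zero {d : ℕ} {G : 𝓢(Euc d, ℂ)} (hG : G ≠ 0) :
    conjWindow (𝓕 G) ≠ 0 := by
  refine conjWindow_ne_zero fun h => hG ?_
  rw [← fourierInv_fourier_eq (E := 𝓢(Euc d, ℂ)) (F := 𝓢(Euc d, ℂ)) G, h]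
  exact (fourierInvCLM ℂ 𝓢(Euc d, ℂ)).map_zero

theorem exists_norm_windowedFourier_fourier_le {d : ℕ} {g₀ : 𝓢(Euc d, ℂ)} (hg₀ : g₀ ≠ 0)
    {p q : ℝ≥0∞} (hp : 1 ≤ p) (hq : 1 ≤ q) {f : 𝓢'(Euc d, ℂ)}
    (hf : modulationENorm g₀ p q f < ∞) (ψ : 𝓢(Euc d, ℂ)) :
    ∃ M : ℝ, ∀ x ξ, ‖windowedFourier ψ (𝓕 f) x ξ‖ ≤ M := by
  by_cases hψ : ψ = 0
  · refine ⟨0, fun x ξ => ?_⟩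
    simp [windowedFourier, atom, hψ]
  · obtain ⟨C, hC⟩ := exists_modulationENorm_le hg₀ (conjWindow (𝓕 ψ))
    obtain ⟨M, hM⟩ := exists_norm_stft_le (conjWindow_fourier_ne_zero hψ) hp hq
      ((hC p q hp hq f).trans_lt (ENNReal.mul_lt_top ENNReal.coe_lt_top hf))
    refine ⟨M, fun x ξ => ?_⟩
    have h := hM (-ξ) x
    rwa [norm_stft_conjWindow_fourier, neg_neg] at h

/-- Boundedness of the multiplier in the modulation norms of suitable windows: for each frequency,
the short-time Fourier transform of the image is dominated by a convolution in the space variable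
with an integrable function of norm at most `distAmalgamENorm θ s`. -/
theorem modulationENorm_product_le {d : ℕ} {θ : 𝓢(Euc d, ℂ)} {s f k : 𝓢'(Euc d, ℂ)}
    {p q : ℝ≥0∞} (hp : 1 ≤ p) (hq : 1 ≤ q)
    (h : ∀ x ξ, windowedFourier (schwartzMul θ θ) (𝓕 k) x ξ =
      ∫ η, windowedFourier θ s x (ξ - η) * windowedFourier θ (𝓕 f) x η) :
    modulationENorm (conjWindow (𝓕 (schwartzMul θ θ))) p q k ≤
      distAmalgamENorm θ s * modulationENorm (conjWindow (𝓕 θ)) p q f := by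
  set g := conjWindow (𝓕 θ) with hg
  have hstft : ∀ x ξ, ‖stft (conjWindow (𝓕 (schwartzMul θ θ))) k x ξ‖ₑ ≤
      ∫⁻ ζ, ‖windowedFourier θ s ξ ζ‖ₑ * ‖stft g f (x + ζ) ξ‖ₑ := fun x ξ => by
    rw [← ofReal_norm, norm_stft_conjWindow_fourier, ofReal_norm, h]
    refine (enorm_integral_le_lintegral_enorm _).trans (le_of_eq ?_)
    rw [← lintegral_sub_left_eq_self _ (-x)]
    refine lintegral_congr fun ζ => ?_
    rw [sub_sub_cancel, enorm_mul, ← ofReal_norm (stft g f (x + ζ) ξ), hg,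
      norm_stft_conjWindow_fourier, ofReal_norm, neg_add, ← sub_eq_add_neg]
  have hG : ∀ ξ, Measurable (Function.uncurry fun x ζ : Euc d =>
      ‖windowedFourier θ s ξ ζ‖ₑ * ‖stft g f (x + ζ) ξ‖ₑ) := fun ξ =>
    (measurable_enorm_windowedFourier_comp θ s measurable_const measurable_snd).mul
      (measurable_enorm_stft_comp g f (by fun_prop) measurable_const)
  have hfx : ∀ ξ, Measurable fun x => ‖stft g f x ξ‖ₑ := fun ξ =>
    measurable_enorm_stft_comp g f measurable_id measurable_const
  have hfxζ : ∀ ξ ζ, Measurable fun x => ‖stft g f (x + ζ) ξ‖ₑ := fun ξ ζ =>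
    measurable_enorm_stft_comp g f (by fun_prop) measurable_const
  have hinner : ∀ ξ, eLpNorm (fun x => ‖stft (conjWindow (𝓕 (schwartzMul θ θ))) k x ξ‖ₑ) p volume ≤
      distAmalgamENorm θ s * eLpNorm (fun x => ‖stft g f x ξ‖ₑ) p volume := fun ξ => by
    refine (eLpNorm_ennreal_mono fun x => hstft x ξ).trans ((eLpNorm_lintegral_le hp (hG ξ)).trans ?_)
    have hms : Measurable fun ζ => ‖windowedFourier θ s ξ ζ‖ₑ :=
      measurable_enorm_windowedFourier_comp θ s measurable_const measurable_id
    calc ∫⁻ ζ, eLpNorm (fun x => ‖windowedFourier θ s ξ ζ‖ₑ * ‖stft g f (x + ζ) ξ‖ₑ) p volume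
        = ∫⁻ ζ, ‖windowedFourier θ s ξ ζ‖ₑ * eLpNorm (fun x => ‖stft g f x ξ‖ₑ) p volume := by
          refine lintegral_congr fun ζ => ?_
          rw [eLpNorm_ennreal_const_mul hp _ (hfxζ ξ ζ),
            eLpNorm_comp_add_right (fun x => ‖stft g f x ξ‖ₑ) (hfx ξ) ζ p]
      _ = (∫⁻ ζ, ‖windowedFourier θ s ξ ζ‖ₑ) * eLpNorm (fun x => ‖stft g f x ξ‖ₑ) p volume :=
          lintegral_mul_const _ hms
      _ ≤ _ := by
          gcongr
          exact lintegral_windowedFourier_le θ s ξ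
  rw [modulationENorm_eq, modulationENorm_eq, ← eLpNorm_ennreal_const_mul hq _
    (measurable_eLpNorm_right hp (measurable_enorm_stft g f))]
  exact eLpNorm_ennreal_mono hinner

/-! ### The Fourier multiplier -/

/-- The modulation space `M^{p,q}` as a space of tempered distributions. -/
noncomputable def modulationSpace {d : ℕ} (g : 𝓢(Euc d, ℂ)) {p q : ℝ≥0∞} (hp : 1 ≤ p)
    (hq : 1 ≤ q) : Submodule ℂ 𝓢'(Euc d, ℂ) where
  carrier := {f | modulationENorm g p q f < ∞}
  add_mem' {f f'} hf hf' :=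
    (modulationENorm_add_le g hp hq f f').trans_lt (ENNReal.add_lt_top.2 ⟨hf, hf'⟩)
  zero_mem' := by
    have h := modulationENorm_smul g hp hq 0 (0 : 𝓢'(Euc d, ℂ))
    have h0 : (0 : ℂ) • (0 : 𝓢'(Euc d, ℂ)) = 0 := by
      ext φ
      rw [_root_.smul_apply, smul_eq_mul, zero_mul]
      rfl
    rw [h0, enorm_zero, zero_mul] at h
    exact h.trans_lt ENNReal.zero_lt_top
  smul_mem' c f hf :=
    (modulationENorm_smul g hp hq c f).trans_lt (ENNReal.mul_lt_top enorm_lt_top hf)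

theorem isProduct_of_apply_eq {d : ℕ} {σ : Euc d → ℂ} {b γ : 𝓢(Euc d, ℂ)}
    (hbγ : ∫ y, b y * γ y = 1) {s u h : 𝓢'(Euc d, ℂ)} (hσs : Represents σ s)
    (hs : ∀ g : 𝓢(Euc d, ℂ), distAmalgamENorm g s < ∞)
    (hu : ∀ ψ : 𝓢(Euc d, ℂ), ∃ M : ℝ, ∀ x ξ, ‖windowedFourier ψ u x ξ‖ ≤ M)
    (hh : ∀ φ : 𝓢(Euc d, ℂ), h φ = ∫ p : Euc d × Euc d,
      windowedFourier b (distMul φ s) p.1 (-p.2) * windowedFourier γ u p.1 p.2) :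
    IsProduct σ u h := by
  intro φ ψ hφ hψ ξ
  obtain ⟨Mγ, hMγ⟩ := hu γ
  obtain ⟨M, hM⟩ := hu ψ
  have h1 : ∀ η, 𝓕 (fun y => φ y * σ y) (ξ - η) = windowedFourier φ s 0 (ξ - η) := fun η => by
    rw [windowedFourier_of_represents hσs hφ]
    simp [character]
  simp only [h1]
  refine ⟨?_, windowedFourier_product hbγ hMγ hh (hs φ) ψ 0 ξ⟩
  exact integrable_mul_windowedFourier ((integrable_windowedFourier (hs φ) 0).comp_sub_left ξ) hM
    measurable_const measurable_id

/-- The action of the multiplier on a Schwartz function. -/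
theorem represents_fourierInv {d : ℕ} {σ : Euc d → ℂ} (hσ : Continuous σ)
    (hσ1 : ∀ y, ‖σ y‖ ≤ 1) {h : 𝓢'(Euc d, ℂ)} (χ : 𝓢(Euc d, ℂ))
    (hh : ∀ ψ : 𝓢(Euc d, ℂ), h ψ = ∫ y, σ y * (ψ y * χ y)) :
    Represents (fun x => ∫ ξ, Complex.exp (2 * Real.pi * Complex.I * (inner ℝ x ξ : ℝ)) *
      σ ξ * χ ξ) (𝓕⁻ h) := by
  have hσχ : Integrable fun ξ => σ ξ * χ ξ :=
    (χ.integrable (μ := volume)).bdd_mul hσ.aestronglyMeasurable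
      (Eventually.of_forall hσ1)
  have hF : ∀ x, ∫ ξ, Complex.exp (2 * Real.pi * Complex.I * (inner ℝ x ξ : ℝ)) * σ ξ * χ ξ =
      ∫ ξ, character (-x) ξ * (σ ξ * χ ξ) := fun x => by
    refine integral_congr_ae (Eventually.of_forall fun ξ => ?_)
    simp only
    rw [character, inner_neg_right, neg_neg, real_inner_comm, mul_assoc]
  simp only [hF]
  constructor
  · refine Continuous.locallyIntegrable ?_
    have h1 : Continuous (𝓕 fun ξ => σ ξ * χ ξ) :=
      VectorFourier.fourierIntegral_continuous Real.continuous_fourierChar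
        (by exact continuous_inner) hσχ
    have h2 : (fun x => ∫ ξ, character (-x) ξ * (σ ξ * χ ξ)) =
        fun x => 𝓕 (fun ξ => σ ξ * χ ξ) (-x) := by
      ext x
      rw [fourier_eq_integral_character]
    rw [h2]
    exact h1.comp continuous_neg
  · intro φ _
    rw [TemperedDistribution.fourierInv_apply, hh]
    have hI : Integrable (Function.uncurry fun x ξ : Euc d =>
        character (-x) ξ * (σ ξ * χ ξ) * φ x) (volume.prod volume) := by
      have hc : Continuous fun p : Euc d × Euc d => character (-p.1) p.2 := by
        unfold character
        fun_prop
      refine (((φ.integrable (μ := volume)).mul_prod hσχ).mul_of_top_left (memLp_top_of_bound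
        hc.aestronglyMeasurable 1 (Eventually.of_forall fun _ => (norm_character _ _).le))).congr
        (Eventually.of_forall fun p => ?_)
      simp only [Function.uncurry, Pi.mul_apply]
      ring
    simp only [← integral_mul_const]
    rw [integral_integral_swap hI]
    refine integral_congr_ae (Eventually.of_forall fun ξ => ?_)
    simp only
    rw [SchwartzMap.fourierInv_coe, fourierInv_eq_integral_character, ← integral_mul_const,
      ← integral_const_mul]
    refine integral_congr_ae (Eventually.of_forall fun x => ?_)
    simp only
    have h4 : character (-ξ) x = character (-x) ξ := by
      rw [character, character]; simp [real_inner_comm]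
    rw [h4]
    ring

theorem windowedFourier_add {d : ℕ} (g : 𝓢(Euc d, ℂ)) (u v : 𝓢'(Euc d, ℂ)) (x ξ : Euc d) :
    windowedFourier g (u + v) x ξ = windowedFourier g u x ξ + windowedFourier g v x ξ := rfl

theorem windowedFourier_smul {d : ℕ} (g : 𝓢(Euc d, ℂ)) (c : ℂ) (u : 𝓢'(Euc d, ℂ))
    (x ξ : Euc d) : windowedFourier g (c • u) x ξ = c * windowedFourier g u x ξ := rfl

/-- A continuous symbol bounded by one in the amalgam space defines a bounded Fourier multiplier on all
modulation spaces. -/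
theorem exists_multiplier {d : ℕ} {g₀ : 𝓢(Euc d, ℂ)} (hg₀ : g₀ ≠ 0) {σ : Euc d → ℂ}
    (hσ : Continuous σ) (hσ1 : ∀ y, ‖σ y‖ ≤ 1) {s : 𝓢'(Euc d, ℂ)}
    (hσs : ∀ φ : 𝓢(Euc d, ℂ), s φ = ∫ y, σ y * φ y)
    (hs : ∀ g : 𝓢(Euc d, ℂ), distAmalgamENorm g s < ∞) {p q : ℝ≥0∞} (hp : 1 ≤ p) (hq : 1 ≤ q) :
    ∃ T : 𝓢'(Euc d, ℂ) →ₗ.[ℂ] 𝓢'(Euc d, ℂ),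
      (∀ f : T.domain, IsMultiplierImage σ f (T f)) ∧
      (∀ φ : 𝓢(Euc d, ℂ), ∃ hφ : ofSchwartz φ ∈ T.domain,
        Represents (fun x => ∫ ξ, Complex.exp (2 * Real.pi * Complex.I * (inner ℝ x ξ : ℝ)) *
          σ ξ * (𝓕 φ) ξ) (T ⟨_, hφ⟩)) ∧
      ∀ g : 𝓢(Euc d, ℂ), g ≠ 0 →
        (∀ f : 𝓢'(Euc d, ℂ), f ∈ T.domain ↔ modulationENorm g p q f < ∞) ∧
        ∃ C : ℝ≥0, ∀ f : T.domain,
          modulationENorm g p q (T f) ≤ C * modulationENorm g p q (f : 𝓢'(Euc d, ℂ)) := by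
  set b := schwartzMul g₀ g₀ with hb
  have hb0 : b ≠ 0 := by
    intro h
    refine hg₀ (SchwartzMap.ext fun y => ?_)
    have h1 : b y = 0 := by rw [h]; rfl
    rw [hb, schwartzMul_apply] at h1
    exact mul_self_eq_zero.1 h1
  -- a product window, so that the windowed Fourier transform of `φ s` is a convolution
  obtain ⟨γ, hγb⟩ := exists_dual_window hb0
  have hbγ : ∫ y, b y * γ y = 1 := by simpa only [mul_comm] using hγb
  have hex : ∀ f : modulationSpace g₀ hp hq, ∃ h : 𝓢'(Euc d, ℂ), ∀ φ : 𝓢(Euc d, ℂ),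
      h φ = ∫ z : Euc d × Euc d, windowedFourier b (distMul φ s) z.1 (-z.2) *
        windowedFourier γ (𝓕 (f : 𝓢'(Euc d, ℂ))) z.1 z.2 := fun f => by
    obtain ⟨M, hM⟩ := exists_norm_windowedFourier_fourier_le hg₀ hp hq f.2 γ
    exact exists_product (hs g₀) g₀ γ hM
  choose H hH using hex
  have hint : ∀ (f : modulationSpace g₀ hp hq) (φ : 𝓢(Euc d, ℂ)),
      Integrable fun z : Euc d × Euc d => windowedFourier b (distMul φ s) z.1 (-z.2) *
        windowedFourier γ (𝓕 (f : 𝓢'(Euc d, ℂ))) z.1 z.2 := fun f φ => by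
    obtain ⟨M, hM⟩ := exists_norm_windowedFourier_fourier_le hg₀ hp hq f.2 γ
    exact integrable_mul_windowedFourier (integrable_windowedFourier_distMul (hs g₀) g₀ φ) hM
      measurable_fst measurable_snd
  have hadd : ∀ f f', H (f + f') = H f + H f' := fun f f' => by
    ext φ
    rw [_root_.add_apply, hH, hH, hH, ← integral_add (hint f φ) (hint f' φ)]
    refine integral_congr_ae (Eventually.of_forall fun z => ?_)
    simp only
    rw [Submodule.coe_add, FourierTransform.fourier_add, windowedFourier_add, mul_add]
  have hsmul : ∀ (c : ℂ) f, H (c • f) = c • H f := fun c f => by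
    ext φ
    rw [_root_.smul_apply, hH, hH, smul_eq_mul, ← integral_const_mul]
    refine integral_congr_ae (Eventually.of_forall fun z => ?_)
    simp only
    rw [Submodule.coe_smul, FourierTransform.fourier_smul, windowedFourier_smul, mul_left_comm]
  let T : 𝓢'(Euc d, ℂ) →ₗ.[ℂ] 𝓢'(Euc d, ℂ) :=
    { domain := modulationSpace g₀ hp hq
      toFun :=
        { toFun := fun f => 𝓕⁻ (H f)
          map_add' := fun f f' => by rw [hadd, FourierTransform.fourierInv_add]
          map_smul' := fun c f => by
            rw [hsmul, FourierTransform.fourierInv_smul, RingHom.id_apply] } }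
  have hT : ∀ f : T.domain, 𝓕 (T f) = H f := fun f => fourier_fourierInv_eq (H f)
  have hbdd : ∀ (f : T.domain) (ψ : 𝓢(Euc d, ℂ)),
      ∃ M : ℝ, ∀ x ξ, ‖windowedFourier ψ (𝓕 (f : 𝓢'(Euc d, ℂ))) x ξ‖ ≤ M := fun f =>
    exists_norm_windowedFourier_fourier_le hg₀ hp hq f.2
  have hmem : ∀ g : 𝓢(Euc d, ℂ), g ≠ 0 → ∀ f : 𝓢'(Euc d, ℂ),
      f ∈ T.domain ↔ modulationENorm g p q f < ∞ := fun g hg f => by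
    obtain ⟨C, hC⟩ := exists_modulationENorm_le hg₀ g
    obtain ⟨C', hC'⟩ := exists_modulationENorm_le hg g₀
    exact ⟨fun hf => (hC p q hp hq f).trans_lt (ENNReal.mul_lt_top ENNReal.coe_lt_top hf),
      fun hf => (hC' p q hp hq f).trans_lt (ENNReal.mul_lt_top ENNReal.coe_lt_top hf)⟩
  refine ⟨T, fun f => ?_, fun φ => ⟨modulationENorm_ofSchwartz_lt_top g₀ φ hp hq, ?_⟩,
    fun g hg => ⟨hmem g hg, ?_⟩⟩
  · rw [IsMultiplierImage, hT]
    exact isProduct_of_apply_eq hbγ (represents_of_apply_eq hσ hσs) hs (hbdd f) (hH f)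
  -- for a Schwartz function `φ`, the product acts as integration against `σ · 𝓕 φ`
  · refine represents_fourierInv hσ hσ1 (𝓕 φ) fun ψ => ?_
    have h1 := hH ⟨ofSchwartz φ, modulationENorm_ofSchwartz_lt_top g₀ φ hp hq⟩
    simp only [ofSchwartz, TemperedDistribution.fourier_toTemperedDistributionCLM_eq] at h1
    rw [product_ofSchwartz_apply hbγ (𝓕 φ) h1 ψ, hσs]
    simp only [schwartzMul_apply]
  · obtain ⟨C₁, hC₁⟩ := exists_modulationENorm_le (conjWindow_fourier_ne_zero hb0) g
    obtain ⟨C₂, hC₂⟩ := exists_modulationENorm_le hg (conjWindow (𝓕 g₀))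
    refine ⟨C₁ * (distAmalgamENorm g₀ s).toNNReal * C₂, fun f => ?_⟩
    obtain ⟨M, hM⟩ := hbdd f γ
    have hW : ∀ x ξ, windowedFourier (schwartzMul g₀ g₀) (𝓕 (T f)) x ξ =
        ∫ η, windowedFourier g₀ s x (ξ - η) *
          windowedFourier g₀ (𝓕 (f : 𝓢'(Euc d, ℂ))) x η := fun x ξ => by
      rw [hT]
      exact windowedFourier_product hbγ hM (hH f) (hs g₀) g₀ x ξ
    calc modulationENorm g p q (T f)
        ≤ C₁ * modulationENorm (conjWindow (𝓕 b)) p q (T f) := hC₁ p q hp hq _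
      _ ≤ C₁ * (distAmalgamENorm g₀ s * (C₂ * modulationENorm g p q (f : 𝓢'(Euc d, ℂ)))) := by
          gcongr
          refine (modulationENorm_product_le hp hq hW).trans ?_
          gcongr
          exact hC₂ p q hp hq _
      _ = _ := by
          push_cast
          rw [ENNReal.coe_toNNReal (hs g₀).ne]
          ring

end TimeFrequency

theorem theorem1p1 (d : ℕ) (g₀ : 𝓢(TimeFrequency.Euc d, ℂ)) (hg₀ : g₀ ≠ 0) :
    -- `e^{iμ}` belongs to `W(𝓕L¹, L^∞)`, with a bound that is uniform in `μ`
    (∀ g : 𝓢(TimeFrequency.Euc d, ℂ), g ≠ 0 → ∃ C : ℝ, 0 < C ∧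
      ∀ μ : TimeFrequency.Euc d → ℝ, TimeFrequency.AdmissiblePhase g₀ μ →
        TimeFrequency.amalgamENorm g (TimeFrequency.unimodular μ) ≤
          ENNReal.ofReal (C * Real.exp (C * ∑ i : Fin d, ∑ j ∈ Finset.Ici i,
            (TimeFrequency.amalgamENorm g₀ (TimeFrequency.secondPartial μ i j)).toReal))) ∧
    -- `e^{iμ(D)}` is a bounded operator on every `M^{p,q}`
    (∀ μ : TimeFrequency.Euc d → ℝ, TimeFrequency.AdmissiblePhase g₀ μ →
      ∀ p q : ℝ≥0∞, 1 ≤ p → 1 ≤ q →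
        ∃ T : 𝓢'(TimeFrequency.Euc d, ℂ) →ₗ.[ℂ] 𝓢'(TimeFrequency.Euc d, ℂ),
          (∀ f : T.domain,
            TimeFrequency.IsMultiplierImage (TimeFrequency.unimodular μ) f (T f)) ∧
          (∀ φ : 𝓢(TimeFrequency.Euc d, ℂ),
            ∃ hφ : SchwartzMap.toTemperedDistributionCLM (TimeFrequency.Euc d) ℂ volume φ
                ∈ T.domain,
              TimeFrequency.Represents
                (fun x => ∫ ξ, Complex.exp (2 * Real.pi * Complex.I * (inner ℝ x ξ : ℝ)) *
                  TimeFrequency.unimodular μ ξ * (𝓕 φ) ξ)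
                (T ⟨_, hφ⟩)) ∧
          ∀ g : 𝓢(TimeFrequency.Euc d, ℂ), g ≠ 0 →
            (∀ f : 𝓢'(TimeFrequency.Euc d, ℂ),
              f ∈ T.domain ↔ TimeFrequency.modulationENorm g p q f < ∞) ∧
            ∃ C : ℝ≥0, ∀ f : T.domain,
              TimeFrequency.modulationENorm g p q (T f) ≤
                C * TimeFrequency.modulationENorm g p q (f : 𝓢'(TimeFrequency.Euc d, ℂ))) := by
  have htemp : ∀ μ : TimeFrequency.Euc d → ℝ, TimeFrequency.AdmissiblePhase g₀ μ →
      ∃ u : 𝓢'(TimeFrequency.Euc d, ℂ), ∀ φ : 𝓢(TimeFrequency.Euc d, ℂ),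
        u φ = ∫ y, TimeFrequency.unimodular μ y * φ y := fun μ hμ =>
    TimeFrequency.exists_tempered_of_bounded
      (TimeFrequency.continuous_unimodular hμ.1.continuous)
      fun y => (TimeFrequency.norm_unimodular μ y).le
  refine ⟨fun g _ => ?_, fun μ hμ p q hp hq => ?_⟩
  · obtain ⟨C, hC, h⟩ := TimeFrequency.exists_distAmalgamENorm_unimodular_le hg₀ g
    refine ⟨C, hC, fun μ hμ => ?_⟩
    obtain ⟨u, hu⟩ := htemp μ hμ
    have hrep := TimeFrequency.represents_of_apply_eq
      (TimeFrequency.continuous_unimodular hμ.1.continuous) hu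
    exact (iInf₂_le u hrep).trans (h μ hμ u hrep)
  · obtain ⟨s, hs⟩ := htemp μ hμ
    have hσ := TimeFrequency.continuous_unimodular hμ.1.continuous
    refine TimeFrequency.exists_multiplier hg₀ hσ
      (fun y => (TimeFrequency.norm_unimodular μ y).le) hs (fun g => ?_) hp hq
    obtain ⟨C, -, h⟩ := TimeFrequency.exists_distAmalgamENorm_unimodular_le hg₀ g
    exact (h μ hμ s (TimeFrequency.represents_of_apply_eq hσ hs)).trans_lt ENNReal.ofReal_lt_top
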